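/- Singly periodic zero-mode formulas. Let $\xi>0$, let $\rho=|(r_2,r_3)|$, $V=\xi^2\rho^2$, $\tilde r_i=r_i/\rho$, and $$\varphi_0=E_1(V)+\log(\rho^2)+1,\qquad \varphi_1=1-e^{-V},\qquad \varphi_2=\varphi_1-Ve^{-V},\qquad E_\nu(a)=\int_1^\infty e^{-at}t^{-\nu}\,dt .$$ For $k\in\mathbb R^3$ put $\hat H(k)=4\pi/|k|^2$, $\hat B(k)=-8\pi/|k|^4$, $\hat\gamma_E(k)=e^{-|k|^2/(2\xi)^2}$, $\hat\gamma_H(k)=e^{-|k|^2/(2\xi)^2}\bigl(1+|k|^2/(2\xi)^2\bigr)$, and consider the operators $$K^S_{jl}=\delta_{jl}\nabla^2-\nabla_j\nabla_l,\quad K^\Omega_{jl}=-\epsilon_{jlm}\nabla_m,\quad K^T_{jlm}=(\delta_{jl}\nabla_m+\delta_{mj}\nabla_l+\delta_{lm}\nabla_j)\nabla^2-2\nabla_j\nabla_l\nabla_m$$ with symbols $\hat K$ obtained by $\nabla\mapsto ik$; set $\hat S^F=\hat K^S\hat B\hat\gamma_H$, $\hat\Omega^F=\hat K^\Omega\hat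 H\hat\gamma_E$, $\hat T^F=\hat K^T\hat B\hat\gamma_H$. Functions of $(r_2,r_3)$ are regarded as functions on $\mathbb R^3$ independent of $r_1$ when these operators are applied. Write $\mathcal F^{-1}g(r)=(2\pi)^{-2}\int_{\mathbb R^2}g(\kappa)e^{i\kappa\cdot r}\,d\kappa$ for the inverse Fourier transform in the two free directions. We say that $f$ is a distributional inverse Fourier transform of $g$ of order $m$ if $f$ defines a tempered distribution on $\mathbb R^2$ and, for every Schwartz function $\psi$ whose derivatives of order $<m$ vanish at $0$, $g\psi$ is integrable and $\int f(r)\,\hat\psi(r)\,dr=\int g\psi$, where $\hat\psi(r)=\int\psi(\kappa)e^{-i\kappa\cdot r}d\kappa$. **Harmonic kernel.** For $k_1\ne0$, $\bar H(k_1,r)=2K_0(|k_1|\rho)$ is a distributional inverse transform of $\hat H(k_1,\cdot)$ of order $0$, the function $(\hat H\hat\gamma_E)(k_1,\cdot)$ is integrable, and with $\bar H^F(k_1,\cdot)=\mathcal F^{-1}\{(\hat H\hat\gamma_E)(k_1,\cdot)\}$ one has, for $r\ne0$, $\lim_{k_1\to0}(\bar H(k_1,r)-\bar H^F(k_1,r))=E_1(\xi^2\rho^2)$.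 For every $\ell_H>0$, $\bar H(0,r)=-2\log(\rho/\ell_H)$ is a distributional inverse transform of $\hat H(0,\cdot)$ of order $1$, and $$Q^{H,(0)}:=\bar H(0,\cdot)-\lim_{k_1\to0}\bigl(\bar H(k_1,\cdot)-\bar H^F(k_1,\cdot)\bigr)$$ is one of $(\hat H\hat\gamma_E)(0,\cdot)$ of order $1$; for $r\neq 0$, $Q^{H,(0)}=-\log(\rho^2/\ell_H^2)-E_1(\xi^2\rho^2)$. **Biharmonic kernel.** For $k_1\ne0$, $\hat B(k_1,\cdot)$ and $(\hat B\hat\gamma_H)(k_1,\cdot)$ are integrable; let $\bar B(k_1,\cdot)$, $\bar B^F(k_1,\cdot)$ be their inverse transforms $\mathcal F^{-1}$. Then $\bar B(k_1,r)=-\frac{2\rho}{|k_1|}K_1(|k_1|\rho)$ for $r\ne0$, and for all $r$ (including $r=0$) $\lim_{k_1\to0}(\bar B(k_1,r)-\bar B^F(k_1,r))=-\frac1{2\xi^2}E_2(\xi^2\rho^2)$. For every $\ell_B>0$, $\bar B(0,r)=-\rho^2\log(\rho/\ell_B)$ is a distributional inverse transform of $\hat B(0,\cdot)$ of order $3$,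 and $$Q^{B,(0)}_{\ell_B}:=\bar B(0,\cdot)-\lim_{k_1\to0}\bigl(\bar B(k_1,\cdot)-\bar B^F(k_1,\cdot)\bigr)$$ is one of $(\hat B\hat\gamma_H)(0,\cdot)$ of order $3$; it is of class $C^3$ on $\mathbb R^2$ and $$Q^{B,(0)}_{\ell_B}(r_2,r_3)=-\rho^2\log(\rho/\ell_B)+\frac1{2\xi^2}E_2(\xi^2\rho^2)$$ (with $\rho^2\log(\rho/\ell_B)=0$ at $\rho=0$). **Rotlet.** $\hat\Omega^F(0,\cdot)$ is integrable, and $Q^{\Omega,(0)}:=\mathcal F^{-1}\{\hat\Omega^F(0,\cdot)\}$ satisfies, for $r\ne0$ and every $\ell_H>0$ (with $Q^{H,(0)}$ differentiable at $r$), $$Q^{\Omega,(0)}=K^\Omega Q^{H,(0)}=\frac{2\varphi_1}{\rho}\begin{bmatrix}0&\tilde r_3&-\tilde r_2\\-\tilde r_3&0&0\\\tilde r_2&0&0\end{bmatrix},$$ and $\lim_{r\to0}Q^{\Omega,(0)}(r)=Q^{\Omega,(0)}(0)=0$. **Stokeslet.** For $\ell_B>0$ let $Q^{S,(0)}_{\ell_B}:=K^SQ^{B,(0)}_{\ell_B}$.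 Each of its entries is a distributional inverse transform of order $1$ of the corresponding entry of $\hat S^F(0,\cdot)$, $Q^{S,(0)}_{\ell_B}=Q^{S,(0)}_{1}+\log(\ell_B)\,\mathrm{diag}(4,2,2)$ everywhere, and $Q^{S,(0)}:=Q_1^{S,(0)}$ satisfies, for $r\ne0$, $$Q^{S,(0)}=-\begin{bmatrix}2(\varphi_0+\varphi_1)&0&0\\0&\varphi_0+2\tilde r_3^2\varphi_1&-2\tilde r_2\tilde r_3\varphi_1\\0&-2\tilde r_2\tilde r_3\varphi_1&\varphi_0+2\tilde r_2^2\varphi_1\end{bmatrix},$$ and $\lim_{r\to0}Q^{S,(0)}(r)=Q^{S,(0)}(0)=(\gamma+\log(\xi^2)-1)\,\mathrm{diag}(2,1,1)$, with $\gamma$ the Euler–Mascheroni constant. **Stresslet.** $\hat T^F(0,\cdot)$ is integrable, and $Q^{T,(0)}:=\mathcal F^{-1}\{\hat T^F(0,\cdot)\}$ satisfies $Q^{T,(0)}=K^TQ^{B,(0)}_{\ell_B}$ everywhere, for every $\ell_B>0$. It is totally symmetric in its three indices and, for $r\ne0$, with $R=-4/\rho$, $$\begin{aligned} &Q^{T,(0)}_{111}=Q^{T,(0)}_{122}=Q^{T,(0)}_{123}=Q^{T,(0)}_{133}=0,\\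 &Q^{T,(0)}_{112}=R\tilde r_2(2\varphi_1-\varphi_2),\qquad Q^{T,(0)}_{113}=R\tilde r_3(2\varphi_1-\varphi_2),\\ &Q^{T,(0)}_{222}=R\tilde r_2\bigl(3\varphi_1-(\tilde r_2^2+3\tilde r_3^2)\varphi_2\bigr),\qquad Q^{T,(0)}_{223}=R\tilde r_3\bigl(\varphi_1-(\tilde r_3^2-\tilde r_2^2)\varphi_2\bigr),\\ &Q^{T,(0)}_{233}=R\tilde r_2\bigl(\varphi_1-(\tilde r_2^2-\tilde r_3^2)\varphi_2\bigr),\qquad Q^{T,(0)}_{333}=R\tilde r_3\bigl(3\varphi_1-(3\tilde r_2^2+\tilde r_3^2)\varphi_2\bigr), \end{aligned}$$ and $\lim_{r\to0}Q^{T,(0)}(r)=Q^{T,(0)}(0)=0$. Here $K_0,K_1$ of one argument are the modified Bessel functions of the second kind. -/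

import Mathlib

open MeasureTheory Filter Topology Set
open scoped SchwartzMap

noncomputable section

namespace SinglyPeriodic

/-- Vectors in all three directions; components `0, 1, 2` are the directions `1, 2, 3`, and
direction `1` is the periodic one. -/
abbrev E3 := EuclideanSpace ℝ (Fin 3)

/-- Vectors in the two free directions; components `0, 1` are the directions `2, 3`. -/
abbrev E2 := EuclideanSpace ℝ (Fin 2)

/-- The vector `(a, v₂, v₃)`. -/
def join (a : ℝ) (v : E2) : E3 := !₂[a, v 0, v 1]

/-- A function of the free variables `(r₂, r₃)`, as a function on `ℝ³` independent of `r₁`. -/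
def lift (f : E2 → ℂ) : E3 → ℂ := fun r => f !₂[r 1, r 2]

/-- Kronecker delta. -/
def kron (j l : Fin 3) : ℂ := if j = l then 1 else 0

/-- Levi-Civita symbol. -/
def eps (j l m : Fin 3) : ℂ :=
  ((l : ℂ) - (j : ℂ)) * ((m : ℂ) - (j : ℂ)) * ((m : ℂ) - (l : ℂ)) / 2

/-! ### Special functions -/

/-- Modified Bessel function of the second kind, for `x > 0`. -/
def besselK (ν x : ℝ) : ℝ :=
  ∫ t in Ioi (0 : ℝ), Real.exp (-x * Real.cosh t) * Real.cosh (ν * t)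

/-- Incomplete modified Bessel function of the second kind. -/
def incBesselK (ν : ℤ) (a b : ℝ) : ℝ :=
  ∫ t in Ioi (1 : ℝ), Real.exp (-a * t - b / t) / t ^ (ν + 1)

/-- Exponential integral `E_ν(a) = ∫₁^∞ e^{-a t} t^{-ν} dt`. -/
def expInt (ν : ℤ) (a : ℝ) : ℝ := incBesselK (ν - 1) a 0

/-! ### Fourier symbols of the kernels -/

/-- Symbol of the harmonic kernel `1/|r|`. -/
def harmHat (k : E3) : ℂ := 4 * (Real.pi : ℂ) / (‖k‖ : ℂ) ^ 2

/-- Symbol of the biharmonic kernel `|r|`. -/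
def biharmHat (k : E3) : ℂ := -(8 * (Real.pi : ℂ)) / (‖k‖ : ℂ) ^ 4

/-- Fourier transform of the Ewald screening function. -/
def ewaldHat (ξ : ℝ) (k : E3) : ℂ := Complex.exp (-(‖k‖ : ℂ) ^ 2 / (2 * (ξ : ℂ)) ^ 2)

/-- Fourier transform of the Hasimoto screening function. -/
def hasimotoHat (ξ : ℝ) (k : E3) : ℂ :=
  Complex.exp (-(‖k‖ : ℂ) ^ 2 / (2 * (ξ : ℂ)) ^ 2) * (1 + (‖k‖ : ℂ) ^ 2 / (2 * (ξ : ℂ)) ^ 2)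

/-- Symbol of `δ_{jl} ∇² - ∇_j ∇_l`. -/
def stokesletOpHat (j l : Fin 3) (k : E3) : ℂ :=
  -kron j l * (‖k‖ : ℂ) ^ 2 + (k j : ℂ) * (k l : ℂ)

/-- Symbol of `-ε_{jlm} ∇_m`. -/
def rotletOpHat (j l : Fin 3) (k : E3) : ℂ :=
  -∑ m : Fin 3, eps j l m * Complex.I * (k m : ℂ)

/-- Symbol of `(δ_{jl} ∇_m + δ_{mj} ∇_l + δ_{lm} ∇_j) ∇² - 2 ∇_j ∇_l ∇_m`. -/
def stressletOpHat (j l m : Fin 3) (k : E3) : ℂ :=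
  -Complex.I * (kron j l * (k m : ℂ) + kron m j * (k l : ℂ) + kron l m * (k j : ℂ))
      * (‖k‖ : ℂ) ^ 2
    + 2 * Complex.I * (k j : ℂ) * (k l : ℂ) * (k m : ℂ)

/-- Fourier transform of the Fourier-space part of the stokeslet. -/
def stokesletHatF (ξ : ℝ) (j l : Fin 3) (k : E3) : ℂ :=
  stokesletOpHat j l k * biharmHat k * hasimotoHat ξ k

/-- Fourier transform of the Fourier-space part of the rotlet. -/
def rotletHatF (ξ : ℝ) (j l : Fin 3) (k : E3) : ℂ :=
  rotletOpHat j l k * harmHat k * ewaldHat ξ k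

/-- Fourier transform of the Fourier-space part of the stresslet. -/
def stressletHatF (ξ : ℝ) (j l m : Fin 3) (k : E3) : ℂ :=
  stressletOpHat j l m k * biharmHat k * hasimotoHat ξ k

/-! ### Differential operators on functions on `ℝ³` -/

/-- Partial derivative `∇_m`. -/
def grad (m : Fin 3) (f : E3 → ℂ) : E3 → ℂ :=
  fun r => fderiv ℝ f r (EuclideanSpace.single m (1 : ℝ))

/-- `∇² = ∇₁² + ∇₂² + ∇₃²`. -/
def lapl (f : E3 → ℂ) : E3 → ℂ := fun r => ∑ m : Fin 3, grad m (grad m f) r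

/-- `δ_{jl} ∇² - ∇_j ∇_l`. -/
def stokesletOp (j l : Fin 3) (f : E3 → ℂ) : E3 → ℂ :=
  fun r => kron j l * lapl f r - grad j (grad l f) r

/-- `-ε_{jlm} ∇_m`. -/
def rotletOp (j l : Fin 3) (f : E3 → ℂ) : E3 → ℂ :=
  fun r => -∑ m : Fin 3, eps j l m * grad m f r

/-- `(δ_{jl} ∇_m + δ_{mj} ∇_l + δ_{lm} ∇_j) ∇² - 2 ∇_j ∇_l ∇_m`. -/
def stressletOp (j l m : Fin 3) (f : E3 → ℂ) : E3 → ℂ :=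
  fun r => kron j l * grad m (lapl f) r + kron m j * grad l (lapl f) r
    + kron l m * grad j (lapl f) r - 2 * grad j (grad l (grad m f)) r

/-! ### Fourier transforms in the free directions -/

/-- `∫ f(r) e^{-i κ·r} dr` over `ℝ²`. -/
def ft2 (f : E2 → ℂ) (κ : E2) : ℂ :=
  ∫ r : E2, f r * Complex.exp (-Complex.I * ((inner ℝ κ r : ℝ) : ℂ))

/-- Classical inverse transform `(2π)⁻² ∫ g(κ) e^{i κ·r} dκ` over `ℝ²`. -/
def invFt2 (g : E2 → ℂ) (r : E2) : ℂ :=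
  1 / (2 * (Real.pi : ℂ)) ^ 2 *
    ∫ κ : E2, g κ * Complex.exp (Complex.I * ((inner ℝ κ r : ℝ) : ℂ))

/-- `f` is an inverse Fourier transform, in the distributional sense, of a function `g` that may
have a non-integrable singularity at the origin. The function `f` defines a tempered distribution,
and its Fourier transform is given by absolutely convergent integration against `g` on all
Schwartz functions whose derivatives of order `< m` vanish at the origin. For `m = 0` these are
all Schwartz functions; for `m ≥ 1` the condition determines `f` up to polynomials of
degree `< m`. -/
def IsDistribInvFt (m : ℕ) (g f : E2 → ℂ) : Prop :=
  (∀ ψ : 𝓢(E2, ℂ), Integrable fun r => f r * ψ r) ∧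
  ∀ ψ : 𝓢(E2, ℂ), (∀ n < m, iteratedFDeriv ℝ n (ψ : E2 → ℂ) 0 = 0) →
    (Integrable fun κ => g κ * ψ κ) ∧
    ∫ r : E2, f r * ft2 ψ r = ∫ κ : E2, g κ * ψ κ

/-! ### The harmonic and biharmonic zero modes -/

/-- Inverse transform of `harmHat (k₁, ·, ·)` for `k₁ ≠ 0`. -/
def harmBar (k₁ : ℝ) (r : E2) : ℂ := ((2 * besselK 0 (|k₁| * ‖r‖) : ℝ) : ℂ)

/-- Inverse transform of the screened harmonic kernel for `k₁ ≠ 0`. -/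
def harmBarF (ξ k₁ : ℝ) (r : E2) : ℂ :=
  invFt2 (fun κ => harmHat (join k₁ κ) * ewaldHat ξ (join k₁ κ)) r

/-- The two-dimensional harmonic kernel with gauge constant `ℓ`. -/
def harmBarZero (ℓ : ℝ) (r : E2) : ℂ := ((-2 * Real.log (‖r‖ / ℓ) : ℝ) : ℂ)

/-- Zero mode of the screened harmonic kernel, `H(0) - lim_{k₁ → 0} (H(k₁) - H^F(k₁))`. -/
def harmZeroMode (ξ ℓ : ℝ) (r : E2) : ℂ :=
  harmBarZero ℓ r - limUnder (𝓝[≠] (0 : ℝ)) fun k₁ => harmBar k₁ r - harmBarF ξ k₁ r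

/-- Inverse transform of `biharmHat (k₁, ·, ·)` for `k₁ ≠ 0`. -/
def biharmBar (k₁ : ℝ) (r : E2) : ℂ := invFt2 (fun κ => biharmHat (join k₁ κ)) r

/-- Inverse transform of the screened biharmonic kernel for `k₁ ≠ 0`. -/
def biharmBarF (ξ k₁ : ℝ) (r : E2) : ℂ :=
  invFt2 (fun κ => biharmHat (join k₁ κ) * hasimotoHat ξ (join k₁ κ)) r

/-- The two-dimensional biharmonic kernel with gauge constant `ℓ`. -/
def biharmBarZero (ℓ : ℝ) (r : E2) : ℂ := ((-‖r‖ ^ 2 * Real.log (‖r‖ / ℓ) : ℝ) : ℂ)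

/-- Zero mode of the screened biharmonic kernel, `B(0) - lim_{k₁ → 0} (B(k₁) - B^F(k₁))`. -/
def biharmZeroMode (ξ ℓ : ℝ) (r : E2) : ℂ :=
  biharmBarZero ℓ r - limUnder (𝓝[≠] (0 : ℝ)) fun k₁ => biharmBar k₁ r - biharmBarF ξ k₁ r

/-! ### The zero modes of the Stokes kernels -/

/-- Rotlet: the (absolutely convergent) Fourier integral. -/
def rotletZeroMode (ξ : ℝ) (r : E2) : Matrix (Fin 3) (Fin 3) ℂ :=
  Matrix.of fun j l => invFt2 (fun κ => rotletHatF ξ j l (join 0 κ)) r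

/-- Stokeslet: the Fourier integral exists only in the distributional sense; it is realised by
the stokeslet operator acting on the biharmonic zero mode with gauge constant `ℓ`. -/
def stokesletZeroMode (ξ ℓ : ℝ) (r : E2) : Matrix (Fin 3) (Fin 3) ℂ :=
  Matrix.of fun j l => stokesletOp j l (lift (biharmZeroMode ξ ℓ)) (join 0 r)

/-- Stresslet: the (absolutely convergent) Fourier integral. -/
def stressletZeroMode (ξ : ℝ) (r : E2) (j l m : Fin 3) : ℂ :=
  invFt2 (fun κ => stressletHatF ξ j l m (join 0 κ)) r

/-! ### Auxiliary variables -/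

/-- `r̃₂ = r₂ / ρ`. -/
def rt2 (r : E2) : ℝ := r 0 / ‖r‖

/-- `r̃₃ = r₃ / ρ`. -/
def rt3 (r : E2) : ℝ := r 1 / ‖r‖

/-- `V = ξ² ρ²`. -/
def auxV (ξ : ℝ) (r : E2) : ℝ := ξ ^ 2 * ‖r‖ ^ 2

/-- `φ₀ = E₁(V) + log(ρ²) + 1`. -/
def phi0 (ξ : ℝ) (r : E2) : ℝ := expInt 1 (auxV ξ r) + Real.log (‖r‖ ^ 2) + 1

/-- `φ₁ = 1 - e^{-V}`. -/
def phi1 (ξ : ℝ) (r : E2) : ℝ := 1 - Real.exp (-auxV ξ r)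

/-- `φ₂ = φ₁ - V e^{-V}`. -/
def phi2 (ξ : ℝ) (r : E2) : ℝ := phi1 ξ r - auxV ξ r * Real.exp (-auxV ξ r)

end SinglyPeriodic

end

/-!
All the kernels are superpositions of heat kernels. With `x = |k|²`,

* `4π / x = ∫₀^∞ 4π e^{-tx} dt` and `8π / x² = ∫₀^∞ 8π t e^{-tx} dt`,
* multiplication by the Ewald, respectively Hasimoto, screening function restricts these integrals to
  `t > 1 / (4ξ²)`.

In the plane, `e^{-t|κ|²}` is the transform of `(4πt)⁻¹ e^{-|r|²/(4t)}`. Fubini's theorem therefore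
identifies the inverse transforms, classically (`invFt2_heatSym`) or in the sense of distributions
(`heat_superposition_pairing`), depending on the integrability of the weight. The integrals over
`t ∈ (0, ∞)` are Bessel functions, those over `t ∈ (0, 1/(4ξ²))` are the exponential integrals
`E₁(ξ²ρ²)` and `E₂(ξ²ρ²) / (2ξ²)`; these are the limits of the splitting as `k₁ → 0`.

At `k₁ = 0` the integrals over `(0, ∞)` diverge at `t = ∞`. Truncating them at `t = 1 / (4η²)` and
letting `η → 0`, the expansion `E₁(x) = -γ - log x + Ein x` shows that the truncated kernel is the
logarithmic kernel, plus a diverging constant (in the biharmonic case, plus a diverging combination of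
`1` and `ρ²`), plus a remainder that tends to zero. The pairing with a test function that vanishes to the
right order at the origin converges, so the diverging terms are paired with zero
(`isWeakInvFt_harmBarZero`, `isWeakInvFt_biharmBarZero`).

The logarithms cancel in the zero modes: these are `G(ρ²)` with smooth profiles `G` built from the
entire function `Ein`. The Stokes kernels follow by differentiation. A derivative multiplies the symbol
by `iκ_j` and lowers the order of the distributional inverse transform by one (`IsWeakInvFt.pd`,
integration by parts), and a continuous distributional inverse transform of order `0` of an integrable
symbol is the classical one (`IsWeakInvFt.eq_invFt2`). The closed formulas are the derivatives of
`G(ρ²)`.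
-/

namespace SinglyPeriodic

/-! ### Superpositions of heat kernels -/

/-- The symbol `∫_S w(t) e^{-t|κ|²} dt`: a superposition of heat semigroup symbols. -/
noncomputable def heatSym (S : Set ℝ) (w : ℝ → ℝ) (κ : E2) : ℝ :=
  ∫ t in S, w t * Real.exp (-(t * ‖κ‖ ^ 2))

/-- The kernel `∫_S w(t) (4πt)⁻¹ e^{-|r|²/(4t)} dt`: the same superposition in real space. -/
noncomputable def heatKer (S : Set ℝ) (w : ℝ → ℝ) (r : E2) : ℝ :=
  ∫ t in S, w t * (Real.exp (-(‖r‖ ^ 2 / (4 * t))) / (4 * Real.pi * t))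

lemma integrable_exp_neg_mul_norm_sq {b : ℝ} (hb : 0 < b) :
    Integrable fun x : E2 => Real.exp (-(b * ‖x‖ ^ 2)) := by
  have h := (GaussianFourier.integrable_cexp_neg_mul_sq_norm_add (V := E2) (b := (b : ℂ))
    (by simpa using hb) 0 0).norm
  refine h.congr (Eventually.of_forall fun x => ?_)
  simp only [Complex.norm_exp]
  congr 1
  simp [← Complex.ofReal_pow]

lemma integral_exp_neg_mul_norm_sq {b : ℝ} (hb : 0 < b) :
    ∫ x : E2, Real.exp (-(b * ‖x‖ ^ 2)) = Real.pi / b := by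
  have h := GaussianFourier.integral_rexp_neg_mul_sq_norm (V := E2) hb
  simpa [neg_mul] using h

lemma integrable_gaussian_mul_plane_wave {b : ℝ} (hb : 0 < b) (c : ℂ) (w : E2) :
    Integrable fun v : E2 => (Real.exp (-(b * ‖v‖ ^ 2)) : ℂ) *
      Complex.exp (c * ((inner ℝ v w : ℝ) : ℂ)) := by
  have h := GaussianFourier.integrable_cexp_neg_mul_sq_norm_add (V := E2) (b := (b : ℂ))
    (by simpa using hb) c w
  refine h.congr (Eventually.of_forall fun x => ?_)
  simp only [Complex.exp_add, real_inner_comm x w]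
  push_cast
  simp

lemma integral_gaussian_mul_plane_wave {b : ℝ} (hb : 0 < b) (c : ℂ) (w : E2) :
    ∫ v : E2, (Real.exp (-(b * ‖v‖ ^ 2)) : ℂ) * Complex.exp (c * ((inner ℝ v w : ℝ) : ℂ)) =
      (Real.pi / b) * Complex.exp (c ^ 2 * (‖w‖ : ℂ) ^ 2 / (4 * b)) := by
  have h := GaussianFourier.integral_cexp_neg_mul_sq_norm_add (V := E2) (b := (b : ℂ))
    (by simpa using hb) c w
  rw [← (show _ = (Real.pi / b) * Complex.exp (c ^ 2 * (‖w‖ : ℂ) ^ 2 / (4 * b)) by simpa using h)]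
  refine integral_congr_ae (Eventually.of_forall fun x => ?_)
  simp only [Complex.exp_add, real_inner_comm x w]
  push_cast
  simp

/-- Fubini for a superposition `∫_S w(t) k(t, ·) dt` of kernels paired with `φ`, under the
integrability of `w(t) / (1 + t)`. -/
lemma integrable_superposition {S : Set ℝ} (hS : MeasurableSet S) (hS0 : S ⊆ Ioi 0) {w : ℝ → ℝ}
    (hw : Measurable w) (hw1 : IntegrableOn (fun t => w t / (1 + t)) S)
    {k : ℝ → E2 → ℝ} (hk : Measurable (Function.uncurry k)) {φ : E2 → ℂ} (hφ : Continuous φ)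
    (hi : ∀ t > 0, Integrable fun x => k t x * φ x) {K : ℝ}
    (hK : ∀ t > 0, ∫ x, ‖k t x * φ x‖ ≤ K / (1 + t)) :
    Integrable (fun p : ℝ × E2 => (w p.1 : ℂ) * (k p.1 p.2 * φ p.2))
      ((volume.restrict S).prod volume) := by
  have hm : Measurable fun p : ℝ × E2 => (w p.1 : ℂ) * (k p.1 p.2 * φ p.2) :=
    ((hw.comp measurable_fst).complex_ofReal).mul
      (hk.complex_ofReal.mul (hφ.measurable.comp measurable_snd))
  rw [integrable_prod_iff hm.aestronglyMeasurable]
  refine ⟨(ae_restrict_iff' hS).2 (Eventually.of_forall fun t ht => (hi t (hS0 ht)).const_mul (w t : ℂ)), ?_⟩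
  refine (hw1.norm.const_mul K).mono' ?_ ?_
  · exact hm.norm.stronglyMeasurable.integral_prod_right.aestronglyMeasurable
  · refine (ae_restrict_iff' hS).2 (Eventually.of_forall fun t ht => ?_)
    have ht' : 0 < t := hS0 ht
    simp only [norm_mul (w t : ℂ), integral_const_mul]
    rw [Real.norm_of_nonneg (mul_nonneg (norm_nonneg _) (integral_nonneg fun _ => norm_nonneg _)),
      norm_div, Real.norm_of_nonneg (by linarith : 0 ≤ 1 + t), Complex.norm_real]
    calc ‖w t‖ * _ ≤ ‖w t‖ * (K / (1 + t)) := by gcongr; exact hK t ht'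
      _ = _ := by ring

lemma exists_integral_gaussian_mul_le (φ : 𝓢(E2, ℂ)) :
    ∃ K, ∀ t > 0, ∫ x : E2, ‖(Real.exp (-(t * ‖x‖ ^ 2)) : ℂ) * φ x‖ ≤ K / (1 + t) := by
  set C := SchwartzMap.seminorm ℂ 0 0 φ
  have hC : ∀ x, ‖φ x‖ ≤ C := SchwartzMap.norm_le_seminorm ℂ φ
  refine ⟨(∫ x, ‖φ x‖) + C * Real.pi, fun t ht => ?_⟩
  have h0 : ∀ x : E2, ‖(Real.exp (-(t * ‖x‖ ^ 2)) : ℂ) * φ x‖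
      = Real.exp (-(t * ‖x‖ ^ 2)) * ‖φ x‖ := fun x => by
    rw [norm_mul, Complex.norm_real, Real.norm_of_nonneg (Real.exp_pos _).le]
  have hle : ∀ x : E2, Real.exp (-(t * ‖x‖ ^ 2)) ≤ 1 := fun x =>
    Real.exp_le_one_iff.2 (by nlinarith [sq_nonneg ‖x‖])
  have hi : Integrable fun x : E2 => Real.exp (-(t * ‖x‖ ^ 2)) * ‖φ x‖ :=
    φ.integrable.norm.bdd_mul (c := 1) (by fun_prop)
      (Eventually.of_forall fun x => by
        rw [Real.norm_of_nonneg (Real.exp_pos _).le]; exact hle x)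
  simp only [h0]
  rw [le_div_iff₀ (by positivity)]
  have h1 : ∫ x : E2, Real.exp (-(t * ‖x‖ ^ 2)) * ‖φ x‖ ≤ ∫ x, ‖φ x‖ :=
    integral_mono hi φ.integrable.norm fun x =>
      mul_le_of_le_one_left (norm_nonneg _) (hle x)
  have h2 : ∫ x : E2, Real.exp (-(t * ‖x‖ ^ 2)) * ‖φ x‖ ≤ Real.pi / t * C := by
    rw [← integral_exp_neg_mul_norm_sq ht, ← integral_mul_const]
    exact integral_mono hi ((integrable_exp_neg_mul_norm_sq ht).mul_const _) fun x =>
      mul_le_mul_of_nonneg_left (hC x) (Real.exp_pos _).le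
  have h3 : (∫ x : E2, Real.exp (-(t * ‖x‖ ^ 2)) * ‖φ x‖) * t ≤ C * Real.pi := by
    calc _ ≤ Real.pi / t * C * t := by gcongr
      _ = _ := by field_simp
  linarith

lemma integrable_gaussian_mul (φ : 𝓢(E2, ℂ)) {t : ℝ} (ht : 0 < t) :
    Integrable fun x : E2 => (Real.exp (-(t * ‖x‖ ^ 2)) : ℂ) * φ x :=
  φ.integrable.bdd_mul (c := 1) (by fun_prop) (Eventually.of_forall fun x => by
    rw [Complex.norm_real, Real.norm_of_nonneg (Real.exp_pos _).le]
    exact Real.exp_le_one_iff.2 (by nlinarith [sq_nonneg ‖x‖]))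

/-- The two-dimensional heat kernel at time `t`. -/
noncomputable def heat (t : ℝ) (r : E2) : ℝ := Real.exp (-(‖r‖ ^ 2 / (4 * t))) / (4 * Real.pi * t)

lemma heat_eq (t : ℝ) (r : E2) :
    heat t r = (4 * Real.pi * t)⁻¹ * Real.exp (-((4 * t)⁻¹ * ‖r‖ ^ 2)) := by
  rw [heat, div_eq_inv_mul]; congr 3; rw [div_eq_inv_mul]

lemma measurable_heat : Measurable (Function.uncurry heat) := by
  unfold heat Function.uncurry; fun_prop

lemma integrable_heat_mul (φ : 𝓢(E2, ℂ)) {t : ℝ} (ht : 0 < t) :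
    Integrable fun x : E2 => (heat t x : ℂ) * φ x := by
  have := (integrable_gaussian_mul φ (t := (4 * t)⁻¹) (by positivity)).const_mul
    ((4 * Real.pi * t : ℝ)⁻¹ : ℂ)
  refine this.congr (Eventually.of_forall fun x => ?_)
  simp only [heat_eq]
  push_cast
  ring

lemma exists_integral_heat_mul_le (φ : 𝓢(E2, ℂ)) :
    ∃ K, ∀ t > 0, ∫ x : E2, ‖(heat t x : ℂ) * φ x‖ ≤ K / (1 + t) := by
  obtain ⟨K, hK⟩ := exists_integral_gaussian_mul_le φ
  refine ⟨K / Real.pi, fun t ht => ?_⟩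
  have h0 : ∀ x : E2, ‖(heat t x : ℂ) * φ x‖ = (4 * Real.pi * t)⁻¹ *
      ‖(Real.exp (-((4 * t)⁻¹ * ‖x‖ ^ 2)) : ℂ) * φ x‖ := fun x => by
    rw [heat_eq, Complex.ofReal_mul, mul_assoc, norm_mul, Complex.norm_real,
      Real.norm_of_nonneg (by positivity)]
  simp only [h0, integral_const_mul]
  have hK0 : 0 ≤ K := by
    have := (integral_nonneg fun x => norm_nonneg _).trans (hK 1 one_pos)
    by_contra! h
    linarith
  calc _ ≤ (4 * Real.pi * t)⁻¹ * (K / (1 + (4 * t)⁻¹)) := by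
        gcongr; exact hK _ (by positivity)
    _ = K / Real.pi / (1 + 4 * t) := by field_simp; ring
    _ ≤ _ := by gcongr; linarith

/-- `ft2` on Schwartz functions, as a rescaled version of the Fourier transform of Mathlib. -/
noncomputable def ft2S (ψ : 𝓢(E2, ℂ)) : 𝓢(E2, ℂ) :=
  SchwartzMap.compCLMOfContinuousLinearEquiv ℂ
    (ContinuousLinearEquiv.smulLeft (R₁ := ℝ) (M₁ := E2)
      (Units.mk0 (2 * Real.pi)⁻¹ (by positivity)))
    (FourierTransform.fourier ψ)

lemma ft2S_apply_eq (ψ : 𝓢(E2, ℂ)) (κ : E2) :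
    ft2S ψ κ = (FourierTransform.fourier ψ : 𝓢(E2, ℂ)) ((2 * Real.pi)⁻¹ • κ) := rfl

lemma ft2S_apply (ψ : 𝓢(E2, ℂ)) (κ : E2) : ft2S ψ κ = ft2 ψ κ := by
  rw [ft2S_apply_eq, SchwartzMap.fourier_coe, Real.fourier_eq', ft2]
  refine integral_congr_ae (Eventually.of_forall fun v => ?_)
  simp only [smul_eq_mul, mul_comm (ψ v)]
  congr 2
  rw [inner_smul_right, real_inner_comm v κ]
  have : (Real.pi : ℂ) ≠ 0 := by exact_mod_cast Real.pi_ne_zero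
  push_cast
  field_simp

/-- The heat semigroup in Fourier space: `∫ heat t · ft2 φ = ∫ e^{-t|κ|²} φ`. -/
lemma integral_heat_mul_ft2 (φ : 𝓢(E2, ℂ)) {t : ℝ} (ht : 0 < t) :
    ∫ r : E2, (heat t r : ℂ) * ft2S φ r = ∫ κ : E2, (Real.exp (-(t * ‖κ‖ ^ 2)) : ℂ) * φ κ := by
  have hint : Integrable (Function.uncurry fun (r κ : E2) =>
      (heat t r : ℂ) * (φ κ * Complex.exp (-Complex.I * ((inner ℝ r κ : ℝ) : ℂ))))
      (volume.prod volume) := by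
    have h1 : Integrable fun r : E2 => (heat t r : ℂ) := by
      simp only [heat_eq]
      exact ((integrable_exp_neg_mul_norm_sq (by positivity)).const_mul _).ofReal
    have h2 := (h1.mul_prod φ.integrable (ν := volume)).bdd_mul (c := 1)
      (f := fun p : E2 × E2 => Complex.exp (-Complex.I * ((inner ℝ p.1 p.2 : ℝ) : ℂ)))
      (by fun_prop) (Eventually.of_forall fun p => by
        rw [Complex.norm_exp]; simp)
    refine h2.congr (Eventually.of_forall fun p => ?_)
    simp only [Function.uncurry]
    ring
  calc _ = ∫ r : E2, ∫ κ : E2,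
      (heat t r : ℂ) * (φ κ * Complex.exp (-Complex.I * ((inner ℝ r κ : ℝ) : ℂ))) := by
        simp only [ft2S_apply, ft2, integral_const_mul]
    _ = ∫ κ : E2, ∫ r : E2,
      (heat t r : ℂ) * (φ κ * Complex.exp (-Complex.I * ((inner ℝ r κ : ℝ) : ℂ))) :=
        integral_integral_swap hint
    _ = _ := by
        refine integral_congr_ae (Eventually.of_forall fun κ => ?_)
        have h3 : ∀ r : E2,
            (heat t r : ℂ) * (φ κ * Complex.exp (-Complex.I * ((inner ℝ r κ : ℝ) : ℂ))) =
            (φ κ * ((4 * Real.pi * t : ℝ)⁻¹ : ℂ)) * ((Real.exp (-((4 * t)⁻¹ * ‖r‖ ^ 2)) : ℂ) *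
              Complex.exp (-Complex.I * ((inner ℝ r κ : ℝ) : ℂ))) := fun r => by
          rw [heat_eq]; push_cast; ring
        simp only [h3, integral_const_mul]
        rw [integral_gaussian_mul_plane_wave (by positivity)]
        have h4 : (-Complex.I) ^ 2 * (‖κ‖ : ℂ) ^ 2 / (4 * ((4 * t)⁻¹ : ℝ)) =
            ((-(t * ‖κ‖ ^ 2) : ℝ) : ℂ) := by
          have : (t : ℂ) ≠ 0 := by exact_mod_cast ht.ne'
          push_cast
          simp
          field_simp
        rw [h4]
        have : (t : ℂ) ≠ 0 := by exact_mod_cast ht.ne'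
        have : (Real.pi : ℂ) ≠ 0 := by exact_mod_cast Real.pi_ne_zero
        push_cast
        field_simp

section Superposition

variable {S : Set ℝ} {w : ℝ → ℝ}

lemma heatKer_eq (r : E2) : heatKer S w r = ∫ t in S, w t * heat t r := rfl

/-- A superposition of heat kernels is the distributional inverse Fourier transform of the
superposition of their symbols as soon as `w(t) / (1 + t)` is integrable. -/
lemma heat_superposition_pairing (hS : MeasurableSet S) (hS0 : S ⊆ Ioi 0) (hw : Measurable w)
    (hw1 : IntegrableOn (fun t => w t / (1 + t)) S) (φ : 𝓢(E2, ℂ)) :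
    (Integrable fun κ => (heatSym S w κ : ℂ) * φ κ) ∧
    (Integrable fun r => (heatKer S w r : ℂ) * φ r) ∧
    ∫ r, (heatKer S w r : ℂ) * ft2S φ r = ∫ κ, (heatSym S w κ : ℂ) * φ κ := by
  have hgm : Measurable (Function.uncurry fun (t : ℝ) (x : E2) => Real.exp (-(t * ‖x‖ ^ 2))) := by
    unfold Function.uncurry; fun_prop
  have hI1 : ∀ φ : 𝓢(E2, ℂ), Integrable (fun p : ℝ × E2 => (w p.1 : ℂ) *
      ((Real.exp (-(p.1 * ‖p.2‖ ^ 2)) : ℝ) * φ p.2)) ((volume.restrict S).prod volume) := fun φ => by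
    obtain ⟨K, hK⟩ := exists_integral_gaussian_mul_le φ
    exact integrable_superposition hS hS0 hw hw1 hgm φ.continuous
      (fun t ht => integrable_gaussian_mul φ ht) hK
  have hI2 : ∀ φ : 𝓢(E2, ℂ), Integrable (fun p : ℝ × E2 => (w p.1 : ℂ) *
      ((heat p.1 p.2 : ℝ) * φ p.2)) ((volume.restrict S).prod volume) := fun φ => by
    obtain ⟨K, hK⟩ := exists_integral_heat_mul_le φ
    exact integrable_superposition hS hS0 hw hw1 measurable_heat φ.continuous
      (fun t ht => integrable_heat_mul φ ht) hK
  have e1 : ∀ (φ : 𝓢(E2, ℂ)) κ, (heatSym S w κ : ℂ) * φ κ =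
      ∫ t in S, (w t : ℂ) * ((Real.exp (-(t * ‖κ‖ ^ 2)) : ℝ) * φ κ) := fun φ κ => by
    simp only [heatSym, ← integral_complex_ofReal, ← mul_assoc, integral_mul_const,
      Complex.ofReal_mul]
  have e2 : ∀ (φ : 𝓢(E2, ℂ)) κ, (heatKer S w κ : ℂ) * φ κ =
      ∫ t in S, (w t : ℂ) * ((heat t κ : ℝ) * φ κ) := fun φ κ => by
    simp only [heatKer_eq, ← integral_complex_ofReal, ← mul_assoc, integral_mul_const,
      Complex.ofReal_mul]
  simp only [e1, e2]
  refine ⟨(hI1 φ).integral_prod_right, (hI2 φ).integral_prod_right, ?_⟩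
  rw [← integral_integral_swap (f := fun (t : ℝ) (x : E2) => (w t : ℂ) *
      ((heat t x : ℝ) * ft2S φ x)) (hI2 (ft2S φ)),
    ← integral_integral_swap (f := fun (t : ℝ) (x : E2) => (w t : ℂ) *
      ((Real.exp (-(t * ‖x‖ ^ 2)) : ℝ) * φ x)) (hI1 φ)]
  refine setIntegral_congr_fun hS fun t ht => ?_
  simp only [integral_const_mul]
  rw [integral_heat_mul_ft2 φ (hS0 ht)]

/-- If even `w(t) / t` is integrable, the superposed symbol is integrable, and its classical inverse
Fourier transform is the superposition of heat kernels, at every point. -/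
lemma invFt2_heatSym (hS : MeasurableSet S) (hS0 : S ⊆ Ioi 0) (hw : Measurable w)
    (hw1 : IntegrableOn (fun t => w t / t) S) :
    (Integrable fun κ => (heatSym S w κ : ℂ)) ∧
    ∀ r, invFt2 (fun κ => (heatSym S w κ : ℂ)) r = heatKer S w r := by
  have hI : ∀ r : E2, Integrable (fun p : ℝ × E2 => (w p.1 : ℂ) *
      ((Real.exp (-(p.1 * ‖p.2‖ ^ 2)) : ℝ) *
        Complex.exp (Complex.I * ((inner ℝ p.2 r : ℝ) : ℂ))))
      ((volume.restrict S).prod volume) := fun r => by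
    have hm : Measurable (fun p : ℝ × E2 => (w p.1 : ℂ) *
      ((Real.exp (-(p.1 * ‖p.2‖ ^ 2)) : ℝ) *
        Complex.exp (Complex.I * ((inner ℝ p.2 r : ℝ) : ℂ)))) := by fun_prop
    rw [integrable_prod_iff hm.aestronglyMeasurable]
    refine ⟨(ae_restrict_iff' hS).2 (Eventually.of_forall fun t ht =>
      (integrable_gaussian_mul_plane_wave (hS0 ht) Complex.I r).const_mul (w t : ℂ)), ?_⟩
    refine (hw1.norm.const_mul Real.pi).congr ?_
    refine (ae_restrict_iff' hS).2 (Eventually.of_forall fun t ht => ?_)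
    have ht' : 0 < t := hS0 ht
    have hn : ∀ x : E2, ‖(Real.exp (-(t * ‖x‖ ^ 2)) : ℂ) *
        Complex.exp (Complex.I * ((inner ℝ x r : ℝ) : ℂ))‖ = Real.exp (-(t * ‖x‖ ^ 2)) := fun x => by
      rw [norm_mul, Complex.norm_real, Complex.norm_exp]
      simp [Real.norm_of_nonneg (Real.exp_pos _).le]
    simp only [norm_mul (w t : ℂ), integral_const_mul, hn, integral_exp_neg_mul_norm_sq ht']
    rw [norm_div, Complex.norm_real, Real.norm_of_nonneg ht'.le]
    ring
  have e1 : ∀ r κ : E2, (heatSym S w κ : ℂ) * Complex.exp (Complex.I * ((inner ℝ κ r : ℝ) : ℂ)) =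
      ∫ t in S, (w t : ℂ) * ((Real.exp (-(t * ‖κ‖ ^ 2)) : ℝ) *
        Complex.exp (Complex.I * ((inner ℝ κ r : ℝ) : ℂ))) := fun r κ => by
    simp only [heatSym, ← integral_complex_ofReal, ← mul_assoc, integral_mul_const,
      Complex.ofReal_mul]
  refine ⟨?_, fun r => ?_⟩
  · refine (hI 0).integral_prod_right.congr (Eventually.of_forall fun κ => ?_)
    simpa using (e1 0 κ).symm
  · simp only [invFt2, e1]
    rw [← integral_integral_swap (f := fun (t : ℝ) (κ : E2) => (w t : ℂ) *
      ((Real.exp (-(t * ‖κ‖ ^ 2)) : ℝ) *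
        Complex.exp (Complex.I * ((inner ℝ κ r : ℝ) : ℂ)))) (hI r), ← integral_const_mul, heatKer_eq,
      ← integral_complex_ofReal]
    refine setIntegral_congr_fun hS fun t ht => ?_
    have ht' : 0 < t := hS0 ht
    have h1 : (t : ℂ) ≠ 0 := by exact_mod_cast ht'.ne'
    have h2 : (Real.pi : ℂ) ≠ 0 := by exact_mod_cast Real.pi_ne_zero
    simp only [integral_const_mul]
    rw [integral_gaussian_mul_plane_wave ht', heat, Complex.I_sq]
    push_cast
    rw [show (-1 * (‖r‖ : ℂ) ^ 2 / (4 * t)) = -(‖r‖ ^ 2 / (4 * t)) by ring]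
    field_simp
    ring

end Superposition

/-! ### The harmonic and biharmonic symbols as heat superpositions -/

lemma norm_join_sq (k : ℝ) (κ : E2) : ‖join k κ‖ ^ 2 = k ^ 2 + ‖κ‖ ^ 2 := by
  simp [join, EuclideanSpace.norm_sq_eq, Fin.sum_univ_three, Fin.sum_univ_two, add_assoc]

/-- The weight that represents the harmonic symbol with longitudinal wave number `k`. -/
noncomputable def harmW (k t : ℝ) : ℝ := 4 * Real.pi * Real.exp (-(t * k ^ 2))

/-- The weight that represents minus the biharmonic symbol with longitudinal wave number `k`. -/
noncomputable def biharmW (k t : ℝ) : ℝ := 8 * Real.pi * t * Real.exp (-(t * k ^ 2))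

lemma measurable_harmW (k : ℝ) : Measurable (harmW k) := by unfold harmW; fun_prop

lemma measurable_biharmW (k : ℝ) : Measurable (biharmW k) := by unfold biharmW; fun_prop

lemma integrableOn_exp_neg_mul_Ioi {x : ℝ} (hx : 0 < x) (a : ℝ) :
    IntegrableOn (fun t => Real.exp (-(t * x))) (Ioi a) := by
  refine (integrableOn_exp_mul_Ioi (a := -x) (by linarith) a).congr_fun (fun t _ => ?_)
    measurableSet_Ioi
  simp only; congr 1; ring

lemma integral_exp_neg_mul_Ioi {x : ℝ} (hx : 0 < x) (a : ℝ) :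
    ∫ t in Ioi a, Real.exp (-(t * x)) = Real.exp (-(a * x)) / x := by
  have h := integral_exp_mul_Ioi (a := -x) (by linarith) a
  rw [show -Real.exp (-x * a) / -x = Real.exp (-(a * x)) / x by rw [neg_div_neg_eq]; ring_nf] at h
  rw [← h]
  congr 1; ext t; ring_nf

lemma hasDerivAt_mul_exp_antideriv {x : ℝ} (hx : 0 < x) (t : ℝ) :
    HasDerivAt (fun t => -(Real.exp (-(t * x)) * (1 + t * x) / x ^ 2))
      (t * Real.exp (-(t * x))) t := by
  have h1 : HasDerivAt (fun t : ℝ => t * x) x t := by simpa using (hasDerivAt_id t).mul_const x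
  have h := (((h1.neg.exp).mul (h1.const_add 1)).div_const (x ^ 2)).neg
  convert! h using 1
  field_simp
  simp only [Pi.neg_apply]
  ring_nf

lemma tendsto_mul_exp_antideriv {x : ℝ} (hx : 0 < x) :
    Tendsto (fun t => -(Real.exp (-(t * x)) * (1 + t * x) / x ^ 2)) atTop (𝓝 0) := by
  have h1 : Tendsto (fun t : ℝ => t * x) atTop atTop := tendsto_id.atTop_mul_const hx
  have h2 : Tendsto (fun s : ℝ => -((Real.exp (-s) + s ^ 1 * Real.exp (-s)) / x ^ 2)) atTop
      (𝓝 (-((0 + 0) / x ^ 2))) :=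
    (((Real.tendsto_exp_neg_atTop_nhds_zero).add
      (Real.tendsto_pow_mul_exp_neg_atTop_nhds_zero 1)).div_const _).neg
  simp only [add_zero, zero_div, neg_zero] at h2
  refine (h2.comp h1).congr fun t => ?_
  simp only [Function.comp]
  ring

lemma integrableOn_mul_exp_neg_mul_Ioi {x a : ℝ} (hx : 0 < x) (ha : 0 ≤ a) :
    IntegrableOn (fun t => t * Real.exp (-(t * x))) (Ioi a) :=
  integrableOn_Ioi_deriv_of_nonneg
    (hasDerivAt_mul_exp_antideriv hx a).continuousAt.continuousWithinAt
    (fun t _ => hasDerivAt_mul_exp_antideriv hx t)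
    (fun _ ht => mul_nonneg (ha.trans (mem_Ioi.1 ht).le) (Real.exp_pos _).le)
    (tendsto_mul_exp_antideriv hx)

lemma integral_mul_exp_neg_mul_Ioi {x a : ℝ} (hx : 0 < x) (ha : 0 ≤ a) :
    ∫ t in Ioi a, t * Real.exp (-(t * x)) = Real.exp (-(a * x)) * (1 + a * x) / x ^ 2 := by
  rw [integral_Ioi_of_hasDerivAt_of_tendsto
    (hasDerivAt_mul_exp_antideriv hx a).continuousAt.continuousWithinAt
    (fun t _ => hasDerivAt_mul_exp_antideriv hx t) (integrableOn_mul_exp_neg_mul_Ioi hx ha)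
    (tendsto_mul_exp_antideriv hx)]
  ring

lemma heatSym_harmW_eq (S : Set ℝ) (k : ℝ) (κ : E2) : heatSym S (harmW k) κ =
    4 * Real.pi * ∫ t in S, Real.exp (-(t * (k ^ 2 + ‖κ‖ ^ 2))) := by
  rw [heatSym, ← integral_const_mul]
  congr 1; ext t
  rw [harmW, mul_assoc, ← Real.exp_add]
  ring_nf

lemma heatSym_biharmW_eq (S : Set ℝ) (k : ℝ) (κ : E2) : heatSym S (biharmW k) κ =
    8 * Real.pi * ∫ t in S, t * Real.exp (-(t * (k ^ 2 + ‖κ‖ ^ 2))) := by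
  rw [heatSym, ← integral_const_mul]
  congr 1; ext t
  rw [biharmW, mul_assoc, ← Real.exp_add]
  ring_nf

lemma setIntegral_Ioc_eq_sub {f : ℝ → ℝ} (hf : IntegrableOn f (Ioi 0)) {a : ℝ} (ha : 0 ≤ a) :
    ∫ t in Ioc 0 a, f t = (∫ t in Ioi 0, f t) - ∫ t in Ioi a, f t := by
  rw [← Ioc_union_Ioi_eq_Ioi ha, setIntegral_union (Ioc_disjoint_Ioi le_rfl) measurableSet_Ioi
    (hf.mono_set Ioc_subset_Ioi_self) (hf.mono_set (Ioi_subset_Ioi ha))]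
  ring

section Symbols

variable {k : ℝ} {κ : E2}

lemma heatSym_harmW_Ioi (h : 0 < k ^ 2 + ‖κ‖ ^ 2) (a : ℝ) : heatSym (Ioi a) (harmW k) κ =
    4 * Real.pi / (k ^ 2 + ‖κ‖ ^ 2) * Real.exp (-(a * (k ^ 2 + ‖κ‖ ^ 2))) := by
  rw [heatSym_harmW_eq, integral_exp_neg_mul_Ioi h]; ring

lemma heatSym_harmW_Ioc (h : 0 < k ^ 2 + ‖κ‖ ^ 2) {a : ℝ} (ha : 0 ≤ a) :
    heatSym (Ioc 0 a) (harmW k) κ =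
      4 * Real.pi / (k ^ 2 + ‖κ‖ ^ 2) * (1 - Real.exp (-(a * (k ^ 2 + ‖κ‖ ^ 2)))) := by
  rw [heatSym_harmW_eq, setIntegral_Ioc_eq_sub (integrableOn_exp_neg_mul_Ioi h 0) ha,
    integral_exp_neg_mul_Ioi h, integral_exp_neg_mul_Ioi h]
  simp; ring

lemma heatSym_biharmW_Ioi (h : 0 < k ^ 2 + ‖κ‖ ^ 2) {a : ℝ} (ha : 0 ≤ a) :
    heatSym (Ioi a) (biharmW k) κ = 8 * Real.pi / (k ^ 2 + ‖κ‖ ^ 2) ^ 2 *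
      (Real.exp (-(a * (k ^ 2 + ‖κ‖ ^ 2))) * (1 + a * (k ^ 2 + ‖κ‖ ^ 2))) := by
  rw [heatSym_biharmW_eq, integral_mul_exp_neg_mul_Ioi h ha]; ring

lemma heatSym_biharmW_Ioc (h : 0 < k ^ 2 + ‖κ‖ ^ 2) {a : ℝ} (ha : 0 ≤ a) :
    heatSym (Ioc 0 a) (biharmW k) κ = 8 * Real.pi / (k ^ 2 + ‖κ‖ ^ 2) ^ 2 *
      (1 - Real.exp (-(a * (k ^ 2 + ‖κ‖ ^ 2))) * (1 + a * (k ^ 2 + ‖κ‖ ^ 2))) := by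
  rw [heatSym_biharmW_eq, setIntegral_Ioc_eq_sub (integrableOn_mul_exp_neg_mul_Ioi h le_rfl) ha,
    integral_mul_exp_neg_mul_Ioi h le_rfl, integral_mul_exp_neg_mul_Ioi h ha]
  simp; ring

lemma harmHat_join : harmHat (join k κ) = ((4 * Real.pi / (k ^ 2 + ‖κ‖ ^ 2) : ℝ) : ℂ) := by
  rw [harmHat, ← norm_join_sq]; push_cast; ring

lemma biharmHat_join :
    biharmHat (join k κ) = ((-(8 * Real.pi / (k ^ 2 + ‖κ‖ ^ 2) ^ 2) : ℝ) : ℂ) := by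
  rw [biharmHat, ← norm_join_sq]; push_cast; ring

lemma ewaldHat_join (ξ : ℝ) : ewaldHat ξ (join k κ) =
    ((Real.exp (-(1 / (4 * ξ ^ 2) * (k ^ 2 + ‖κ‖ ^ 2))) : ℝ) : ℂ) := by
  rw [ewaldHat, ← norm_join_sq]
  push_cast
  congr 1
  ring

lemma hasimotoHat_join (ξ : ℝ) : hasimotoHat ξ (join k κ) =
    ((Real.exp (-(1 / (4 * ξ ^ 2) * (k ^ 2 + ‖κ‖ ^ 2))) *
      (1 + 1 / (4 * ξ ^ 2) * (k ^ 2 + ‖κ‖ ^ 2)) : ℝ) : ℂ) := by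
  rw [hasimotoHat, ← norm_join_sq]
  push_cast
  congr 2
  · ring
  · ring

lemma sq_add_norm_sq_pos_left (hk : k ≠ 0) (κ : E2) : 0 < k ^ 2 + ‖κ‖ ^ 2 := by positivity

lemma sq_add_norm_sq_pos_right (k : ℝ) (hκ : κ ≠ 0) : 0 < k ^ 2 + ‖κ‖ ^ 2 := by
  have := norm_pos_iff.2 hκ; positivity

lemma harmHat_join_eq (h : 0 < k ^ 2 + ‖κ‖ ^ 2) :
    harmHat (join k κ) = heatSym (Ioi 0) (harmW k) κ := by
  rw [harmHat_join, heatSym_harmW_Ioi h]; simp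

lemma harmHat_mul_ewaldHat (h : 0 < k ^ 2 + ‖κ‖ ^ 2) (ξ : ℝ) :
    harmHat (join k κ) * ewaldHat ξ (join k κ) = heatSym (Ioi (1 / (4 * ξ ^ 2))) (harmW k) κ := by
  rw [harmHat_join, ewaldHat_join, heatSym_harmW_Ioi h, ← Complex.ofReal_mul]

lemma harmHat_sub_mul_ewaldHat (h : 0 < k ^ 2 + ‖κ‖ ^ 2) (ξ : ℝ) :
    harmHat (join k κ) - harmHat (join k κ) * ewaldHat ξ (join k κ) =
      heatSym (Ioc 0 (1 / (4 * ξ ^ 2))) (harmW k) κ := by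
  rw [harmHat_join, ewaldHat_join, heatSym_harmW_Ioc h (by positivity)]; push_cast; ring

lemma biharmHat_join_eq (h : 0 < k ^ 2 + ‖κ‖ ^ 2) :
    biharmHat (join k κ) = -heatSym (Ioi 0) (biharmW k) κ := by
  rw [biharmHat_join, heatSym_biharmW_Ioi h le_rfl]; simp

lemma biharmHat_mul_hasimotoHat (h : 0 < k ^ 2 + ‖κ‖ ^ 2) (ξ : ℝ) :
    biharmHat (join k κ) * hasimotoHat ξ (join k κ) =
      -heatSym (Ioi (1 / (4 * ξ ^ 2))) (biharmW k) κ := by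
  rw [biharmHat_join, hasimotoHat_join, heatSym_biharmW_Ioi h (by positivity)]; push_cast; ring

lemma biharmHat_sub_mul_hasimotoHat (h : 0 < k ^ 2 + ‖κ‖ ^ 2) (ξ : ℝ) :
    biharmHat (join k κ) - biharmHat (join k κ) * hasimotoHat ξ (join k κ) =
      -heatSym (Ioc 0 (1 / (4 * ξ ^ 2))) (biharmW k) κ := by
  rw [biharmHat_join, hasimotoHat_join, heatSym_biharmW_Ioc h (by positivity)]; push_cast; ring

end Symbols

/-! ### Exponential integrals -/

lemma setIntegral_Ioc_eq_integral_comp_div {a : ℝ} (ha : 0 < a) (h : ℝ → ℝ) :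
    ∫ t in Ioc 0 a, h t = ∫ s in Ioi (1 : ℝ), a / s ^ 2 * h (a / s) := by
  have himg : (fun s => a / s) '' Ioi (1 : ℝ) = Ioo 0 a := by
    ext t
    constructor
    · rintro ⟨s, hs, rfl⟩
      have hs' : 1 < s := hs
      exact ⟨by positivity, div_lt_self ha hs'⟩
    · rintro ⟨h0, h1⟩
      exact ⟨a / t, (one_lt_div h0).2 h1, by field_simp⟩
  rw [integral_Ioc_eq_integral_Ioo, ← himg,
    integral_image_eq_integral_abs_deriv_smul (f' := fun s => -(a / s ^ 2)) measurableSet_Ioi]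
  · refine setIntegral_congr_fun measurableSet_Ioi fun s hs => ?_
    rw [abs_neg, abs_of_nonneg (by positivity), smul_eq_mul]
  · intro s hs
    have hs' : s ≠ 0 := (one_pos.trans (mem_Ioi.1 hs)).ne'
    have := (hasDerivAt_inv hs').const_mul a
    simp only [div_eq_mul_inv]
    convert! this.hasDerivWithinAt using 1
    ring
  · intro s hs t ht hst
    have hs' : 0 < s := one_pos.trans hs
    have ht' : 0 < t := one_pos.trans ht
    simp only at hst
    field_simp at hst
    exact hst.symm

lemma expInt_one_eq (x : ℝ) : expInt 1 x = ∫ s in Ioi (1 : ℝ), Real.exp (-(x * s)) / s := by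
  simp [expInt, incBesselK]

lemma expInt_two_eq (x : ℝ) : expInt 2 x = ∫ s in Ioi (1 : ℝ), Real.exp (-(x * s)) / s ^ 2 := by
  simp only [expInt, incBesselK]
  congr 1; ext s
  norm_num

lemma heatKer_harmW_zero_Ioc {η : ℝ} (hη : 0 < η) (r : E2) :
    heatKer (Ioc 0 (1 / (4 * η ^ 2))) (harmW 0) r = expInt 1 (η ^ 2 * ‖r‖ ^ 2) := by
  rw [heatKer, setIntegral_Ioc_eq_integral_comp_div (by positivity), expInt_one_eq]
  refine setIntegral_congr_fun measurableSet_Ioi fun s hs => ?_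
  have hs' : 0 < s := one_pos.trans hs
  have : -(‖r‖ ^ 2 / (4 * (1 / (4 * η ^ 2) / s))) = -(η ^ 2 * ‖r‖ ^ 2 * s) := by field_simp
  simp only [harmW, this]
  simp
  field_simp

lemma heatKer_biharmW_zero_Ioc {η : ℝ} (hη : 0 < η) (r : E2) :
    heatKer (Ioc 0 (1 / (4 * η ^ 2))) (biharmW 0) r =
      1 / (2 * η ^ 2) * expInt 2 (η ^ 2 * ‖r‖ ^ 2) := by
  rw [heatKer, setIntegral_Ioc_eq_integral_comp_div (by positivity), expInt_two_eq,
    ← integral_const_mul]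
  refine setIntegral_congr_fun measurableSet_Ioi fun s hs => ?_
  have hs' : 0 < s := one_pos.trans hs
  have : -(‖r‖ ^ 2 / (4 * (1 / (4 * η ^ 2) / s))) = -(η ^ 2 * ‖r‖ ^ 2 * s) := by field_simp
  simp only [biharmW, this]
  simp
  field_simp
  ring

/-- The entire function `∫₀¹ (-u)ⁿ e^{-us} du`; for `n = 0` it is `(1 - e^{-s}) / s`, and increasing
`n` by one means taking a derivative. -/
noncomputable def expMoment (n : ℕ) (s : ℝ) : ℝ :=
  ∫ u in (0 : ℝ)..1, (-u) ^ n * Real.exp (-(u * s))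

lemma hasDerivAt_expMoment (n : ℕ) (s : ℝ) :
    HasDerivAt (expMoment n) (expMoment (n + 1) s) s := by
  refine (intervalIntegral.hasDerivAt_integral_of_dominated_loc_of_deriv_le
    (F := fun s u => (-u) ^ n * Real.exp (-(u * s)))
    (F' := fun s u => (-u) ^ (n + 1) * Real.exp (-(u * s)))
    (bound := fun _ => Real.exp (|s| + 1)) (Metric.ball_mem_nhds s one_pos)
    (Eventually.of_forall fun x => by fun_prop)
    (Continuous.intervalIntegrable (by fun_prop) _ _) (by fun_prop)
    (Eventually.of_forall fun u hu x hx => ?_) (by simp)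
    (Eventually.of_forall fun u hu x hx => ?_)).2
  · rw [uIoc_of_le zero_le_one] at hu
    rw [norm_mul, norm_pow, norm_neg, Real.norm_of_nonneg hu.1.le,
      Real.norm_of_nonneg (Real.exp_pos _).le]
    refine (mul_le_of_le_one_left (Real.exp_pos _).le (pow_le_one₀ hu.1.le hu.2)).trans
      (Real.exp_le_exp.2 ?_)
    have h1 : |x| ≤ |s| + 1 := by
      have := abs_sub_abs_le_abs_sub x s
      rw [Metric.mem_ball, Real.dist_eq] at hx
      linarith
    calc -(u * x) ≤ |u * x| := neg_le_abs _
      _ = u * |x| := by rw [abs_mul, abs_of_pos hu.1]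
      _ ≤ 1 * |x| := by gcongr; exact hu.2
      _ ≤ _ := by linarith
  · have h1 : HasDerivAt (fun x : ℝ => -(u * x)) (-u) x := by
      simpa using! ((hasDerivAt_id x).const_mul u).neg
    have := (h1.exp).const_mul ((-u) ^ n)
    convert! this using 1
    ring

lemma contDiff_expMoment (m n : ℕ) : ContDiff ℝ m (expMoment n) := by
  induction m generalizing n with
  | zero => exact contDiff_zero.2 (continuous_iff_continuousAt.2 fun s =>
      (hasDerivAt_expMoment n s).continuousAt)
  | succ m ih =>
    push_cast
    refine contDiff_succ_iff_deriv.2 ⟨fun s => (hasDerivAt_expMoment n s).differentiableAt,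
      fun h => by simp at h, ?_⟩
    rw [show deriv (expMoment n) = expMoment (n + 1) from
      funext fun s => (hasDerivAt_expMoment n s).deriv]
    exact ih (n + 1)

@[fun_prop]
lemma continuous_expMoment (n : ℕ) : Continuous (expMoment n) := (contDiff_expMoment 0 n).continuous

lemma abs_expMoment_le_one (n : ℕ) {s : ℝ} (hs : 0 ≤ s) : |expMoment n s| ≤ 1 := by
  have := intervalIntegral.norm_integral_le_of_norm_le_const (a := 0) (b := 1) (C := 1)
    (f := fun u => (-u) ^ n * Real.exp (-(u * s))) fun u hu => by
      rw [uIoc_of_le zero_le_one] at hu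
      rw [norm_mul, norm_pow, norm_neg, Real.norm_of_nonneg hu.1.le,
        Real.norm_of_nonneg (Real.exp_pos _).le]
      exact mul_le_one₀ (pow_le_one₀ hu.1.le hu.2) (Real.exp_pos _).le
        (Real.exp_le_one_iff.2 (by nlinarith [hu.1]))
  simpa [expMoment] using this

lemma expMoment_zero_mul (s : ℝ) : expMoment 0 s * s = 1 - Real.exp (-s) := by
  rw [expMoment, ← intervalIntegral.integral_mul_const]
  have : ∀ u ∈ uIcc (0 : ℝ) 1, HasDerivAt (fun u => -Real.exp (-(u * s)))
      ((-u) ^ 0 * Real.exp (-(u * s)) * s) u := fun u _ => by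
    have h1 : HasDerivAt (fun u : ℝ => -(u * s)) (-s) u := by
      simpa using! ((hasDerivAt_id u).mul_const s).neg
    convert! h1.exp.neg using 1
    ring
  rw [intervalIntegral.integral_eq_sub_of_hasDerivAt this
    (Continuous.intervalIntegrable (by fun_prop) _ _)]
  simp
  ring

lemma expMoment_one_mul (s : ℝ) : expMoment 1 s * s = Real.exp (-s) - expMoment 0 s := by
  have h1 : HasDerivAt (fun s => expMoment 0 s * s) (expMoment 1 s * s + expMoment 0 s * 1) s :=
    (hasDerivAt_expMoment 0 s).mul (hasDerivAt_id s)
  have h2 : HasDerivAt (fun s => expMoment 0 s * s) (Real.exp (-s)) s := by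
    simp only [expMoment_zero_mul]
    have h3 : HasDerivAt (fun s : ℝ => -s) (-1) s := hasDerivAt_neg s
    convert! h3.exp.const_sub 1 using 1
    ring
  linarith [h1.unique h2]

/-- The complementary exponential integral `Ein s = ∫₀ˢ (1 - e^{-u}) / u du`. -/
noncomputable def ein (s : ℝ) : ℝ := ∫ u in (0 : ℝ)..s, expMoment 0 u

lemma hasDerivAt_ein (s : ℝ) : HasDerivAt ein (expMoment 0 s) s :=
  intervalIntegral.integral_hasDerivAt_right ((continuous_expMoment 0).intervalIntegrable _ _)
    ((continuous_expMoment 0).stronglyMeasurableAtFilter _ _) (continuous_expMoment 0).continuousAt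

lemma ein_zero : ein 0 = 0 := by simp [ein]

@[fun_prop]
lemma continuous_ein : Continuous ein :=
  continuous_iff_continuousAt.2 fun s => (hasDerivAt_ein s).continuousAt

lemma contDiff_ein (m : ℕ) : ContDiff ℝ m ein := by
  refine ContDiff.of_succ (n := (m : WithTop ℕ∞)) (contDiff_succ_iff_deriv.2
    ⟨fun s => (hasDerivAt_ein s).differentiableAt, fun h => by simp at h, ?_⟩)
  rw [show deriv ein = expMoment 0 from funext fun s => (hasDerivAt_ein s).deriv]
  exact contDiff_expMoment m 0

lemma abs_ein_le {s : ℝ} (hs : 0 ≤ s) : |ein s| ≤ s := by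
  have := intervalIntegral.norm_integral_le_of_norm_le_const (a := 0) (b := s) (C := 1)
    (f := expMoment 0) fun u hu => by
      rw [uIoc_of_le hs] at hu
      exact abs_expMoment_le_one 0 hu.1.le
  simpa [ein, abs_of_nonneg hs] using this

lemma integrableOn_log_mul_exp_neg :
    IntegrableOn (fun t : ℝ => Real.log t * Real.exp (-t)) (Ioi 0) := by
  have h1 := (Real.GammaIntegral_convergent (s := 1 / 2) (by norm_num)).const_mul 2
  have h2 := Real.GammaIntegral_convergent (s := 2) (by norm_num)
  refine (h1.add h2).mono' (by fun_prop) ?_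
  refine (ae_restrict_iff' measurableSet_Ioi).2 (Eventually.of_forall fun t ht => ?_)
  have ht' : 0 < t := ht
  have hl1 : Real.log t ≤ t := Real.log_le_self ht'.le
  have hl2 : -Real.log t ≤ 2 * t ^ (1 / 2 - 1 : ℝ) := by
    have := Real.log_le_rpow_div (x := t⁻¹) (by positivity) (ε := 1 / 2) (by norm_num)
    rw [Real.log_inv, Real.inv_rpow ht'.le, ← Real.rpow_neg ht'.le] at this
    norm_num at this ⊢
    linarith
  have h3 : |Real.log t| ≤ 2 * t ^ (1 / 2 - 1 : ℝ) + t :=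
    abs_le.2 ⟨by linarith, by linarith [Real.rpow_nonneg ht'.le (1 / 2 - 1 : ℝ)]⟩
  rw [norm_mul, Real.norm_eq_abs, Real.norm_of_nonneg (Real.exp_pos _).le]
  calc _ ≤ (2 * t ^ (1 / 2 - 1 : ℝ) + t) * Real.exp (-t) := by gcongr
    _ = _ := by
      norm_num
      ring

/-- `∫₀^∞ e^{-t} log t dt = Γ'(1) = -γ`. -/
lemma integral_log_mul_exp_neg :
    ∫ t in Ioi (0 : ℝ), Real.log t * Real.exp (-t) = -Real.eulerMascheroniConstant := by
  have h1 := Complex.hasDerivAt_GammaIntegral (s := 1) (by simp)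
  simp only [sub_self, Complex.cpow_zero, one_mul] at h1
  have h2 : HasDerivAt Complex.Gamma (∫ t in Ioi (0 : ℝ), (Real.log t : ℂ) * Real.exp (-t)) 1 := by
    refine h1.congr_of_eventuallyEq ?_
    have : {s : ℂ | 0 < s.re} ∈ 𝓝 (1 : ℂ) :=
      (isOpen_lt continuous_const Complex.continuous_re).mem_nhds (by simp)
    filter_upwards [this] with s hs using Complex.Gamma_eq_integral hs
  have h3 := Complex.hasDerivAt_Gamma_one
  have h4 := h2.unique h3
  have h5 : ((∫ t in Ioi (0 : ℝ), Real.log t * Real.exp (-t) : ℝ) : ℂ) =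
      -Real.eulerMascheroniConstant := by
    rw [← h4, ← integral_complex_ofReal]
    simp
  exact_mod_cast h5

/-- `E₁(x) = -γ - log x + Ein x`: integrate `∫₀^∞ e^{-s} log s ds = -γ` by parts on `(0, x)` and on
`(x, ∞)`. -/
lemma expInt_one_eq_ein {x : ℝ} (hx : 0 < x) :
    expInt 1 x = -Real.eulerMascheroniConstant - Real.log x + ein x := by
  have hint := integrableOn_log_mul_exp_neg
  have hE : expInt 1 x = ∫ u in Ioi x, Real.exp (-u) / u := by
    have := integral_comp_mul_left_Ioi (fun u => Real.exp (-u) / u) 1 hx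
    rw [mul_one, smul_eq_mul, eq_inv_mul_iff_mul_eq₀ hx.ne', ← integral_const_mul] at this
    rw [← this, expInt_one_eq]
    refine setIntegral_congr_fun measurableSet_Ioi fun s hs => ?_
    field_simp
  have hEint : IntegrableOn (fun u => Real.exp (-u) / u) (Ioi x) := by
    refine ((integrableOn_exp_neg_Ioi x).div_const x).mono' (Measurable.aestronglyMeasurable (by fun_prop)) ?_
    refine (ae_restrict_iff' measurableSet_Ioi).2 (Eventually.of_forall fun t ht => ?_)
    have ht' : x < t := ht
    have : 0 < t := hx.trans ht'
    rw [Real.norm_of_nonneg (by positivity)]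
    gcongr
  have hlim : Tendsto (fun t : ℝ => Real.exp (-t) * Real.log t) atTop (𝓝 0) := by
    have h := Real.tendsto_pow_mul_exp_neg_atTop_nhds_zero 1
    refine squeeze_zero' (g := fun t : ℝ => t ^ 1 * Real.exp (-t)) ?_ ?_ h
    · filter_upwards [eventually_ge_atTop 1] with t ht
      exact mul_nonneg (Real.exp_pos _).le (Real.log_nonneg ht)
    · filter_upwards [eventually_ge_atTop 1] with t ht
      rw [pow_one, mul_comm]
      gcongr
      exact Real.log_le_self (by linarith)
  have hderiv : ∀ t ∈ Ioi (0 : ℝ), HasDerivAt (fun t => Real.exp (-t) * Real.log t)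
      (Real.exp (-t) / t - Real.log t * Real.exp (-t)) t := fun t ht => by
    convert! ((hasDerivAt_neg t).exp).mul (Real.hasDerivAt_log (ne_of_gt ht)) using 1
    ring
  have houter : (∫ t in Ioi x, Real.exp (-t) / t) - ∫ t in Ioi x, Real.log t * Real.exp (-t) =
      0 - Real.exp (-x) * Real.log x := by
    have hi2 := hint.mono_set (Ioi_subset_Ioi hx.le)
    rw [← integral_sub hEint hi2]
    exact integral_Ioi_of_hasDerivAt_of_tendsto (hderiv x hx).continuousAt.continuousWithinAt
      (fun t ht => hderiv t (hx.trans ht)) (hEint.sub hi2) hlim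
  have hinner : (∫ t in Ioc 0 x, Real.log t * Real.exp (-t)) + ein x =
      (1 - Real.exp (-x)) * Real.log x := by
    have hi : IntervalIntegrable (fun t => Real.log t * Real.exp (-t)) volume 0 x :=
      (intervalIntegrable_iff_integrableOn_Ioc_of_le hx.le).2 (hint.mono_set Ioc_subset_Ioi_self)
    have hi0 : IntervalIntegrable (expMoment 0) volume 0 x :=
      (continuous_expMoment 0).intervalIntegrable _ _
    rw [← intervalIntegral.integral_of_le hx.le, ein, ← intervalIntegral.integral_add hi hi0,
      ← expMoment_zero_mul, mul_assoc]
    rw [intervalIntegral.integral_eq_sub_of_hasDerivAt_of_le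
      (f := fun t => expMoment 0 t * (t * Real.log t)) hx.le
      ((continuous_expMoment 0).mul Real.continuous_mul_log).continuousOn ?_ (hi.add hi0)]
    · simp
    · intro t ht
      have h1 := (hasDerivAt_expMoment 0 t).mul (Real.hasDerivAt_mul_log ht.1.ne')
      convert! h1 using 1
      have h2 := expMoment_one_mul t
      simp only [zero_add]
      linear_combination (-Real.log t) * h2
  have htot := integral_log_mul_exp_neg
  have hsplit := setIntegral_Ioc_eq_sub hint hx.le
  rw [hE]
  linarith

lemma expInt_two_eq_expInt_one {x : ℝ} (hx : 0 < x) :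
    expInt 2 x = Real.exp (-x) - x * expInt 1 x := by
  have hx' := integrableOn_exp_neg_mul_Ioi hx 1
  have hi1 : IntegrableOn (fun s => Real.exp (-(x * s)) / s) (Ioi 1) := by
    refine hx'.mono' (Measurable.aestronglyMeasurable (by fun_prop)) ?_
    refine (ae_restrict_iff' measurableSet_Ioi).2 (Eventually.of_forall fun t ht => ?_)
    have ht' : 1 < t := ht
    rw [Real.norm_of_nonneg (by positivity), mul_comm x]
    exact div_le_self (Real.exp_pos _).le ht'.le
  have hi2 : IntegrableOn (fun s => Real.exp (-(x * s)) / s ^ 2) (Ioi 1) := by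
    refine hx'.mono' (Measurable.aestronglyMeasurable (by fun_prop)) ?_
    refine (ae_restrict_iff' measurableSet_Ioi).2 (Eventually.of_forall fun t ht => ?_)
    have ht' : 1 < t := ht
    rw [Real.norm_of_nonneg (by positivity), mul_comm x]
    exact div_le_self (Real.exp_pos _).le (one_le_pow₀ ht'.le)
  have hderiv : ∀ t ∈ Ioi (0 : ℝ), HasDerivAt (fun s => -(Real.exp (-(x * s)) / s))
      (Real.exp (-(x * t)) / t ^ 2 + x * (Real.exp (-(x * t)) / t)) t := fun t ht => by
    have ht' : t ≠ 0 := ne_of_gt ht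
    have h1 : HasDerivAt (fun s : ℝ => -(x * s)) (-x) t := by
      simpa using! ((hasDerivAt_id t).const_mul x).neg
    convert! (h1.exp.div (hasDerivAt_id t) ht').neg using 1
    simp only [id]
    field_simp
    ring
  have hlim : Tendsto (fun s => -(Real.exp (-(x * s)) / s)) atTop (𝓝 0) := by
    have h1 : Tendsto (fun s : ℝ => Real.exp (-(x * s))) atTop (𝓝 0) :=
      Real.tendsto_exp_neg_atTop_nhds_zero.comp (tendsto_id.const_mul_atTop hx)
    simpa [div_eq_mul_inv] using! (h1.mul tendsto_inv_atTop_zero).neg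
  have h := integral_Ioi_of_hasDerivAt_of_tendsto
    (hderiv 1 (mem_Ioi.2 one_pos)).continuousAt.continuousWithinAt
    (fun t ht => hderiv t (mem_Ioi.2 (one_pos.trans (mem_Ioi.1 ht)))) (hi2.add (hi1.const_mul x)) hlim
  rw [integral_add hi2 (hi1.const_mul x), integral_const_mul, ← expInt_one_eq,
    ← expInt_two_eq] at h
  simp at h
  linarith

lemma expInt_two_zero : expInt 2 0 = 1 := by
  rw [expInt_two_eq]
  have := integral_Ioi_rpow_of_lt (a := -2) (c := 1) (by norm_num) one_pos
  norm_num at this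
  refine Eq.trans (setIntegral_congr_fun measurableSet_Ioi fun s hs => ?_) this
  have hs' : (0 : ℝ) < s := one_pos.trans (mem_Ioi.1 hs)
  simp

/-- At `x = 0` this relies on `log 0 = 0`. -/
lemma expInt_two_eq_ein {x : ℝ} (hx : 0 ≤ x) : expInt 2 x =
    Real.exp (-x) + x * (Real.eulerMascheroniConstant + Real.log x - ein x) := by
  rcases hx.eq_or_lt with rfl | hx
  · simp [expInt_two_zero]
  · rw [expInt_two_eq_expInt_one hx, expInt_one_eq_ein hx]; ring

/-! ### Continuous functions of polynomial growth -/

/-- Continuous functions on the plane bounded by a polynomial. -/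
def ContPolyBdd (f : E2 → ℂ) : Prop :=
  Continuous f ∧ ∃ (C : ℝ) (k : ℕ), ∀ x, ‖f x‖ ≤ C * (1 + ‖x‖) ^ k

lemma ContPolyBdd.const (c : ℂ) : ContPolyBdd fun _ => c :=
  ⟨continuous_const, ‖c‖, 0, fun x => by simp⟩

lemma ContPolyBdd.mul {f g : E2 → ℂ} (hf : ContPolyBdd f) (hg : ContPolyBdd g) :
    ContPolyBdd fun x => f x * g x := by
  obtain ⟨hfc, C, k, hC⟩ := hf
  obtain ⟨hgc, D, l, hD⟩ := hg
  refine ⟨hfc.mul hgc, C * D, k + l, fun x => ?_⟩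
  rw [norm_mul]
  calc _ ≤ (C * (1 + ‖x‖) ^ k) * (D * (1 + ‖x‖) ^ l) :=
        mul_le_mul (hC x) (hD x) (norm_nonneg _) ((norm_nonneg _).trans (hC x))
    _ = _ := by ring

lemma ContPolyBdd.add {f g : E2 → ℂ} (hf : ContPolyBdd f) (hg : ContPolyBdd g) :
    ContPolyBdd fun x => f x + g x := by
  obtain ⟨hfc, C, k, hC⟩ := hf
  obtain ⟨hgc, D, l, hD⟩ := hg
  have hC0 : 0 ≤ C := by simpa using (norm_nonneg _).trans (hC 0)
  have hD0 : 0 ≤ D := by simpa using (norm_nonneg _).trans (hD 0)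
  refine ⟨hfc.add hgc, C + D, k + l, fun x => (norm_add_le _ _).trans ?_⟩
  have h1 : 1 ≤ 1 + ‖x‖ := by linarith [norm_nonneg x]
  calc _ ≤ C * (1 + ‖x‖) ^ k + D * (1 + ‖x‖) ^ l := add_le_add (hC x) (hD x)
    _ ≤ C * (1 + ‖x‖) ^ (k + l) + D * (1 + ‖x‖) ^ (k + l) := by gcongr <;> omega
    _ = _ := by ring

/-- A continuous profile of at most linear growth in `|x|²`. -/
lemma ContPolyBdd.radial {G : ℝ → ℝ} (hG : Continuous G) {C : ℝ}
    (hC : ∀ s, 0 ≤ s → |G s| ≤ C * (1 + s)) : ContPolyBdd fun x => ((G (‖x‖ ^ 2) : ℝ) : ℂ) := by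
  refine ⟨by fun_prop, C, 2, fun x => ?_⟩
  have hC0 : 0 ≤ C := by simpa using (abs_nonneg _).trans (hC 0 le_rfl)
  rw [Complex.norm_real]
  refine (hC _ (sq_nonneg _)).trans (mul_le_mul_of_nonneg_left ?_ hC0)
  nlinarith [norm_nonneg x]

lemma ContPolyBdd.normSq : ContPolyBdd fun x => ((‖x‖ ^ 2 : ℝ) : ℂ) :=
  .radial (G := fun s => s) continuous_id (C := 1) fun s hs => by rw [abs_of_nonneg hs]; linarith

lemma ContPolyBdd.expMoment (n : ℕ) {c : ℝ} (hc : 0 ≤ c) :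
    ContPolyBdd fun x => ((expMoment n (c * ‖x‖ ^ 2) : ℝ) : ℂ) :=
  .radial (G := fun s => SinglyPeriodic.expMoment n (c * s)) (by fun_prop) (C := 1) fun s hs => by
    linarith [abs_expMoment_le_one n (mul_nonneg hc hs)]

lemma ContPolyBdd.ein {c : ℝ} (hc : 0 ≤ c) :
    ContPolyBdd fun x => ((ein (c * ‖x‖ ^ 2) : ℝ) : ℂ) :=
  .radial (G := fun s => SinglyPeriodic.ein (c * s)) (by fun_prop) (C := c) fun s hs => by
    linarith [abs_ein_le (mul_nonneg hc hs)]

lemma ContPolyBdd.integrable_mul {f : E2 → ℂ} (hf : ContPolyBdd f) (ψ : 𝓢(E2, ℂ)) :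
    Integrable fun x => f x * ψ x := by
  obtain ⟨hfc, C, k, hC⟩ := hf
  have hC0 : 0 ≤ C := by simpa using (norm_nonneg _).trans (hC 0)
  have h1 := (ψ.integrable.norm (μ := volume)).add (ψ.integrable_pow_mul volume k)
  refine (h1.const_mul (C * 2 ^ k)).mono' (hfc.mul ψ.continuous).aestronglyMeasurable
    (Eventually.of_forall fun x => ?_)
  have h2 : (1 + ‖x‖) ^ k ≤ 2 ^ k * (1 + ‖x‖ ^ k) := by
    have h0 := norm_nonneg x
    rcases le_total ‖x‖ 1 with h | h
    · calc (1 + ‖x‖) ^ k ≤ 2 ^ k := by gcongr; linarith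
        _ ≤ _ := le_mul_of_one_le_right (by positivity) (by linarith [pow_nonneg h0 k])
    · calc (1 + ‖x‖) ^ k ≤ (2 * ‖x‖) ^ k := by gcongr; linarith
        _ = 2 ^ k * ‖x‖ ^ k := mul_pow _ _ _
        _ ≤ _ := by gcongr; linarith
  rw [norm_mul]
  calc _ ≤ C * (1 + ‖x‖) ^ k * ‖ψ x‖ := by gcongr; exact hC x
    _ ≤ C * (2 ^ k * (1 + ‖x‖ ^ k)) * ‖ψ x‖ := by gcongr
    _ = _ := by simp only [Pi.add_apply]; ring

/-! ### Distributional inverse transforms -/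

/-- The pairing that defines `IsDistribInvFt`, required for the test functions that are
`O(|κ|^m)`. This asks for no derivatives of the test function, so it is convenient to multiply test
functions by coordinates. -/
def IsWeakInvFt (m : ℕ) (g f : E2 → ℂ) : Prop :=
  (∀ ψ : 𝓢(E2, ℂ), Integrable fun r => f r * ψ r) ∧
  ∀ φ : 𝓢(E2, ℂ), (∃ C, ∀ κ, ‖φ κ‖ ≤ C * ‖κ‖ ^ m) →
    (Integrable fun κ => g κ * φ κ) ∧ ∫ r, f r * ft2S φ r = ∫ κ, g κ * φ κ

lemma norm_iteratedFDeriv_le_of_vanish {m : ℕ} (ψ : 𝓢(E2, ℂ))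
    (h : ∀ n < m, iteratedFDeriv ℝ n (ψ : E2 → ℂ) 0 = 0) (j : ℕ) (hj : j ≤ m) (x : E2) :
    ‖iteratedFDeriv ℝ (m - j) (ψ : E2 → ℂ) x‖ ≤ SchwartzMap.seminorm ℝ 0 m ψ * ‖x‖ ^ j := by
  induction j generalizing x with
  | zero => simpa using ψ.norm_iteratedFDeriv_le_seminorm ℝ m x
  | succ j ih =>
    have hlt : m - (j + 1) < m := by omega
    have hsucc : m - (j + 1) + 1 = m - j := by omega
    have hd : Differentiable ℝ (iteratedFDeriv ℝ (m - (j + 1)) (ψ : E2 → ℂ)) :=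
      (show ContDiff ℝ ((m : ℕ) : WithTop ℕ∞) (ψ : E2 → ℂ) by
        exact_mod_cast ψ.smooth m).differentiable_iteratedFDeriv (Nat.cast_lt.2 hlt)
    have := (convex_closedBall (0 : E2) ‖x‖).norm_image_sub_le_of_norm_fderiv_le
      (f := iteratedFDeriv ℝ (m - (j + 1)) (ψ : E2 → ℂ)) (𝕜 := ℝ) (x := 0) (y := x)
      (C := SchwartzMap.seminorm ℝ 0 m ψ * ‖x‖ ^ j) (fun y _ => hd y) (fun y hy => by
        rw [norm_fderiv_iteratedFDeriv, hsucc]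
        refine (ih (by omega) y).trans ?_
        gcongr
        simpa using hy) (by simp) (by simp)
    rw [h _ hlt, sub_zero, sub_zero] at this
    rw [pow_succ, ← mul_assoc]
    exact this

lemma IsWeakInvFt.isDistribInvFt {m : ℕ} {g f : E2 → ℂ} (h : IsWeakInvFt m g f) :
    IsDistribInvFt m g f := by
  refine ⟨h.1, fun ψ hψ => ?_⟩
  simp only [← ft2S_apply]
  refine h.2 ψ ⟨SchwartzMap.seminorm ℝ 0 m ψ, fun κ => ?_⟩
  have := norm_iteratedFDeriv_le_of_vanish ψ hψ m le_rfl κ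
  rwa [Nat.sub_self, norm_iteratedFDeriv_zero] at this

lemma IsWeakInvFt.mono {m : ℕ} {g f : E2 → ℂ} (h : IsWeakInvFt 0 g f) : IsWeakInvFt m g f :=
  ⟨h.1, fun φ _ => h.2 φ ⟨SchwartzMap.seminorm ℝ 0 0 φ, fun κ => by
    simpa using φ.norm_le_seminorm ℝ κ⟩⟩

lemma IsWeakInvFt.congr {m : ℕ} {g g' f f' : E2 → ℂ} (h : IsWeakInvFt m g f)
    (hg : ∀ κ, κ ≠ 0 → g κ = g' κ) (hf : ∀ r, r ≠ 0 → f r = f' r) : IsWeakInvFt m g' f' := by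
  have hae : ∀ᵐ x : E2, x ≠ 0 := by simp [ae_iff]
  have hg' : ∀ φ : 𝓢(E2, ℂ), (fun κ => g κ * φ κ) =ᵐ[volume] fun κ => g' κ * φ κ := fun φ => by
    filter_upwards [hae] with x hx using by rw [hg x hx]
  have hf' : ∀ φ : 𝓢(E2, ℂ), (fun κ => f κ * φ κ) =ᵐ[volume] fun κ => f' κ * φ κ := fun φ => by
    filter_upwards [hae] with x hx using by rw [hf x hx]
  refine ⟨fun ψ => (h.1 ψ).congr (hf' ψ), fun φ hφ => ?_⟩
  obtain ⟨h1, h2⟩ := h.2 φ hφ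
  exact ⟨h1.congr (hg' φ), by rw [← integral_congr_ae (hf' _), h2, integral_congr_ae (hg' _)]⟩

lemma IsWeakInvFt.add {m : ℕ} {g g' f f' : E2 → ℂ} (h : IsWeakInvFt m g f)
    (h' : IsWeakInvFt m g' f') :
    IsWeakInvFt m (fun κ => g κ + g' κ) (fun r => f r + f' r) := by
  simp only [IsWeakInvFt, add_mul]
  refine ⟨fun ψ => (h.1 ψ).add (h'.1 ψ), fun φ hφ => ?_⟩
  obtain ⟨h1, h2⟩ := h.2 φ hφ
  obtain ⟨h1', h2'⟩ := h'.2 φ hφ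
  exact ⟨h1.add h1', by
    rw [integral_add (h.1 _) (h'.1 _), integral_add h1 h1', h2, h2']⟩

lemma IsWeakInvFt.const_mul {m : ℕ} {g f : E2 → ℂ} (h : IsWeakInvFt m g f) (c : ℂ) :
    IsWeakInvFt m (fun κ => c * g κ) (fun r => c * f r) := by
  simp only [IsWeakInvFt, mul_assoc]
  refine ⟨fun ψ => (h.1 ψ).const_mul c, fun φ hφ => ?_⟩
  obtain ⟨h1, h2⟩ := h.2 φ hφ
  exact ⟨h1.const_mul c, by rw [integral_const_mul, integral_const_mul, h2]⟩

lemma isWeakInvFt_heat {S : Set ℝ} {w : ℝ → ℝ} (hS : MeasurableSet S) (hS0 : S ⊆ Ioi 0)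
    (hw : Measurable w) (hw1 : IntegrableOn (fun t => w t / (1 + t)) S) :
    IsWeakInvFt 0 (fun κ => (heatSym S w κ : ℂ)) (fun r => (heatKer S w r : ℂ)) :=
  ⟨fun ψ => (heat_superposition_pairing hS hS0 hw hw1 ψ).2.1, fun φ _ =>
    have h := heat_superposition_pairing hS hS0 hw hw1 φ
    ⟨h.1, h.2.2⟩⟩

/-- Integrability of symbols with a singularity `1/|κ|` and a quadratic gain at infinity. -/
lemma integrable_of_norm_le_inv_mul {h : E2 → ℂ} (hm : AEStronglyMeasurable h) {E : ℝ}
    (hE : ∀ κ, κ ≠ 0 → ‖h κ‖ ≤ E * (‖κ‖⁻¹ * (1 + ‖κ‖ ^ 2)⁻¹)) : Integrable h := by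
  have h1 : Integrable fun κ : E2 => ‖κ‖⁻¹ * (1 + ‖κ‖ ^ 2)⁻¹ := by
    refine (integrable_fun_norm_addHaar (E := E2) volume
      (f := fun y : ℝ => y⁻¹ * (1 + y ^ 2)⁻¹)).2 ?_
    refine integrable_inv_one_add_sq.integrableOn.congr_fun (fun y hy => ?_) measurableSet_Ioi
    have hy' : y ≠ 0 := ne_of_gt hy
    simp [hy']
  have hae : ∀ᵐ x : E2, x ≠ 0 := by simp [ae_iff]
  exact (h1.const_mul E).mono' hm (by filter_upwards [hae] with x hx using hE x hx)

lemma integrable_mul_of_vanish {m : ℕ} {g : E2 → ℂ} (hm : AEStronglyMeasurable g) {D : ℝ}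
    (hD : ∀ κ, κ ≠ 0 → ‖g κ‖ ≤ D / ‖κ‖ ^ (m + 1)) (φ : 𝓢(E2, ℂ))
    (hφ : ∃ C, ∀ κ, ‖φ κ‖ ≤ C * ‖κ‖ ^ m) : Integrable fun κ => g κ * φ κ := by
  obtain ⟨C, hC⟩ := hφ
  set s0 := SchwartzMap.seminorm ℝ 0 0 φ
  set s2 := SchwartzMap.seminorm ℝ 2 0 φ
  have hs0 : 0 ≤ s0 := apply_nonneg _ _
  have hs2 : 0 ≤ s2 := apply_nonneg _ _
  refine integrable_of_norm_le_inv_mul (hm.mul φ.continuous.aestronglyMeasurable)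
    (E := D * (2 * |C| + s0 + s2)) fun κ hκ => ?_
  have hκ' : 0 < ‖κ‖ := norm_pos_iff.2 hκ
  have hD0 : 0 ≤ D := by
    have := (norm_nonneg _).trans (hD κ hκ)
    by_contra! hneg
    have := div_neg_of_neg_of_pos hneg (pow_pos hκ' (m + 1))
    linarith
  have key : ‖φ κ‖ * (1 + ‖κ‖ ^ 2) ≤ (2 * |C| + s0 + s2) * ‖κ‖ ^ m := by
    rcases le_total ‖κ‖ 1 with h | h
    · calc ‖φ κ‖ * (1 + ‖κ‖ ^ 2) ≤ (|C| * ‖κ‖ ^ m) * 2 := by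
            gcongr
            · exact (hC κ).trans (by gcongr; exact le_abs_self C)
            · nlinarith
        _ = 2 * |C| * ‖κ‖ ^ m := by ring
        _ ≤ _ := by gcongr; linarith
    · have h2 : ‖κ‖ ^ 2 * ‖φ κ‖ ≤ s2 := φ.norm_pow_mul_le_seminorm ℝ 2 κ
      have h0 : ‖φ κ‖ ≤ s0 := φ.norm_le_seminorm ℝ κ
      calc _ ≤ (2 * |C| + s0 + s2) * 1 := by nlinarith [abs_nonneg C]
        _ ≤ _ := by gcongr; exact one_le_pow₀ h
  rw [norm_mul]
  calc _ ≤ D / ‖κ‖ ^ (m + 1) * ((2 * |C| + s0 + s2) * ‖κ‖ ^ m / (1 + ‖κ‖ ^ 2)) := by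
        gcongr
        · exact hD κ hκ
        · rw [le_div_iff₀ (by positivity)]; exact key
    _ = _ := by field_simp; ring

/-! ### The unscreened kernels in two dimensions -/

lemma integrableOn_weight_Ioc {w : ℝ → ℝ} (hw : Continuous w) (a : ℝ) :
    IntegrableOn (fun t => w t / (1 + t)) (Ioc 0 a) := by
  refine (ContinuousOn.integrableOn_Icc (a := 0) (b := a) ?_).mono_set Ioc_subset_Icc_self
  exact hw.continuousOn.div (by fun_prop) fun t ht => by linarith [ht.1]

lemma continuous_harmW (k : ℝ) : Continuous (harmW k) := by unfold harmW; fun_prop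

lemma continuous_biharmW (k : ℝ) : Continuous (biharmW k) := by unfold biharmW; fun_prop

/-- The real-space part of the harmonic kernel. -/
lemma isWeakInvFt_harm_real_part {η : ℝ} (hη : 0 < η) :
    IsWeakInvFt 0 (fun κ => harmHat (join 0 κ) - harmHat (join 0 κ) * ewaldHat η (join 0 κ))
      (fun r => ((expInt 1 (η ^ 2 * ‖r‖ ^ 2) : ℝ) : ℂ)) :=
  (isWeakInvFt_heat measurableSet_Ioc Ioc_subset_Ioi_self (measurable_harmW 0)
    (integrableOn_weight_Ioc (continuous_harmW 0) (1 / (4 * η ^ 2)))).congr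
    (fun κ hκ => (harmHat_sub_mul_ewaldHat (sq_add_norm_sq_pos_right 0 hκ) η).symm)
    (fun r _ => by rw [heatKer_harmW_zero_Ioc hη])

/-- The real-space part of the biharmonic kernel. -/
lemma isWeakInvFt_biharm_real_part {η : ℝ} (hη : 0 < η) :
    IsWeakInvFt 0
      (fun κ => biharmHat (join 0 κ) - biharmHat (join 0 κ) * hasimotoHat η (join 0 κ))
      (fun r => ((-(1 / (2 * η ^ 2)) * expInt 2 (η ^ 2 * ‖r‖ ^ 2) : ℝ) : ℂ)) :=
  ((isWeakInvFt_heat measurableSet_Ioc Ioc_subset_Ioi_self (measurable_biharmW 0)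
    (integrableOn_weight_Ioc (continuous_biharmW 0) (1 / (4 * η ^ 2)))).const_mul (-1)).congr
    (fun κ hκ => by
      rw [biharmHat_sub_mul_hasimotoHat (sq_add_norm_sq_pos_right 0 hκ) η]; ring)
    (fun r _ => by rw [heatKer_biharmW_zero_Ioc hη]; push_cast; ring)

lemma integral_tendsto_zero_of_profile {R : ℝ → E2 → ℂ} (φ : 𝓢(E2, ℂ)) {B : E2 → ℂ}
    (hB : ContPolyBdd B) (hR : ∀ η, ContPolyBdd (R η))
    (hle : ∀ η, 0 < η → η < 1 → ∀ x, ‖R η x‖ ≤ ‖B x‖)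
    (hlim : ∀ x, Tendsto (fun η => R η x) (𝓝[>] 0) (𝓝 0)) :
    Tendsto (fun η => ∫ x, R η x * φ x) (𝓝[>] 0) (𝓝 0) := by
  have h := tendsto_integral_filter_of_dominated_convergence (μ := volume) (l := 𝓝[>] (0 : ℝ))
    (F := fun η x => R η x * φ x) (f := fun _ => 0) (fun x => ‖B x * φ x‖)
    (Eventually.of_forall fun η => ((hR η).integrable_mul φ).aestronglyMeasurable) ?_
    (hB.integrable_mul φ).norm ?_
  · simpa using h
  · filter_upwards [Ioo_mem_nhdsGT one_pos] with η hη
    refine Eventually.of_forall fun x => ?_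
    rw [norm_mul, norm_mul]
    gcongr
    exact hle η hη.1 hη.2 x
  · refine Eventually.of_forall fun x => ?_
    simpa using (hlim x).mul_const (φ x)

lemma tendsto_screening_exponent {x : ℝ} (hx : 0 < x) :
    Tendsto (fun η : ℝ => 1 / (4 * η ^ 2) * x) (𝓝[>] 0) atTop := by
  have h1 : Tendsto (fun η : ℝ => η ^ 2) (𝓝[>] 0) (𝓝[>] 0) := by
    refine tendsto_nhdsWithin_iff.2 ⟨?_, ?_⟩
    · have : Tendsto (fun η : ℝ => η ^ 2) (𝓝 0) (𝓝 (0 ^ 2)) := (continuous_pow 2).tendsto 0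
      simpa using this.mono_left nhdsWithin_le_nhds
    · filter_upwards [self_mem_nhdsWithin] with η hη using pow_pos (mem_Ioi.1 hη) 2
  refine (tendsto_inv_nhdsGT_zero.comp h1).const_mul_atTop (show 0 < x / 4 by positivity)
    |>.congr fun η => ?_
  simp only [Function.comp]
  ring

lemma integrable_harmHat_mul (φ : 𝓢(E2, ℂ)) (hφ : ∃ C, ∀ κ, ‖φ κ‖ ≤ C * ‖κ‖ ^ 1) :
    Integrable fun κ => harmHat (join 0 κ) * φ κ := by
  simp only [harmHat_join]
  refine integrable_mul_of_vanish (m := 1) (D := 4 * Real.pi)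
    (Measurable.aestronglyMeasurable (by fun_prop)) (fun κ hκ => ?_) φ hφ
  rw [Complex.norm_real, Real.norm_of_nonneg (by positivity)]
  simp

lemma integrable_biharmHat_mul (φ : 𝓢(E2, ℂ)) (hφ : ∃ C, ∀ κ, ‖φ κ‖ ≤ C * ‖κ‖ ^ 3) :
    Integrable fun κ => biharmHat (join 0 κ) * φ κ := by
  simp only [biharmHat_join]
  refine integrable_mul_of_vanish (m := 3) (D := 8 * Real.pi)
    (Measurable.aestronglyMeasurable (by fun_prop)) (fun κ hκ => ?_) φ hφ
  rw [Complex.norm_real, norm_neg, Real.norm_of_nonneg (by positivity)]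
  simp [← pow_mul]

/-- Removing the screening: the truncated symbol converges to the full one under the integral. -/
lemma tendsto_integral_unscreened {g : E2 → ℂ} {σ : ℝ → E2 → ℂ} (φ : 𝓢(E2, ℂ))
    (hg : Integrable fun κ => g κ * φ κ)
    (hi : ∀ η > 0, Integrable fun κ => (g κ - g κ * σ η κ) * φ κ)
    (hσ : ∀ η κ, ‖1 - σ η κ‖ ≤ 1)
    (hlim : ∀ κ, κ ≠ 0 → Tendsto (fun η => σ η κ) (𝓝[>] 0) (𝓝 0)) :
    Tendsto (fun η => ∫ κ, (g κ - g κ * σ η κ) * φ κ) (𝓝[>] 0) (𝓝 (∫ κ, g κ * φ κ)) := by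
  have hae : ∀ᵐ x : E2, x ≠ 0 := by simp [ae_iff]
  refine tendsto_integral_filter_of_dominated_convergence (fun κ => ‖g κ * φ κ‖) ?_ ?_ hg.norm ?_
  · filter_upwards [self_mem_nhdsWithin] with η hη using (hi η hη).aestronglyMeasurable
  · refine Eventually.of_forall fun η => Eventually.of_forall fun κ => ?_
    rw [show (g κ - g κ * σ η κ) * φ κ = (1 - σ η κ) * (g κ * φ κ) by ring, norm_mul]
    exact mul_le_of_le_one_left (norm_nonneg _) (hσ η κ)
  · filter_upwards [hae] with κ hκ
    have := ((hlim κ hκ).const_mul (g κ)).const_sub (g κ) |>.mul_const (φ κ)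
    simpa using this

lemma eq_zero_of_tendsto_mul_atTop {c : ℝ → ℝ} {M L : ℂ}
    (hc : Tendsto c (𝓝[>] 0) atTop)
    (h : Tendsto (fun η => (c η : ℂ) * M) (𝓝[>] 0) (𝓝 L)) : M = 0 := by
  have h1 : Tendsto (fun η => ((c η)⁻¹ : ℂ)) (𝓝[>] (0 : ℝ)) (𝓝 0) := by
    have := (Complex.continuous_ofReal.tendsto 0).comp (tendsto_inv_atTop_zero.comp hc)
    simpa [Function.comp_def] using this
  have h2 := h1.mul h
  rw [zero_mul] at h2
  refine tendsto_nhds_unique (tendsto_const_nhds.congr' ?_) h2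
  filter_upwards [hc.eventually_gt_atTop 0] with η hη
  have : (c η : ℂ) ≠ 0 := by exact_mod_cast hη.ne'
  field_simp

lemma tendsto_neg_log_nhdsGT : Tendsto (fun η : ℝ => -Real.log η) (𝓝[>] 0) atTop :=
  tendsto_neg_atBot_atTop.comp Real.tendsto_log_nhdsGT_zero

lemma expInt_one_eq_harmBarZero {η ℓ : ℝ} (hη : 0 < η) (hℓ : 0 < ℓ) {r : E2} (hr : r ≠ 0) :
    ((expInt 1 (η ^ 2 * ‖r‖ ^ 2) : ℝ) : ℂ) = harmBarZero ℓ r +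
      ((-2 * Real.log η + (-Real.eulerMascheroniConstant - 2 * Real.log ℓ) : ℝ) : ℂ) +
      ((ein (η ^ 2 * ‖r‖ ^ 2) : ℝ) : ℂ) := by
  have hr' : 0 < ‖r‖ := norm_pos_iff.2 hr
  rw [harmBarZero, ← Complex.ofReal_add, ← Complex.ofReal_add]
  congr 1
  rw [expInt_one_eq_ein (by positivity), Real.log_mul (by positivity) (by positivity),
    Real.log_pow, Real.log_pow, Real.log_div hr'.ne' hℓ.ne']
  push_cast
  ring

/-- The logarithm as the transform of `4π/|κ|²`: it differs from the real-space part at screening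
parameter `η` by a constant that diverges as `η → 0` and by a function that vanishes in the limit.
Since all the integrals converge, the constant must have been paired with zero. -/
lemma isWeakInvFt_harmBarZero {ℓ : ℝ} (hℓ : 0 < ℓ) :
    IsWeakInvFt 1 (fun κ => harmHat (join 0 κ)) (harmBarZero ℓ) := by
  set c0 : ℝ := -Real.eulerMascheroniConstant - 2 * Real.log ℓ
  have hein : ∀ η : ℝ, ContPolyBdd fun r => ((ein (η ^ 2 * ‖r‖ ^ 2) : ℝ) : ℂ) := fun η =>
    .ein (sq_nonneg η)
  have hae : ∀ᵐ x : E2, x ≠ 0 := by simp [ae_iff]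
  have hint : ∀ ψ : 𝓢(E2, ℂ), Integrable fun r => harmBarZero ℓ r * ψ r := fun ψ => by
    have h1 := (((isWeakInvFt_harm_real_part one_pos).1 ψ).sub
      (ψ.integrable.const_mul ((-2 * Real.log 1 + c0 : ℝ) : ℂ))).sub ((hein 1).integrable_mul ψ)
    refine h1.congr ?_
    filter_upwards [hae] with r hr
    simp only [Pi.sub_apply]
    rw [expInt_one_eq_harmBarZero one_pos hℓ hr]
    ring
  refine ⟨hint, fun φ hφ => ⟨integrable_harmHat_mul φ hφ, ?_⟩⟩
  set M := ∫ r, ft2S φ r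
  have key : ∀ η > 0, (∫ r, harmBarZero ℓ r * ft2S φ r) +
      ((-2 * Real.log η + c0 : ℝ) : ℂ) * M +
      ∫ r, ((ein (η ^ 2 * ‖r‖ ^ 2) : ℝ) : ℂ) * ft2S φ r =
      ∫ κ, (harmHat (join 0 κ) - harmHat (join 0 κ) * ewaldHat η (join 0 κ)) * φ κ := fun η hη => by
    have h1 := (ft2S φ).integrable.const_mul ((-2 * Real.log η + c0 : ℝ) : ℂ) (μ := volume)
    have h2 : Integrable fun r => harmBarZero ℓ r * ft2S φ r +
      ((-2 * Real.log η + c0 : ℝ) : ℂ) * ft2S φ r := (hint _).add h1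
    rw [← ((isWeakInvFt_harm_real_part hη).mono.2 φ hφ).2, ← integral_const_mul,
      ← integral_add (hint _) h1, ← integral_add h2 ((hein η).integrable_mul _)]
    refine integral_congr_ae ?_
    filter_upwards [hae] with r hr
    rw [expInt_one_eq_harmBarZero hη hℓ hr]
    ring
  have hG := tendsto_integral_unscreened (σ := fun η κ => ewaldHat η (join 0 κ)) φ
    (integrable_harmHat_mul φ hφ)
    (fun η hη => ((isWeakInvFt_harm_real_part hη).mono.2 φ hφ).1)
    (fun η κ => by
      rw [ewaldHat_join, ← Complex.ofReal_one, ← Complex.ofReal_sub, Complex.norm_real,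
        Real.norm_eq_abs, abs_le]
      have h1 := Real.exp_pos (-(1 / (4 * η ^ 2) * (0 ^ 2 + ‖κ‖ ^ 2)))
      have h2 : Real.exp (-(1 / (4 * η ^ 2) * (0 ^ 2 + ‖κ‖ ^ 2))) ≤ 1 :=
        Real.exp_le_one_iff.2 (neg_nonpos.2 (by positivity))
      constructor <;> linarith)
    (fun κ hκ => by
      simp only [ewaldHat_join]
      have := (Complex.continuous_ofReal.tendsto 0).comp (Real.tendsto_exp_neg_atTop_nhds_zero.comp
        (tendsto_screening_exponent (sq_add_norm_sq_pos_right 0 hκ)))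
      simpa [Function.comp_def] using this)
  have hR := integral_tendsto_zero_of_profile (ft2S φ)
    (R := fun η r => ((ein (η ^ 2 * ‖r‖ ^ 2) : ℝ) : ℂ)) .normSq hein
    (fun η h0 h1 r => by
      rw [Complex.norm_real, Complex.norm_real, Real.norm_eq_abs, Real.norm_of_nonneg (by positivity)]
      refine (abs_ein_le (by positivity)).trans (mul_le_of_le_one_left (by positivity) ?_)
      exact pow_le_one₀ h0.le h1.le)
    (fun r => by
      have : Continuous fun η : ℝ => ((ein (η ^ 2 * ‖r‖ ^ 2) : ℝ) : ℂ) := by fun_prop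
      have h := (this.tendsto 0).mono_left (nhdsWithin_le_nhds (s := Ioi 0))
      simpa [ein_zero] using h)
  set A := ∫ r, harmBarZero ℓ r * ft2S φ r
  have hc : Tendsto (fun η : ℝ => -2 * Real.log η + c0) (𝓝[>] 0) atTop := by
    refine tendsto_atTop_add_const_right _ _ ?_
    exact (tendsto_neg_log_nhdsGT.const_mul_atTop two_pos).congr fun η => by ring
  have hcM := (hG.sub hR).sub_const A
  have hcM' : Tendsto (fun η => ((-2 * Real.log η + c0 : ℝ) : ℂ) * M) (𝓝[>] 0)
      (𝓝 ((∫ κ, harmHat (join 0 κ) * φ κ) - 0 - A)) := by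
    refine hcM.congr' ?_
    filter_upwards [self_mem_nhdsWithin] with η hη
    rw [← key η hη]
    ring
  have hM : M = 0 := eq_zero_of_tendsto_mul_atTop hc hcM'
  rw [hM] at hcM'
  simp only [mul_zero] at hcM'
  have := tendsto_nhds_unique hcM' tendsto_const_nhds
  show A = ∫ κ, harmHat (join 0 κ) * φ κ
  linear_combination -this

lemma biharm_real_part_eq {η ℓ : ℝ} (hη : 0 < η) (hℓ : 0 < ℓ) (r : E2) :
    ((-(1 / (2 * η ^ 2)) * expInt 2 (η ^ 2 * ‖r‖ ^ 2) : ℝ) : ℂ) = biharmBarZero ℓ r +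
      ((-(1 / (2 * η ^ 2)) : ℝ) : ℂ) +
      ((-Real.log η + (1 / 2 - Real.eulerMascheroniConstant / 2 - Real.log ℓ) : ℝ) : ℂ) *
        ((‖r‖ ^ 2 : ℝ) : ℂ) +
      ((1 / 2 : ℝ) : ℂ) * ((‖r‖ ^ 2 : ℝ) : ℂ) * (((expMoment 0 (η ^ 2 * ‖r‖ ^ 2) : ℝ) : ℂ) +
        ((-1 : ℝ) : ℂ) + ((ein (η ^ 2 * ‖r‖ ^ 2) : ℝ) : ℂ)) := by
  rw [biharmBarZero]
  simp only [← Complex.ofReal_add, ← Complex.ofReal_mul]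
  congr 1
  rw [expInt_two_eq_ein (by positivity)]
  have h := expMoment_zero_mul (η ^ 2 * ‖r‖ ^ 2)
  rcases eq_or_ne r 0 with rfl | hr
  · simp
  have hr' : 0 < ‖r‖ := norm_pos_iff.2 hr
  rw [Real.log_mul (by positivity) (by positivity), Real.log_pow, Real.log_pow,
    Real.log_div hr'.ne' hℓ.ne', show Real.exp (-(η ^ 2 * ‖r‖ ^ 2)) =
      1 - expMoment 0 (η ^ 2 * ‖r‖ ^ 2) * (η ^ 2 * ‖r‖ ^ 2) by linarith]
  push_cast
  field_simp
  ring

/-- The kernel `-ρ² log(ρ/ℓ)` as the transform of `-8π/|κ|⁴`: as in the harmonic case it differs from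
the real-space part by a diverging combination of `1` and `ρ²`, diverging at different rates, and by
a function that vanishes in the limit. -/
lemma isWeakInvFt_biharmBarZero {ℓ : ℝ} (hℓ : 0 < ℓ) :
    IsWeakInvFt 3 (fun κ => biharmHat (join 0 κ)) (biharmBarZero ℓ) := by
  set c0 : ℝ := 1 / 2 - Real.eulerMascheroniConstant / 2 - Real.log ℓ with hc0
  set R : ℝ → E2 → ℂ := fun η r => ((1 / 2 : ℝ) : ℂ) * ((‖r‖ ^ 2 : ℝ) : ℂ) *
    (((expMoment 0 (η ^ 2 * ‖r‖ ^ 2) : ℝ) : ℂ) + ((-1 : ℝ) : ℂ) +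
      ((ein (η ^ 2 * ‖r‖ ^ 2) : ℝ) : ℂ)) with hRdef
  have hRc : ∀ η : ℝ, ContPolyBdd (R η) := fun η =>
    ((ContPolyBdd.const _).mul .normSq).mul
      (((ContPolyBdd.expMoment 0 (sq_nonneg η)).add (.const _)).add (.ein (sq_nonneg η)))
  have hident : ∀ η > 0, ∀ r, ((-(1 / (2 * η ^ 2)) * expInt 2 (η ^ 2 * ‖r‖ ^ 2) : ℝ) : ℂ) =
      biharmBarZero ℓ r + ((-(1 / (2 * η ^ 2)) : ℝ) : ℂ) + ((-Real.log η + c0 : ℝ) : ℂ) *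
        ((‖r‖ ^ 2 : ℝ) : ℂ) + R η r := fun η hη r => biharm_real_part_eq hη hℓ r
  have hint : ∀ ψ : 𝓢(E2, ℂ), Integrable fun r => biharmBarZero ℓ r * ψ r := fun ψ => by
    have h1 := ((((isWeakInvFt_biharm_real_part one_pos).1 ψ).sub
      (ψ.integrable.const_mul ((-(1 / (2 * 1 ^ 2)) : ℝ) : ℂ))).sub
      ((ContPolyBdd.normSq.integrable_mul ψ).const_mul ((-Real.log 1 + c0 : ℝ) : ℂ))).sub
      ((hRc 1).integrable_mul ψ)
    refine h1.congr (Eventually.of_forall fun r => ?_)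
    simp only [Pi.sub_apply]
    rw [hident 1 one_pos]
    ring
  refine ⟨hint, fun φ hφ => ⟨integrable_biharmHat_mul φ hφ, ?_⟩⟩
  set M := ∫ r, ft2S φ r
  set N := ∫ r, ((‖r‖ ^ 2 : ℝ) : ℂ) * ft2S φ r
  have key : ∀ η > 0, (∫ r, biharmBarZero ℓ r * ft2S φ r) +
      ((-(1 / (2 * η ^ 2)) : ℝ) : ℂ) * M + ((-Real.log η + c0 : ℝ) : ℂ) * N +
      ∫ r, R η r * ft2S φ r =
      ∫ κ, (biharmHat (join 0 κ) - biharmHat (join 0 κ) * hasimotoHat η (join 0 κ)) * φ κ :=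
      fun η hη => by
    have h1 := (ft2S φ).integrable.const_mul ((-(1 / (2 * η ^ 2)) : ℝ) : ℂ) (μ := volume)
    have h2 : Integrable fun r => biharmBarZero ℓ r * ft2S φ r +
      ((-(1 / (2 * η ^ 2)) : ℝ) : ℂ) * ft2S φ r := (hint _).add h1
    have h3 := (ContPolyBdd.normSq.integrable_mul (ft2S φ)).const_mul
      ((-Real.log η + c0 : ℝ) : ℂ)
    have h4 : Integrable fun r => biharmBarZero ℓ r * ft2S φ r +
      ((-(1 / (2 * η ^ 2)) : ℝ) : ℂ) * ft2S φ r +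
      ((-Real.log η + c0 : ℝ) : ℂ) * (((‖r‖ ^ 2 : ℝ) : ℂ) * ft2S φ r) := h2.add h3
    rw [← ((isWeakInvFt_biharm_real_part hη).mono.2 φ hφ).2, ← integral_const_mul,
      ← integral_const_mul, ← integral_add (hint _) h1, ← integral_add h2 h3,
      ← integral_add h4 ((hRc η).integrable_mul _)]
    refine integral_congr_ae (Eventually.of_forall fun r => ?_)
    simp only
    rw [hident η hη]
    ring
  have hG := tendsto_integral_unscreened (σ := fun η κ => hasimotoHat η (join 0 κ)) φ
    (integrable_biharmHat_mul φ hφ)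
    (fun η hη => ((isWeakInvFt_biharm_real_part hη).mono.2 φ hφ).1)
    (fun η κ => by
      rw [hasimotoHat_join, ← Complex.ofReal_one, ← Complex.ofReal_sub, Complex.norm_real,
        Real.norm_eq_abs, abs_le]
      set x := 1 / (4 * η ^ 2) * (0 ^ 2 + ‖κ‖ ^ 2)
      have hx : 0 ≤ x := by positivity
      have h1 := Real.exp_pos (-x)
      have h2 : Real.exp (-x) * (1 + x) ≤ 1 := by
        rw [Real.exp_neg, inv_mul_le_iff₀ (Real.exp_pos x)]
        linarith [Real.add_one_le_exp x]
      constructor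
      · linarith
      · have : 0 ≤ Real.exp (-x) * (1 + x) := by positivity
        linarith)
    (fun κ hκ => by
      simp only [hasimotoHat_join]
      have h0 : Tendsto (fun x : ℝ => Real.exp (-x) * (1 + x)) atTop (𝓝 0) := by
        have := Real.tendsto_exp_neg_atTop_nhds_zero.add
          (Real.tendsto_pow_mul_exp_neg_atTop_nhds_zero 1)
        simp only [add_zero] at this
        exact this.congr fun x => by ring
      have := (Complex.continuous_ofReal.tendsto 0).comp (h0.comp
        (tendsto_screening_exponent (sq_add_norm_sq_pos_right 0 hκ)))
      simpa [Function.comp_def] using this)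
  have hR := integral_tendsto_zero_of_profile (ft2S φ) (R := R)
    (B := fun r => ((‖r‖ ^ 2 : ℝ) : ℂ) * (((1 : ℝ) : ℂ) + ((‖r‖ ^ 2 : ℝ) : ℂ)))
    (ContPolyBdd.normSq.mul ((ContPolyBdd.const _).add .normSq)) hRc
    (fun η h0 h1 r => by
      simp only [hRdef, ← Complex.ofReal_add, ← Complex.ofReal_mul, Complex.norm_real,
        Real.norm_eq_abs]
      have hV : 0 ≤ η ^ 2 * ‖r‖ ^ 2 := by positivity
      have hV' : η ^ 2 * ‖r‖ ^ 2 ≤ ‖r‖ ^ 2 :=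
        mul_le_of_le_one_left (by positivity) (pow_le_one₀ h0.le h1.le)
      have e1 := abs_le.1 (abs_expMoment_le_one 0 hV)
      have e2 := abs_le.1 (abs_ein_le hV)
      rw [abs_mul, abs_of_nonneg (by positivity), abs_mul, abs_of_nonneg (by positivity : 0 ≤ ‖r‖ ^ 2),
        mul_comm (1 / 2 : ℝ), mul_assoc]
      gcongr
      rw [abs_of_nonneg (by positivity : 0 ≤ 1 + ‖r‖ ^ 2)]
      have : |expMoment 0 (η ^ 2 * ‖r‖ ^ 2) + -1 + ein (η ^ 2 * ‖r‖ ^ 2)| ≤ 2 + ‖r‖ ^ 2 :=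
        abs_le.2 ⟨by linarith, by linarith⟩
      linarith [sq_nonneg ‖r‖])
    (fun r => by
      have : Continuous fun η : ℝ => R η r := by simp only [hRdef]; fun_prop
      have h := (this.tendsto 0).mono_left (nhdsWithin_le_nhds (s := Ioi 0))
      simpa [hRdef, ein_zero, expMoment] using h)
  set A := ∫ r, biharmBarZero ℓ r * ft2S φ r
  set L := ∫ κ, biharmHat (join 0 κ) * φ κ
  have hc : Tendsto (fun η : ℝ => -Real.log η + c0) (𝓝[>] 0) atTop :=
    tendsto_atTop_add_const_right _ _ tendsto_neg_log_nhdsGT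
  have hMN : Tendsto (fun η => ((-(1 / (2 * η ^ 2)) : ℝ) : ℂ) * M +
      ((-Real.log η + c0 : ℝ) : ℂ) * N) (𝓝[>] 0) (𝓝 (L - 0 - A)) := by
    refine ((hG.sub hR).sub_const A).congr' ?_
    filter_upwards [self_mem_nhdsWithin] with η hη
    rw [← key η hη]
    ring
  -- Multiplication by `η²` removes the slower divergence and isolates the zeroth moment.
  have hM : M = 0 := by
    have hsq : Tendsto (fun η : ℝ => ((2 * η ^ 2 : ℝ) : ℂ)) (𝓝[>] 0) (𝓝 0) := by
      have : Continuous fun η : ℝ => ((2 * η ^ 2 : ℝ) : ℂ) := by fun_prop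
      simpa using (this.tendsto 0).mono_left (nhdsWithin_le_nhds (s := Ioi 0))
    have hlog : Tendsto (fun η : ℝ => ((2 * η ^ 2 * (-Real.log η + c0) : ℝ) : ℂ)) (𝓝[>] 0)
        (𝓝 0) := by
      have : Continuous fun η : ℝ => ((2 * η * (-(η * Real.log η) + η * c0) : ℝ) : ℂ) := by
        have := Real.continuous_mul_log
        fun_prop
      have h := (this.tendsto 0).mono_left (nhdsWithin_le_nhds (s := Ioi 0))
      simp only [mul_zero, zero_mul, Complex.ofReal_zero] at h
      refine h.congr fun η => ?_
      congr 1
      ring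
    have h := (hsq.mul hMN).sub (hlog.mul_const N)
    rw [zero_mul, zero_mul, sub_zero] at h
    have hM' : Tendsto (fun _ : ℝ => -M) (𝓝[>] (0 : ℝ)) (𝓝 0) := by
      refine h.congr' ?_
      filter_upwards [self_mem_nhdsWithin] with η hη
      have : (η : ℂ) ≠ 0 := by exact_mod_cast (ne_of_gt hη)
      push_cast
      field_simp
      ring
    simpa using tendsto_nhds_unique hM' tendsto_const_nhds
  rw [hM] at hMN
  simp only [mul_zero, zero_add] at hMN
  have hN : N = 0 := eq_zero_of_tendsto_mul_atTop hc hMN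
  rw [hN] at hMN
  simp only [mul_zero] at hMN
  have := tendsto_nhds_unique hMN tendsto_const_nhds
  show A = L
  linear_combination -this

/-! ### Derivatives and uniqueness of distributional inverse transforms -/

/-- The partial derivative of a function of the free variables. -/
noncomputable def pd (i : Fin 2) (f : E2 → ℂ) (r : E2) : ℂ :=
  fderiv ℝ f r (EuclideanSpace.single i (1 : ℝ))

/-- The Schwartz function `κ ↦ i κ_i φ(κ)`. -/
noncomputable def mulCoord (i : Fin 2) (φ : 𝓢(E2, ℂ)) : 𝓢(E2, ℂ) :=
  Complex.I • SchwartzMap.smulLeftCLM ℂ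
    (fun κ : E2 => inner ℝ κ (EuclideanSpace.single i (1 : ℝ))) φ

lemma mulCoord_apply (i : Fin 2) (φ : 𝓢(E2, ℂ)) (κ : E2) :
    mulCoord i φ κ = Complex.I * (κ i : ℂ) * φ κ := by
  have : (fun κ : E2 => inner ℝ κ (EuclideanSpace.single i (1 : ℝ))).HasTemperateGrowth :=
    Function.hasTemperateGrowth_inner_left _
  rw [mulCoord, smul_apply, SchwartzMap.smulLeftCLM_apply_apply this,
    EuclideanSpace.inner_single_right]
  simp [mul_assoc]

lemma pd_ft2S (i : Fin 2) (φ : 𝓢(E2, ℂ)) (r : E2) : pd i (ft2S φ) r = -ft2S (mulCoord i φ) r := by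
  rw [pd, ← SchwartzMap.lineDerivOp_apply_eq_fderiv, ft2S,
    SchwartzMap.lineDerivOp_compCLMOfContinuousLinearEquiv]
  have h1 : (ContinuousLinearEquiv.smulLeft (R₁ := ℝ) (M₁ := E2)
      (Units.mk0 (2 * Real.pi)⁻¹ (by positivity))) (EuclideanSpace.single i (1 : ℝ)) =
      (2 * Real.pi)⁻¹ • EuclideanSpace.single i (1 : ℝ) := rfl
  have h2 : -(2 * Real.pi * Complex.I) • (SchwartzMap.smulLeftCLM ℂ
      fun κ : E2 => inner ℝ κ (EuclideanSpace.single i (1 : ℝ))) φ =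
      (-(2 * Real.pi) : ℂ) • mulCoord i φ := by
    rw [mulCoord, smul_smul]; congr 1; ring
  rw [h1, LineDeriv.lineDerivOp_left_smul, SchwartzMap.lineDerivOp_fourier_eq, h2,
    FourierTransform.fourier_smul]
  have h3 : (2 * Real.pi)⁻¹ • (-(2 * Real.pi) : ℂ) •
      FourierTransform.fourier (mulCoord i φ) = -FourierTransform.fourier (mulCoord i φ) := by
    ext x
    have : (Real.pi : ℂ) ≠ 0 := by exact_mod_cast Real.pi_ne_zero
    simp only [smul_apply, neg_apply, Complex.real_smul, smul_eq_mul]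
    push_cast
    field_simp
  rw [h3, map_neg]
  rfl

/-- Differentiation multiplies the symbol by `i κ_i` and lowers the order by one. -/
lemma IsWeakInvFt.pd {m : ℕ} {g f : E2 → ℂ} (h : IsWeakInvFt (m + 1) g f) (i : Fin 2)
    (hf : Differentiable ℝ f) (hf1 : ContPolyBdd (pd i f)) :
    IsWeakInvFt m (fun κ => Complex.I * (κ i : ℂ) * g κ) (pd i f) := by
  refine ⟨hf1.integrable_mul, fun φ ⟨C, hC⟩ => ?_⟩
  obtain ⟨h1, h2⟩ := h.2 (mulCoord i φ) ⟨C, fun κ => by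
    rw [mulCoord_apply, norm_mul, norm_mul, Complex.norm_I, one_mul, Complex.norm_real]
    calc _ ≤ ‖κ‖ * (C * ‖κ‖ ^ m) := mul_le_mul (PiLp.norm_apply_le κ i) (hC κ) (norm_nonneg _)
          (norm_nonneg _)
      _ = _ := by ring⟩
  have e : ∀ κ, g κ * mulCoord i φ κ = Complex.I * (κ i : ℂ) * g κ * φ κ := fun κ => by
    rw [mulCoord_apply]; ring
  simp only [e] at h1 h2
  refine ⟨h1, ?_⟩
  rw [← h2]
  have hp : ∀ r, fderiv ℝ (ft2S φ) r (EuclideanSpace.single i (1 : ℝ)) = -ft2S (mulCoord i φ) r :=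
    pd_ft2S i φ
  have key := integral_mul_fderiv_eq_neg_fderiv_mul_of_integrable (μ := volume) (f := f)
    (g := ft2S φ) (v := EuclideanSpace.single i (1 : ℝ)) (hf1.integrable_mul _)
    (by simp only [hp, mul_neg]; exact (h.1 _).neg) (h.1 _)
    (fun x _ => hf x) (fun x _ => (ft2S φ).differentiableAt)
  simp only [hp, mul_neg, integral_neg, neg_inj] at key
  exact key.symm

/-- The transform `ft2S` is onto the Schwartz functions. -/
lemma exists_ft2S_eq (θ : 𝓢(E2, ℂ)) : ∃ φ, ft2S φ = θ := by
  refine ⟨FourierTransformInv.fourierInv (SchwartzMap.compCLMOfContinuousLinearEquiv ℂ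
    (ContinuousLinearEquiv.smulLeft (R₁ := ℝ) (M₁ := E2)
      (Units.mk0 (2 * Real.pi) (by positivity))) θ), ?_⟩
  ext κ
  rw [ft2S_apply_eq, FourierTransform.fourier_fourierInv_eq]
  change θ ((2 * Real.pi) • (2 * Real.pi)⁻¹ • κ) = θ κ
  rw [smul_smul, mul_inv_cancel₀ (by positivity), one_smul]

lemma invFt2_ft2S (φ : 𝓢(E2, ℂ)) (r : E2) : invFt2 (ft2S φ) r = φ r := by
  have h1 : (FourierTransformInv.fourierInv (FourierTransform.fourier φ) : 𝓢(E2, ℂ)) r = φ r := by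
    rw [FourierTransform.fourierInv_fourier_eq]
  rw [SchwartzMap.fourierInv_coe, Real.fourierInv_eq'] at h1
  rw [← h1, invFt2]
  have h2 := Measure.integral_comp_smul (volume : Measure E2) (fun v : E2 =>
    Complex.exp (((2 * Real.pi * inner ℝ v r : ℝ) : ℂ) * Complex.I) •
      (FourierTransform.fourier φ : 𝓢(E2, ℂ)) v) (2 * Real.pi)⁻¹
  have h3 : ∀ κ : E2, ft2S φ κ * Complex.exp (Complex.I * ((inner ℝ κ r : ℝ) : ℂ)) =
      Complex.exp (((2 * Real.pi * inner ℝ ((2 * Real.pi)⁻¹ • κ) r : ℝ) : ℂ) * Complex.I) •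
      (FourierTransform.fourier φ : 𝓢(E2, ℂ)) ((2 * Real.pi)⁻¹ • κ) := fun κ => by
    rw [ft2S_apply_eq, smul_eq_mul, mul_comm, real_inner_smul_left, ← mul_assoc,
      mul_inv_cancel₀ (by positivity), one_mul, mul_comm Complex.I]
  simp only [h3]
  rw [h2]
  have hd : Module.finrank ℝ E2 = 2 := by simp
  rw [hd, Complex.real_smul, ← mul_assoc, abs_of_nonneg (by positivity)]
  have : (Real.pi : ℂ) ≠ 0 := by exact_mod_cast Real.pi_ne_zero
  rw [show (1 / (2 * (Real.pi : ℂ)) ^ 2 * ((((2 * Real.pi)⁻¹ ^ 2)⁻¹ : ℝ) : ℂ)) = 1 by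
    push_cast; field_simp, one_mul]

lemma integral_invFt2_mul_ft2S {g : E2 → ℂ} (hg : Integrable g) (φ : 𝓢(E2, ℂ)) :
    ∫ r, invFt2 g r * ft2S φ r = ∫ κ, g κ * φ κ := by
  have hint : Integrable (Function.uncurry fun (r κ : E2) =>
      1 / (2 * (Real.pi : ℂ)) ^ 2 * (g κ * Complex.exp (Complex.I * ((inner ℝ κ r : ℝ) : ℂ))) *
        ft2S φ r) (volume.prod volume) := by
    have h2 := (((ft2S φ).integrable.mul_prod hg (μ := volume) (ν := volume)).bdd_mul (c := 1)
      (f := fun p : E2 × E2 => Complex.exp (Complex.I * ((inner ℝ p.2 p.1 : ℝ) : ℂ)))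
      (by fun_prop) (Eventually.of_forall fun p => by
        rw [Complex.norm_exp]; simp)).const_mul (1 / (2 * (Real.pi : ℂ)) ^ 2)
    refine h2.congr (Eventually.of_forall fun p => ?_)
    simp only [Function.uncurry]
    ring
  calc _ = ∫ r : E2, ∫ κ : E2, 1 / (2 * (Real.pi : ℂ)) ^ 2 *
      (g κ * Complex.exp (Complex.I * ((inner ℝ κ r : ℝ) : ℂ))) * ft2S φ r := by
        simp only [invFt2, integral_mul_const, integral_const_mul]
    _ = ∫ κ : E2, ∫ r : E2, 1 / (2 * (Real.pi : ℂ)) ^ 2 *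
      (g κ * Complex.exp (Complex.I * ((inner ℝ κ r : ℝ) : ℂ))) * ft2S φ r :=
        integral_integral_swap hint
    _ = _ := by
      refine integral_congr_ae (Eventually.of_forall fun κ => ?_)
      simp only
      rw [← invFt2_ft2S φ κ, invFt2, ← integral_const_mul, ← integral_const_mul]
      refine integral_congr_ae (Eventually.of_forall fun r => ?_)
      simp only [real_inner_comm κ r]
      ring

lemma continuous_invFt2 {g : E2 → ℂ} (hg : Integrable g) : Continuous (invFt2 g) := by
  refine continuous_const.mul (continuous_of_dominated (bound := fun κ => ‖g κ‖) (fun r => ?_)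
    (fun r => Eventually.of_forall fun κ => ?_) hg.norm (Eventually.of_forall fun κ => by fun_prop))
  · exact hg.aestronglyMeasurable.mul (by fun_prop)
  · rw [norm_mul, Complex.norm_exp]; simp

/-- A continuous weak inverse transform of an integrable symbol is the classical one. -/
lemma IsWeakInvFt.eq_invFt2 {g f : E2 → ℂ} (h : IsWeakInvFt 0 g f) (hg : Integrable g)
    (hf : Continuous f) : f = invFt2 g := by
  have hc := continuous_invFt2 hg
  have hbd : ∀ r, ‖invFt2 g r‖ ≤ ‖1 / (2 * (Real.pi : ℂ)) ^ 2‖ * ∫ κ, ‖g κ‖ := fun r => by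
    rw [invFt2, norm_mul]
    gcongr
    refine (norm_integral_le_integral_norm _).trans (le_of_eq ?_)
    congr 1; ext κ
    rw [norm_mul, Complex.norm_exp]; simp
  have hae : ∀ᵐ r : E2, f r - invFt2 g r = 0 := by
    refine ae_eq_zero_of_integral_contDiff_smul_eq_zero (hf.sub hc).locallyIntegrable
      fun u hu hsupp => ?_
    have hu' : ContDiff ℝ (⊤ : ℕ∞) fun x => ((u x : ℝ) : ℂ) :=
      Complex.ofRealCLM.contDiff.comp hu
    have hsupp' : HasCompactSupport fun x => ((u x : ℝ) : ℂ) :=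
      hsupp.comp_left Complex.ofReal_zero
    obtain ⟨φ, hφ⟩ := exists_ft2S_eq (hsupp'.toSchwartzMap hu')
    have hφ' : ∀ x, ft2S φ x = u x := fun x => by rw [hφ]; rfl
    have h1 := (h.mono (m := 0)).2 φ ⟨SchwartzMap.seminorm ℝ 0 0 φ, fun κ => by
      simpa using φ.norm_le_seminorm ℝ κ⟩
    have h2 := integral_invFt2_mul_ft2S hg φ
    have h3 : Integrable fun r => invFt2 g r * ft2S φ r :=
      (ft2S φ).integrable.bdd_mul hc.aestronglyMeasurable (Eventually.of_forall hbd)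
    have h4 := integral_sub (h.1 (ft2S φ)) h3
    rw [h1.2, h2, sub_self] at h4
    rw [← h4]
    refine integral_congr_ae (Eventually.of_forall fun r => ?_)
    simp only [hφ', Complex.real_smul]
    ring
  have := (Continuous.ae_eq_iff_eq volume (hf.sub hc) continuous_const).1 hae
  funext r
  exact sub_eq_zero.1 (congr_fun this r)

/-! ### Bessel functions -/

lemma setIntegral_Ioi_eq_integral_exp {a : ℝ} (ha : 0 < a) (h : ℝ → ℝ) :
    (IntegrableOn h (Ioi 0) ↔ Integrable fun u => a * Real.exp u * h (a * Real.exp u)) ∧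
    ∫ t in Ioi 0, h t = ∫ u, a * Real.exp u * h (a * Real.exp u) := by
  have himg : (fun u => a * Real.exp u) '' univ = Ioi 0 := by
    ext t
    constructor
    · rintro ⟨u, -, rfl⟩
      exact mem_Ioi.2 (by positivity)
    · intro ht
      have ht' : 0 < t := ht
      exact ⟨Real.log (t / a), mem_univ _, by
        simp only; rw [Real.exp_log (by positivity)]; field_simp⟩
  have hd : ∀ u ∈ univ, HasDerivWithinAt (fun u => a * Real.exp u) (a * Real.exp u) univ u :=
    fun u _ => ((Real.hasDerivAt_exp u).const_mul a).hasDerivWithinAt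
  have hinj : InjOn (fun u => a * Real.exp u) univ := fun u _ v _ huv =>
    Real.exp_injective (mul_left_cancel₀ ha.ne' huv)
  have hpos : ∀ u, |a * Real.exp u| = a * Real.exp u := fun u => abs_of_pos (by positivity)
  constructor
  · rw [← himg, integrableOn_image_iff_integrableOn_abs_deriv_smul MeasurableSet.univ hd hinj]
    simp only [hpos, smul_eq_mul, integrableOn_univ]
  · rw [← himg, integral_image_eq_integral_abs_deriv_smul MeasurableSet.univ hd hinj]
    simp only [hpos, smul_eq_mul, setIntegral_univ]

lemma integral_eq_integral_Ioi_add {F : ℝ → ℝ} (hF : Integrable F) :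
    ∫ u, F u = ∫ u in Ioi 0, (F u + F (-u)) := by
  have h1 : IntegrableOn (fun u => F (-u)) (Ioi 0) := (hF.comp_neg).integrableOn
  rw [integral_add hF.integrableOn h1, integral_comp_neg_Ioi, neg_zero, add_comm,
    ← setIntegral_univ, ← Iic_union_Ioi (a := (0 : ℝ)),
    setIntegral_union (Iic_disjoint_Ioi le_rfl) measurableSet_Ioi hF.integrableOn hF.integrableOn]

/-- With `t = (ρ / 2k) e^u`, the exponent `t k² + ρ² / 4t` becomes `kρ cosh u`. -/
lemma exponent_subst {k ρ : ℝ} (hk : 0 < k) (hρ : 0 < ρ) (u : ℝ) :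
    -(ρ / (2 * k) * Real.exp u * k ^ 2) + -(ρ ^ 2 / (4 * (ρ / (2 * k) * Real.exp u))) =
      -(k * ρ) * Real.cosh u := by
  rw [Real.cosh_eq, Real.exp_neg]
  have := Real.exp_pos u
  field_simp
  ring

lemma exp_neg_inv_le (ρ : ℝ) {t : ℝ} (ht : 0 < t) : Real.exp (-(ρ ^ 2 / (4 * t))) ≤ 1 :=
  Real.exp_le_one_iff.2 (neg_nonpos.2 (by positivity))

lemma integrableOn_biharm_profile {k : ℝ} (hk : k ≠ 0) (ρ : ℝ) :
    IntegrableOn (fun t => Real.exp (-(t * k ^ 2)) * Real.exp (-(ρ ^ 2 / (4 * t)))) (Ioi 0) := by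
  refine (integrableOn_exp_neg_mul_Ioi (show 0 < k ^ 2 by positivity) 0).mono'
    (Measurable.aestronglyMeasurable (by fun_prop)) ?_
  refine (ae_restrict_iff' measurableSet_Ioi).2 (Eventually.of_forall fun t ht => ?_)
  rw [Real.norm_of_nonneg (by positivity)]
  exact mul_le_of_le_one_right (Real.exp_pos _).le (exp_neg_inv_le ρ ht)

lemma exp_neg_inv_div_le {ρ t : ℝ} (hρ : 0 < ρ) (ht : 0 < t) :
    Real.exp (-(ρ ^ 2 / (4 * t))) / t ≤ 4 / ρ ^ 2 := by
  rw [Real.exp_neg, div_le_div_iff₀ ht (by positivity), inv_mul_le_iff₀ (Real.exp_pos _)]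
  have := Real.add_one_le_exp (ρ ^ 2 / (4 * t))
  have h2 : ρ ^ 2 = ρ ^ 2 / (4 * t) * (4 * t) := by field_simp
  nlinarith

lemma integrableOn_harm_profile {k ρ : ℝ} (hk : k ≠ 0) (hρ : 0 < ρ) :
    IntegrableOn (fun t => Real.exp (-(t * k ^ 2)) * (Real.exp (-(ρ ^ 2 / (4 * t))) / t))
      (Ioi 0) := by
  refine ((integrableOn_exp_neg_mul_Ioi (show 0 < k ^ 2 by positivity) 0).mul_const
    (4 / ρ ^ 2)).mono' (Measurable.aestronglyMeasurable (by fun_prop)) ?_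
  refine (ae_restrict_iff' measurableSet_Ioi).2 (Eventually.of_forall fun t ht => ?_)
  have ht' : 0 < t := ht
  rw [Real.norm_of_nonneg (by positivity)]
  exact mul_le_mul_of_nonneg_left (exp_neg_inv_div_le hρ ht') (Real.exp_pos _).le

lemma integral_harm_profile {k ρ : ℝ} (hk : 0 < k) (hρ : 0 < ρ) :
    ∫ t in Ioi 0, Real.exp (-(t * k ^ 2)) * (Real.exp (-(ρ ^ 2 / (4 * t))) / t) =
      2 * besselK 0 (k * ρ) := by
  obtain ⟨h1, h2⟩ := setIntegral_Ioi_eq_integral_exp (a := ρ / (2 * k)) (by positivity)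
    (fun t => Real.exp (-(t * k ^ 2)) * (Real.exp (-(ρ ^ 2 / (4 * t))) / t))
  have e : ∀ u, ρ / (2 * k) * Real.exp u * (Real.exp (-(ρ / (2 * k) * Real.exp u * k ^ 2)) *
      (Real.exp (-(ρ ^ 2 / (4 * (ρ / (2 * k) * Real.exp u)))) / (ρ / (2 * k) * Real.exp u))) =
      Real.exp (-(k * ρ) * Real.cosh u) := fun u => by
    rw [← exponent_subst hk hρ u, Real.exp_add]
    have := Real.exp_pos u
    field_simp
  simp only [e] at h1 h2
  rw [h2, integral_eq_integral_Ioi_add (h1.1 (integrableOn_harm_profile hk.ne' hρ)), besselK,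
    ← integral_const_mul]
  refine setIntegral_congr_fun measurableSet_Ioi fun u _ => ?_
  simp
  ring

lemma integral_biharm_profile {k ρ : ℝ} (hk : 0 < k) (hρ : 0 < ρ) :
    ∫ t in Ioi 0, Real.exp (-(t * k ^ 2)) * Real.exp (-(ρ ^ 2 / (4 * t))) =
      ρ / k * besselK 1 (k * ρ) := by
  obtain ⟨h1, h2⟩ := setIntegral_Ioi_eq_integral_exp (a := ρ / (2 * k)) (by positivity)
    (fun t => Real.exp (-(t * k ^ 2)) * Real.exp (-(ρ ^ 2 / (4 * t))))
  have e : ∀ u, ρ / (2 * k) * Real.exp u * (Real.exp (-(ρ / (2 * k) * Real.exp u * k ^ 2)) *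
      Real.exp (-(ρ ^ 2 / (4 * (ρ / (2 * k) * Real.exp u))))) =
      ρ / (2 * k) * Real.exp u * Real.exp (-(k * ρ) * Real.cosh u) := fun u => by
    rw [← exponent_subst hk hρ u, Real.exp_add]
  simp only [e] at h1 h2
  rw [h2, integral_eq_integral_Ioi_add (h1.1 (integrableOn_biharm_profile hk.ne' ρ)), besselK,
    ← integral_const_mul]
  refine setIntegral_congr_fun measurableSet_Ioi fun u _ => ?_
  simp only [Real.cosh_neg, one_mul]
  rw [Real.cosh_eq u]
  ring

/-! ### The kernels at nonzero longitudinal wave number -/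

lemma heatKer_harmW (S : Set ℝ) (hS : MeasurableSet S) (hS0 : S ⊆ Ioi 0) (k : ℝ) (r : E2) :
    heatKer S (harmW k) r =
      ∫ t in S, Real.exp (-(t * k ^ 2)) * (Real.exp (-(‖r‖ ^ 2 / (4 * t))) / t) := by
  refine setIntegral_congr_fun hS fun t ht => ?_
  have ht' : t ≠ 0 := ne_of_gt (hS0 ht)
  simp only [harmW]
  field_simp

lemma heatKer_biharmW (S : Set ℝ) (hS : MeasurableSet S) (hS0 : S ⊆ Ioi 0) (k : ℝ) (r : E2) :
    heatKer S (biharmW k) r =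
      2 * ∫ t in S, Real.exp (-(t * k ^ 2)) * Real.exp (-(‖r‖ ^ 2 / (4 * t))) := by
  rw [← integral_const_mul]
  refine setIntegral_congr_fun hS fun t ht => ?_
  have ht' : t ≠ 0 := ne_of_gt (hS0 ht)
  simp only [biharmW]
  field_simp
  ring

section Longitudinal

variable {k : ℝ}

lemma isWeakInvFt_harmBar (hk : k ≠ 0) :
    IsWeakInvFt 0 (fun κ => harmHat (join k κ)) (harmBar k) := by
  refine (isWeakInvFt_heat measurableSet_Ioi subset_rfl (measurable_harmW k) ?_).congr
    (fun κ _ => (harmHat_join_eq (sq_add_norm_sq_pos_left hk κ)).symm) fun r hr => ?_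
  · have h := (integrableOn_exp_neg_mul_Ioi (show 0 < k ^ 2 by positivity) 0).const_mul (4 * Real.pi)
    refine h.mono' (((measurable_harmW k).div (by fun_prop)).aestronglyMeasurable) ?_
    refine (ae_restrict_iff' measurableSet_Ioi).2 (Eventually.of_forall fun t ht => ?_)
    have ht' : 0 < t := ht
    rw [harmW, Real.norm_of_nonneg (by positivity)]
    exact div_le_self (by positivity) (by linarith)
  · rw [harmBar, heatKer_harmW _ measurableSet_Ioi subset_rfl, ← sq_abs k,
      integral_harm_profile (abs_pos.2 hk) (norm_pos_iff.2 hr)]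

/-- The screened harmonic symbol and its classical inverse transform. -/
lemma harmBarF_eq {ξ : ℝ} (hξ : 0 < ξ) (hk : k ≠ 0) :
    (Integrable fun κ => harmHat (join k κ) * ewaldHat ξ (join k κ)) ∧
    ∀ r, harmBarF ξ k r = heatKer (Ioi (1 / (4 * ξ ^ 2))) (harmW k) r := by
  have ha : (0 : ℝ) < 1 / (4 * ξ ^ 2) := by positivity
  have hw : IntegrableOn (fun t => harmW k t / t) (Ioi (1 / (4 * ξ ^ 2))) := by
    have h := (integrableOn_exp_neg_mul_Ioi (show 0 < k ^ 2 by positivity)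
      (1 / (4 * ξ ^ 2))).const_mul (4 * Real.pi / (1 / (4 * ξ ^ 2)))
    refine h.mono' (((measurable_harmW k).div (by fun_prop)).aestronglyMeasurable) ?_
    refine (ae_restrict_iff' measurableSet_Ioi).2 (Eventually.of_forall fun t ht => ?_)
    have ht' : 0 < t := ha.trans ht
    rw [harmW, Real.norm_of_nonneg (by positivity), div_mul_eq_mul_div]
    gcongr
    exact (mem_Ioi.1 ht).le
  obtain ⟨h1, h2⟩ := invFt2_heatSym measurableSet_Ioi (Ioi_subset_Ioi ha.le) (measurable_harmW k) hw
  simp only [← harmHat_mul_ewaldHat (sq_add_norm_sq_pos_left hk _)] at h1 h2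
  exact ⟨h1, h2⟩

/-- The biharmonic symbols and their classical inverse transforms. -/
lemma invFt2_neg_heatSym_biharmW (hk : k ≠ 0) {a : ℝ} (ha : 0 ≤ a) :
    (Integrable fun κ => -(heatSym (Ioi a) (biharmW k) κ : ℂ)) ∧
    ∀ r, invFt2 (fun κ => -(heatSym (Ioi a) (biharmW k) κ : ℂ)) r =
      -(heatKer (Ioi a) (biharmW k) r : ℂ) := by
  have hw : IntegrableOn (fun t => biharmW k t / t) (Ioi a) := by
    have h := (integrableOn_exp_neg_mul_Ioi (show 0 < k ^ 2 by positivity) a).const_mul (8 * Real.pi)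
    refine IntegrableOn.congr_fun h (fun t ht => ?_) measurableSet_Ioi
    have ht' : t ≠ 0 := ne_of_gt (ha.trans_lt ht)
    simp only [biharmW]
    field_simp
  obtain ⟨h1, h2⟩ := invFt2_heatSym measurableSet_Ioi (Ioi_subset_Ioi ha) (measurable_biharmW k) hw
  refine ⟨h1.neg, fun r => ?_⟩
  rw [← h2 r]
  simp only [invFt2, neg_mul, integral_neg, mul_neg]

lemma biharmBar_eq (hk : k ≠ 0) :
    (Integrable fun κ => biharmHat (join k κ)) ∧
    ∀ r, biharmBar k r = -(heatKer (Ioi 0) (biharmW k) r : ℂ) := by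
  have h := invFt2_neg_heatSym_biharmW hk le_rfl
  simp only [← biharmHat_join_eq (sq_add_norm_sq_pos_left hk _)] at h
  exact h

lemma biharmBarF_eq {ξ : ℝ} (hk : k ≠ 0) :
    (Integrable fun κ => biharmHat (join k κ) * hasimotoHat ξ (join k κ)) ∧
    ∀ r, biharmBarF ξ k r = -(heatKer (Ioi (1 / (4 * ξ ^ 2))) (biharmW k) r : ℂ) := by
  have h := invFt2_neg_heatSym_biharmW hk (show (0 : ℝ) ≤ 1 / (4 * ξ ^ 2) by positivity)
  simp only [← biharmHat_mul_hasimotoHat (sq_add_norm_sq_pos_left hk _)] at h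
  exact h

lemma biharmBar_eq_besselK (hk : k ≠ 0) {r : E2} (hr : r ≠ 0) :
    biharmBar k r = ((-(2 * ‖r‖ / |k|) * besselK 1 (|k| * ‖r‖) : ℝ) : ℂ) := by
  rw [(biharmBar_eq hk).2, heatKer_biharmW _ measurableSet_Ioi subset_rfl, ← sq_abs k,
    integral_biharm_profile (abs_pos.2 hk) (norm_pos_iff.2 hr), ← Complex.ofReal_neg]
  congr 1
  ring

/-! ### The limit of vanishing longitudinal wave number -/

lemma tendsto_integral_longitudinal {a : ℝ} {f : ℝ → ℝ} (hf : IntegrableOn f (Ioc 0 a)) :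
    Tendsto (fun k : ℝ => ∫ t in Ioc 0 a, Real.exp (-(t * k ^ 2)) * f t) (𝓝[≠] 0)
      (𝓝 (∫ t in Ioc 0 a, f t)) := by
  refine tendsto_integral_filter_of_dominated_convergence (fun t => ‖f t‖)
    (Eventually.of_forall fun k => (by fun_prop : Continuous fun t : ℝ =>
      Real.exp (-(t * k ^ 2))).aestronglyMeasurable.mul hf.aestronglyMeasurable)
    (Eventually.of_forall fun k => ?_) hf.norm (Eventually.of_forall fun t => ?_)
  · refine (ae_restrict_iff' measurableSet_Ioc).2 (Eventually.of_forall fun t ht => ?_)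
    have ht' : 0 < t := ht.1
    rw [norm_mul, Real.norm_of_nonneg (Real.exp_pos _).le]
    exact mul_le_of_le_one_left (norm_nonneg _)
      (Real.exp_le_one_iff.2 (neg_nonpos.2 (by positivity)))
  · have : Continuous fun k : ℝ => Real.exp (-(t * k ^ 2)) * f t := by fun_prop
    simpa using (this.tendsto 0).mono_left (nhdsWithin_le_nhds (s := {0}ᶜ))

lemma tendsto_harmBar_sub {ξ : ℝ} (hξ : 0 < ξ) {r : E2} (hr : r ≠ 0) :
    Tendsto (fun k₁ : ℝ => harmBar k₁ r - harmBarF ξ k₁ r) (𝓝[≠] 0)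
      (𝓝 ((expInt 1 (ξ ^ 2 * ‖r‖ ^ 2) : ℝ) : ℂ)) := by
  have hr' : 0 < ‖r‖ := norm_pos_iff.2 hr
  have ha : (0 : ℝ) ≤ 1 / (4 * ξ ^ 2) := by positivity
  have hf : IntegrableOn (fun t => Real.exp (-(‖r‖ ^ 2 / (4 * t))) / t)
      (Ioc 0 (1 / (4 * ξ ^ 2))) := by
    refine (integrableOn_const (C := 4 / ‖r‖ ^ 2) (by simp)).mono'
      (Measurable.aestronglyMeasurable (by fun_prop)) ?_
    refine (ae_restrict_iff' measurableSet_Ioc).2 (Eventually.of_forall fun t ht => ?_)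
    have ht' : 0 < t := ht.1
    rw [Real.norm_of_nonneg (by positivity)]
    exact exp_neg_inv_div_le hr' ht'
  have h := (Complex.continuous_ofReal.tendsto _).comp (tendsto_integral_longitudinal hf)
  have hE : ∫ t in Ioc 0 (1 / (4 * ξ ^ 2)), Real.exp (-(‖r‖ ^ 2 / (4 * t))) / t =
      expInt 1 (ξ ^ 2 * ‖r‖ ^ 2) := by
    rw [← heatKer_harmW_zero_Ioc hξ, heatKer_harmW _ measurableSet_Ioc Ioc_subset_Ioi_self]
    simp
  rw [hE] at h
  refine h.congr' ?_
  filter_upwards [self_mem_nhdsWithin] with k hk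
  simp only [Function.comp]
  rw [(harmBarF_eq hξ hk).2, harmBar, ← integral_harm_profile (abs_pos.2 hk) hr', sq_abs,
    heatKer_harmW _ measurableSet_Ioi (Ioi_subset_Ioi ha),
    setIntegral_Ioc_eq_sub (integrableOn_harm_profile hk hr') ha, Complex.ofReal_sub]

lemma tendsto_biharmBar_sub {ξ : ℝ} (hξ : 0 < ξ) (r : E2) :
    Tendsto (fun k₁ : ℝ => biharmBar k₁ r - biharmBarF ξ k₁ r) (𝓝[≠] 0)
      (𝓝 ((-(1 / (2 * ξ ^ 2)) * expInt 2 (ξ ^ 2 * ‖r‖ ^ 2) : ℝ) : ℂ)) := by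
  have ha : (0 : ℝ) ≤ 1 / (4 * ξ ^ 2) := by positivity
  have hf : IntegrableOn (fun t => Real.exp (-(‖r‖ ^ 2 / (4 * t)))) (Ioc 0 (1 / (4 * ξ ^ 2))) := by
    refine (integrableOn_const (C := (1 : ℝ)) (by simp)).mono'
      (Measurable.aestronglyMeasurable (by fun_prop)) ?_
    refine (ae_restrict_iff' measurableSet_Ioc).2 (Eventually.of_forall fun t ht => ?_)
    rw [Real.norm_of_nonneg (by positivity)]
    exact exp_neg_inv_le _ ht.1
  have h := (Complex.continuous_ofReal.tendsto _).comp
    ((tendsto_integral_longitudinal hf).const_mul (-2))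
  have hE : -2 * ∫ t in Ioc 0 (1 / (4 * ξ ^ 2)), Real.exp (-(‖r‖ ^ 2 / (4 * t))) =
      -(1 / (2 * ξ ^ 2)) * expInt 2 (ξ ^ 2 * ‖r‖ ^ 2) := by
    rw [neg_mul, neg_mul, ← heatKer_biharmW_zero_Ioc hξ,
      heatKer_biharmW _ measurableSet_Ioc Ioc_subset_Ioi_self]
    simp
  rw [hE] at h
  refine h.congr' ?_
  filter_upwards [self_mem_nhdsWithin] with k hk
  simp only [Function.comp]
  rw [(biharmBarF_eq hk).2, (biharmBar_eq hk).2, heatKer_biharmW _ measurableSet_Ioi subset_rfl,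
    heatKer_biharmW _ measurableSet_Ioi (Ioi_subset_Ioi ha),
    setIntegral_Ioc_eq_sub (integrableOn_biharm_profile hk ‖r‖) ha]
  push_cast
  ring

end Longitudinal

/-! ### Derivatives of functions of the free variables -/

/-- The partial derivative in direction `m` of a function of the free variables regarded as a
function on `ℝ³`; it is zero in the periodic direction. -/
noncomputable def freeDeriv (m : Fin 3) (f : E2 → ℂ) : E2 → ℂ :=
  Fin.cases (fun _ => 0) (fun i => pd i f) m

/-- The components of `(0, r₂, r₃)`. -/
noncomputable def coord (m : Fin 3) (r : E2) : ℝ := join 0 r m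

/-- The derivative of `coord l` in direction `m`. -/
noncomputable def freeKron (m l : Fin 3) : ℝ := if m = l ∧ m ≠ 0 then 1 else 0

@[simp] lemma coord_zero (r : E2) : coord 0 r = 0 := rfl
@[simp] lemma coord_one (r : E2) : coord 1 r = r 0 := rfl
@[simp] lemma coord_two (r : E2) : coord 2 r = r 1 := rfl
lemma coord_succ (i : Fin 2) (r : E2) : coord i.succ r = r i := by fin_cases i <;> rfl

@[fun_prop]
lemma continuous_coord (m : Fin 3) : Continuous (coord m) := by
  refine Fin.cases ?_ (fun i => ?_) m
  · exact continuous_const (y := (0 : ℝ))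
  · rw [show coord i.succ = fun r => r i from funext (coord_succ i)]
    fun_prop

lemma coord_at_zero (m : Fin 3) : coord m 0 = 0 := by fin_cases m <;> simp

lemma abs_coord_le (m : Fin 3) (r : E2) : |coord m r| ≤ ‖r‖ := by
  refine Fin.cases ?_ (fun i => ?_) m
  · simp
  · rw [coord_succ]; exact PiLp.norm_apply_le r i

lemma norm_sq_eq_coord (r : E2) : ‖r‖ ^ 2 = r 0 ^ 2 + r 1 ^ 2 := by
  simp [EuclideanSpace.norm_sq_eq, Fin.sum_univ_two]

lemma ContPolyBdd.coord (m : Fin 3) :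
    ContPolyBdd fun r => ((SinglyPeriodic.coord m r : ℝ) : ℂ) :=
  ⟨by fun_prop, 1, 1, fun r => by
    rw [Complex.norm_real]
    linarith [abs_coord_le m r, Real.norm_eq_abs (SinglyPeriodic.coord m r)]⟩

/-- The projection of `ℝ³` onto the free directions. -/
noncomputable def freeProj : E3 →L[ℝ] E2 :=
  (EuclideanSpace.equiv (Fin 2) ℝ).symm.toContinuousLinearMap.comp
    (ContinuousLinearMap.pi ![EuclideanSpace.proj 1, EuclideanSpace.proj 2])

lemma freeProj_apply (r : E3) : freeProj r = !₂[r 1, r 2] := by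
  ext i; fin_cases i <;> simp [freeProj]

lemma lift_eq (f : E2 → ℂ) : lift f = fun r => f (freeProj r) := by
  funext r; rw [lift, freeProj_apply]

lemma freeProj_join (r : E2) : freeProj (join 0 r) = r := by
  rw [freeProj_apply]; ext i; fin_cases i <;> simp [join]

lemma lift_join (f : E2 → ℂ) (r : E2) : lift f (join 0 r) = f r := by
  rw [lift_eq]; simp only [freeProj_join]

lemma freeProj_single_zero : freeProj (EuclideanSpace.single 0 (1 : ℝ)) = 0 := by
  rw [freeProj_apply]; ext i; fin_cases i <;> simp

lemma freeProj_single_succ (i : Fin 2) :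
    freeProj (EuclideanSpace.single i.succ (1 : ℝ)) = EuclideanSpace.single i (1 : ℝ) := by
  rw [freeProj_apply]; ext j; fin_cases i <;> fin_cases j <;> simp

lemma grad_lift_apply (m : Fin 3) {f : E2 → ℂ} {r : E3} (hf : DifferentiableAt ℝ f (freeProj r)) :
    grad m (lift f) r = freeDeriv m f (freeProj r) := by
  have h : HasFDerivAt (lift f) ((fderiv ℝ f (freeProj r)).comp freeProj) r := by
    rw [lift_eq]; exact hf.hasFDerivAt.comp r freeProj.hasFDerivAt
  rw [grad, h.fderiv, ContinuousLinearMap.comp_apply]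
  refine Fin.cases ?_ (fun i => ?_) m
  · rw [freeProj_single_zero, map_zero]; rfl
  · rw [freeProj_single_succ]; rfl

lemma grad_lift (m : Fin 3) {f : E2 → ℂ} (hf : Differentiable ℝ f) :
    grad m (lift f) = lift (freeDeriv m f) := by
  funext r
  rw [grad_lift_apply m (hf _), lift_eq]

lemma freeDeriv_add (m : Fin 3) {f g : E2 → ℂ} (hf : Differentiable ℝ f)
    (hg : Differentiable ℝ g) :
    freeDeriv m (fun r => f r + g r) = fun r => freeDeriv m f r + freeDeriv m g r := by
  funext r
  refine Fin.cases ?_ (fun i => ?_) m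
  · simp [freeDeriv]
  · simp [freeDeriv, pd, fderiv_fun_add (hf r) (hg r)]

lemma freeDeriv_const_mul (m : Fin 3) {f : E2 → ℂ} (hf : Differentiable ℝ f) (c : ℂ) :
    freeDeriv m (fun r => c * f r) = fun r => c * freeDeriv m f r := by
  funext r
  refine Fin.cases ?_ (fun i => ?_) m
  · simp [freeDeriv]
  · simp [freeDeriv, pd, fderiv_const_mul (hf r) c]

lemma differentiable_coord (l : Fin 3) : Differentiable ℝ fun r => ((coord l r : ℝ) : ℂ) := by
  refine Fin.cases ?_ (fun i => ?_) l
  · exact differentiable_const (c := ((0 : ℝ) : ℂ))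
  · simp only [coord_succ]
    exact Complex.ofRealCLM.differentiable.comp (by fun_prop)

lemma freeDeriv_coord (m l : Fin 3) :
    freeDeriv m (fun r => ((coord l r : ℝ) : ℂ)) = fun _ => (freeKron m l : ℂ) := by
  funext r
  refine Fin.cases ?_ (fun i => ?_) m
  · simp [freeDeriv, freeKron]
  · refine Fin.cases ?_ (fun j => ?_) l
    · simp [freeDeriv, freeKron, pd]
    · have h : HasFDerivAt (fun r : E2 => ((coord j.succ r : ℝ) : ℂ))
          (Complex.ofRealCLM.comp (EuclideanSpace.proj j)) r := by
        simp only [coord_succ]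
        exact Complex.ofRealCLM.hasFDerivAt.comp r
          (EuclideanSpace.proj j : E2 →L[ℝ] ℝ).hasFDerivAt
      simp only [freeDeriv, Fin.cases_succ, pd, h.fderiv, freeKron]
      fin_cases i <;> fin_cases j <;> simp

lemma freeDeriv_coord_mul (m l : Fin 3) {f : E2 → ℂ} (hf : Differentiable ℝ f) :
    freeDeriv m (fun r => (coord l r : ℂ) * f r) =
      fun r => (freeKron m l : ℂ) * f r + (coord l r : ℂ) * freeDeriv m f r := by
  funext r
  have h := congr_fun (freeDeriv_coord m l) r
  revert h
  refine Fin.cases ?_ (fun i => ?_) m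
  · intro h
    simp [freeDeriv, freeKron]
  · intro h
    simp only [freeDeriv, Fin.cases_succ, pd] at h ⊢
    rw [fderiv_fun_mul (differentiable_coord l r) (hf r)]
    simp only [add_apply, smul_apply, smul_eq_mul, h]
    ring

/-- The radial function with profile `G` in the variable `|r|²`. -/
noncomputable def radial (G : ℝ → ℝ) (r : E2) : ℂ := ((G (‖r‖ ^ 2) : ℝ) : ℂ)

lemma hasFDerivAt_radial {G : ℝ → ℝ} {g : ℝ} (r : E2) (hG : HasDerivAt G g (‖r‖ ^ 2)) :
    HasFDerivAt (radial G)
      (Complex.ofRealCLM.comp (g • (2 : ℝ) • (innerSL ℝ r : E2 →L[ℝ] ℝ))) r := by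
  have h1 : HasFDerivAt (fun x : E2 => ‖x‖ ^ 2) ((2 : ℝ) • (innerSL ℝ r : E2 →L[ℝ] ℝ)) r := by
    have := (hasStrictFDerivAt_norm_sq r).hasFDerivAt
    simpa [two_smul] using this
  exact Complex.ofRealCLM.hasFDerivAt.comp r (hG.comp_hasFDerivAt r h1)

lemma differentiable_radial {G G' : ℝ → ℝ} (hG : ∀ s, HasDerivAt G (G' s) s) :
    Differentiable ℝ (radial G) := fun r =>
  (hasFDerivAt_radial r (hG _)).differentiableAt

lemma freeDeriv_radial (m : Fin 3) {G G' : ℝ → ℝ} (hG : ∀ s, HasDerivAt G (G' s) s) :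
    freeDeriv m (radial G) = fun r => 2 * ((coord m r : ℂ) * radial G' r) := by
  funext r
  refine Fin.cases ?_ (fun i => ?_) m
  · simp [freeDeriv]
  · simp only [freeDeriv, Fin.cases_succ, pd, (hasFDerivAt_radial r (hG _)).fderiv, coord_succ,
      radial]
    simp [EuclideanSpace.inner_single_right]
    ring

/-- Multiplication by the symbol of a free derivative, on weak inverse transforms. -/
lemma IsWeakInvFt.freeDeriv {n : ℕ} {g f : E2 → ℂ} (h : IsWeakInvFt (n + 1) g f) (m : Fin 3)
    (hf : Differentiable ℝ f) (hf1 : ContPolyBdd (freeDeriv m f)) :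
    IsWeakInvFt n (fun κ => Complex.I * (coord m κ : ℂ) * g κ) (freeDeriv m f) := by
  revert hf1
  refine Fin.cases (fun _ => ?_) (fun i hf1 => ?_) m
  · simp [IsWeakInvFt, SinglyPeriodic.freeDeriv]
  · simp only [coord_succ]
    exact h.pd i hf hf1

section SecondAndThirdDerivatives

variable {F F₁ F₂ F₃ : ℝ → ℝ}

lemma freeDeriv_freeDeriv_radial (h0 : ∀ s, HasDerivAt F (F₁ s) s)
    (h1 : ∀ s, HasDerivAt F₁ (F₂ s) s) (m l : Fin 3) :
    freeDeriv m (freeDeriv l (radial F)) = fun r =>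
      2 * freeKron m l * radial F₁ r + 4 * ((coord l r : ℂ) * ((coord m r : ℂ) * radial F₂ r)) := by
  have hd := differentiable_radial h1
  have hd' : Differentiable ℝ fun r => (coord l r : ℂ) * radial F₁ r :=
    (differentiable_coord l).mul hd
  rw [freeDeriv_radial l h0, freeDeriv_const_mul m hd',
    freeDeriv_coord_mul m l hd, freeDeriv_radial m h1]
  funext r
  ring

lemma differentiable_freeDeriv_radial (h0 : ∀ s, HasDerivAt F (F₁ s) s)
    (h1 : ∀ s, HasDerivAt F₁ (F₂ s) s) (l : Fin 3) :
    Differentiable ℝ (freeDeriv l (radial F)) := by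
  rw [freeDeriv_radial l h0]
  exact ((differentiable_coord l).mul (differentiable_radial h1)).const_mul 2

lemma differentiable_freeDeriv_freeDeriv_radial (h0 : ∀ s, HasDerivAt F (F₁ s) s)
    (h1 : ∀ s, HasDerivAt F₁ (F₂ s) s) (h2 : ∀ s, HasDerivAt F₂ (F₃ s) s) (m l : Fin 3) :
    Differentiable ℝ (freeDeriv m (freeDeriv l (radial F))) := by
  rw [freeDeriv_freeDeriv_radial h0 h1 m l]
  exact ((differentiable_radial h1).const_mul _).add
    (((differentiable_coord l).mul ((differentiable_coord m).mul
      (differentiable_radial h2))).const_mul 4)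

lemma freeDeriv_three_radial (h0 : ∀ s, HasDerivAt F (F₁ s) s)
    (h1 : ∀ s, HasDerivAt F₁ (F₂ s) s) (h2 : ∀ s, HasDerivAt F₂ (F₃ s) s) (n m l : Fin 3) :
    freeDeriv n (freeDeriv m (freeDeriv l (radial F))) = fun r =>
      4 * (freeKron m l * coord n r + freeKron n l * coord m r + freeKron n m * coord l r) *
        radial F₂ r + 8 * coord l r * coord m r * coord n r * radial F₃ r := by
  have hd1 := differentiable_radial h1
  have hd2 := differentiable_radial h2
  have hd3 : Differentiable ℝ fun r => (coord m r : ℂ) * radial F₂ r :=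
    (differentiable_coord m).mul hd2
  have hd4 : Differentiable ℝ fun r => (coord l r : ℂ) * ((coord m r : ℂ) * radial F₂ r) :=
    (differentiable_coord l).mul hd3
  rw [freeDeriv_freeDeriv_radial h0 h1 m l, freeDeriv_add n (hd1.const_mul _) (hd4.const_mul _),
    freeDeriv_const_mul n hd1, freeDeriv_const_mul n hd4, freeDeriv_coord_mul n l hd3,
    freeDeriv_coord_mul n m hd2, freeDeriv_radial n h1, freeDeriv_radial n h2]
  funext r
  ring

end SecondAndThirdDerivatives

/-! ### The zero modes of the scalar kernels -/

lemma harmZeroMode_eq {ξ : ℝ} (hξ : 0 < ξ) (ℓ : ℝ) {r : E2} (hr : r ≠ 0) :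
    harmZeroMode ξ ℓ r = harmBarZero ℓ r - ((expInt 1 (ξ ^ 2 * ‖r‖ ^ 2) : ℝ) : ℂ) := by
  rw [harmZeroMode, (tendsto_harmBar_sub hξ hr).limUnder_eq]

lemma biharmZeroMode_eq {ξ : ℝ} (hξ : 0 < ξ) (ℓ : ℝ) (r : E2) :
    biharmZeroMode ξ ℓ r = biharmBarZero ℓ r -
      ((-(1 / (2 * ξ ^ 2)) * expInt 2 (ξ ^ 2 * ‖r‖ ^ 2) : ℝ) : ℂ) := by
  rw [biharmZeroMode, (tendsto_biharmBar_sub hξ r).limUnder_eq]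

lemma isWeakInvFt_harmZeroMode {ξ ℓ : ℝ} (hξ : 0 < ξ) (hℓ : 0 < ℓ) :
    IsWeakInvFt 1 (fun κ => harmHat (join 0 κ) * ewaldHat ξ (join 0 κ)) (harmZeroMode ξ ℓ) :=
  ((isWeakInvFt_harmBarZero hℓ).add ((isWeakInvFt_harm_real_part hξ).mono.const_mul (-1))).congr
    (fun κ _ => by ring) fun r hr => by rw [harmZeroMode_eq hξ ℓ hr]; ring

lemma isWeakInvFt_biharmZeroMode {ξ ℓ : ℝ} (hξ : 0 < ξ) (hℓ : 0 < ℓ) :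
    IsWeakInvFt 3 (fun κ => biharmHat (join 0 κ) * hasimotoHat ξ (join 0 κ))
      (biharmZeroMode ξ ℓ) :=
  ((isWeakInvFt_biharmBarZero hℓ).add ((isWeakInvFt_biharm_real_part hξ).mono.const_mul (-1))).congr
    (fun κ _ => by ring) fun r _ => by rw [biharmZeroMode_eq hξ ℓ r]; ring

/-- The smooth profile, in `s = |r|²`, of the harmonic zero mode. -/
noncomputable def harmProfile (ξ ℓ s : ℝ) : ℝ :=
  2 * Real.log ξ + Real.eulerMascheroniConstant + 2 * Real.log ℓ - ein (ξ ^ 2 * s)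

/-- The derivative of `harmProfile`. -/
noncomputable def harmProfile₁ (ξ s : ℝ) : ℝ := -(ξ ^ 2 * expMoment 0 (ξ ^ 2 * s))

/-- The smooth profile, in `s = |r|²`, of the biharmonic zero mode. -/
noncomputable def biharmProfile (ξ ℓ s : ℝ) : ℝ :=
  1 / (2 * ξ ^ 2) + s * (Real.log ξ + Real.eulerMascheroniConstant / 2 + Real.log ℓ
    - 1 / 2 * expMoment 0 (ξ ^ 2 * s) - 1 / 2 * ein (ξ ^ 2 * s))

/-- The derivative of `biharmProfile`. -/
noncomputable def biharmProfile₁ (ξ ℓ s : ℝ) : ℝ :=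
  Real.log ξ + Real.eulerMascheroniConstant / 2 + Real.log ℓ - 1 / 2 - 1 / 2 * ein (ξ ^ 2 * s)

/-- The second derivative of `biharmProfile`. -/
noncomputable def biharmProfile₂ (ξ s : ℝ) : ℝ := -(1 / 2 * ξ ^ 2 * expMoment 0 (ξ ^ 2 * s))

/-- The third derivative of `biharmProfile`. -/
noncomputable def biharmProfile₃ (ξ s : ℝ) : ℝ := -(1 / 2 * ξ ^ 4 * expMoment 1 (ξ ^ 2 * s))

lemma hasDerivAt_comp_const_mul {G : ℝ → ℝ} {g c s : ℝ} (h : HasDerivAt G g (c * s)) :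
    HasDerivAt (fun s => G (c * s)) (c * g) s := by
  have h1 : HasDerivAt (fun s : ℝ => c * s) c s := by
    simpa using (hasDerivAt_id s).const_mul c
  convert! h.comp s h1 using 1
  ring

lemma hasDerivAt_harmProfile (ξ ℓ s : ℝ) :
    HasDerivAt (harmProfile ξ ℓ) (harmProfile₁ ξ s) s :=
  (hasDerivAt_comp_const_mul (hasDerivAt_ein _)).const_sub _

lemma hasDerivAt_biharmProfile (ξ ℓ s : ℝ) :
    HasDerivAt (biharmProfile ξ ℓ) (biharmProfile₁ ξ ℓ s) s := by
  have h1 := hasDerivAt_comp_const_mul (c := ξ ^ 2) (hasDerivAt_expMoment 0 (ξ ^ 2 * s))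
  have h2 := hasDerivAt_comp_const_mul (c := ξ ^ 2) (hasDerivAt_ein (ξ ^ 2 * s))
  have h3 := ((hasDerivAt_id s).mul (((h1.const_mul (1 / 2)).const_sub (Real.log ξ +
    Real.eulerMascheroniConstant / 2 + Real.log ℓ)).sub (h2.const_mul (1 / 2)))).const_add
    (1 / (2 * ξ ^ 2))
  convert! h3 using 1
  have e1 := expMoment_zero_mul (ξ ^ 2 * s)
  have e2 := expMoment_one_mul (ξ ^ 2 * s)
  simp only [biharmProfile₁, id, Pi.sub_apply]
  linear_combination (1 / 2) * e1 + (1 / 2) * e2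

lemma hasDerivAt_biharmProfile₁ (ξ ℓ s : ℝ) :
    HasDerivAt (biharmProfile₁ ξ ℓ) (biharmProfile₂ ξ s) s := by
  convert! ((hasDerivAt_comp_const_mul (c := ξ ^ 2) (hasDerivAt_ein (ξ ^ 2 * s))).const_mul
    (1 / 2)).const_sub (Real.log ξ + Real.eulerMascheroniConstant / 2 + Real.log ℓ - 1 / 2) using 1
  rw [biharmProfile₂]
  ring

lemma hasDerivAt_biharmProfile₂ (ξ s : ℝ) :
    HasDerivAt (biharmProfile₂ ξ) (biharmProfile₃ ξ s) s := by
  convert! ((hasDerivAt_comp_const_mul (c := ξ ^ 2)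
    (hasDerivAt_expMoment 0 (ξ ^ 2 * s))).const_mul (1 / 2 * ξ ^ 2)).neg using 1
  rw [biharmProfile₃]
  ring

lemma harmZeroMode_eq_radial {ξ ℓ : ℝ} (hξ : 0 < ξ) (hℓ : 0 < ℓ) {r : E2} (hr : r ≠ 0) :
    harmZeroMode ξ ℓ r = radial (harmProfile ξ ℓ) r := by
  rw [harmZeroMode_eq hξ ℓ hr, expInt_one_eq_harmBarZero hξ hℓ hr, radial, harmProfile]
  push_cast
  ring

lemma biharmZeroMode_eq_radial {ξ ℓ : ℝ} (hξ : 0 < ξ) (hℓ : 0 < ℓ) :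
    biharmZeroMode ξ ℓ = radial (biharmProfile ξ ℓ) := by
  funext r
  rw [biharmZeroMode_eq hξ ℓ r, biharm_real_part_eq hξ hℓ r, radial, biharmProfile]
  push_cast
  ring

lemma contDiff_biharmZeroMode {ξ ℓ : ℝ} (hξ : 0 < ξ) (hℓ : 0 < ℓ) :
    ContDiff ℝ 3 (biharmZeroMode ξ ℓ) := by
  have h1 : ContDiff ℝ 3 (expMoment 0) := by exact_mod_cast contDiff_expMoment 3 0
  have h2 : ContDiff ℝ 3 ein := by exact_mod_cast contDiff_ein 3
  have h3 : ContDiff ℝ 3 (biharmProfile ξ ℓ) := by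
    unfold biharmProfile
    fun_prop
  rw [biharmZeroMode_eq_radial hξ hℓ]
  exact Complex.ofRealCLM.contDiff.comp (h3.comp (contDiff_norm_sq ℝ))

lemma contPolyBdd_harmProfile₁ (ξ : ℝ) : ContPolyBdd (radial (harmProfile₁ ξ)) := by
  convert (ContPolyBdd.const ((-ξ ^ 2 : ℝ) : ℂ)).mul (ContPolyBdd.expMoment 0 (sq_nonneg ξ)) using 2
  rw [radial, harmProfile₁, ← Complex.ofReal_mul]
  ring_nf

lemma contPolyBdd_biharmProfile₁ (ξ ℓ : ℝ) : ContPolyBdd (radial (biharmProfile₁ ξ ℓ)) := by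
  convert (ContPolyBdd.const ((Real.log ξ + Real.eulerMascheroniConstant / 2 + Real.log ℓ
    - 1 / 2 : ℝ) : ℂ)).add ((ContPolyBdd.const ((-(1 / 2) : ℝ) : ℂ)).mul
      (ContPolyBdd.ein (sq_nonneg ξ))) using 2
  rw [radial, biharmProfile₁, ← Complex.ofReal_mul, ← Complex.ofReal_add]
  ring_nf

lemma contPolyBdd_biharmProfile₂ (ξ : ℝ) : ContPolyBdd (radial (biharmProfile₂ ξ)) := by
  convert (ContPolyBdd.const ((-(1 / 2 * ξ ^ 2) : ℝ) : ℂ)).mul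
    (ContPolyBdd.expMoment 0 (sq_nonneg ξ)) using 2
  rw [radial, biharmProfile₂, ← Complex.ofReal_mul]
  ring_nf

lemma contPolyBdd_biharmProfile₃ (ξ : ℝ) : ContPolyBdd (radial (biharmProfile₃ ξ)) := by
  convert (ContPolyBdd.const ((-(1 / 2 * ξ ^ 4) : ℝ) : ℂ)).mul
    (ContPolyBdd.expMoment 1 (sq_nonneg ξ)) using 2
  rw [radial, biharmProfile₃, ← Complex.ofReal_mul]
  ring_nf

/-! ### Integrability of the rotlet and stresslet symbols -/

@[fun_prop]
lemma measurable_coord (m : Fin 3) : Measurable (coord m) := (continuous_coord m).measurable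

lemma norm_join_zero_sq (κ : E2) : ((‖join 0 κ‖ : ℝ) : ℂ) ^ 2 =
    (coord 0 κ : ℂ) ^ 2 + (coord 1 κ : ℂ) ^ 2 + (coord 2 κ : ℂ) ^ 2 := by
  rw [← Complex.ofReal_pow, norm_join_sq, norm_sq_eq_coord]
  simp

/-- The screening functions decay faster than `1 / (1 + x)`. -/
lemma screening_le {a x : ℝ} (ha : 0 < a) (hx : 0 ≤ x) :
    Real.exp (-(a * x)) * (1 + a * x) ≤ 2 * (1 + 1 / a) * (1 + x)⁻¹ := by
  have hy : 0 ≤ a * x := by positivity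
  have h1 : Real.exp (-(a * x)) * (1 + a * x) ≤ 2 / (1 + a * x) := by
    rw [Real.exp_neg, inv_mul_le_iff₀ (Real.exp_pos _), mul_div_assoc', le_div_iff₀ (by positivity)]
    nlinarith [Real.quadratic_le_exp_of_nonneg hy]
  refine h1.trans ?_
  rw [← div_eq_mul_inv, div_le_div_iff₀ (by positivity) (by positivity)]
  have h2 : (1 + 1 / a) * (1 + a * x) = 1 + a * x + 1 / a + x := by field_simp; ring
  have h3 : 0 ≤ 1 / a := by positivity
  nlinarith

lemma integrable_coord_mul_harm {ξ : ℝ} (hξ : 0 < ξ) (m : Fin 3) :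
    Integrable fun κ => (coord m κ : ℂ) * (harmHat (join 0 κ) * ewaldHat ξ (join 0 κ)) := by
  simp only [harmHat_join, ewaldHat_join]
  have ha : 0 < 1 / (4 * ξ ^ 2) := by positivity
  set a := 1 / (4 * ξ ^ 2)
  refine integrable_of_norm_le_inv_mul (Measurable.aestronglyMeasurable (by fun_prop))
    (E := 4 * Real.pi * (2 * (1 + 1 / a))) fun κ hκ => ?_
  have hκ' : 0 < ‖κ‖ := norm_pos_iff.2 hκ
  have h1 := screening_le ha (sq_nonneg ‖κ‖)
  have h2 : Real.exp (-(a * ‖κ‖ ^ 2)) ≤ Real.exp (-(a * ‖κ‖ ^ 2)) * (1 + a * ‖κ‖ ^ 2) :=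
    le_mul_of_one_le_right (Real.exp_pos _).le (by nlinarith [mul_nonneg ha.le (sq_nonneg ‖κ‖)])
  rw [← Complex.ofReal_mul, ← Complex.ofReal_mul, Complex.norm_real, Real.norm_eq_abs, abs_mul,
    abs_of_nonneg (by positivity : 0 ≤ 4 * Real.pi / (0 ^ 2 + ‖κ‖ ^ 2) *
      Real.exp (-(a * (0 ^ 2 + ‖κ‖ ^ 2))))]
  norm_num only [zero_add]
  calc _ ≤ ‖κ‖ * (4 * Real.pi / ‖κ‖ ^ 2 * (2 * (1 + 1 / a) * (1 + ‖κ‖ ^ 2)⁻¹)) := by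
        gcongr
        · exact abs_coord_le m κ
        · exact h2.trans h1
    _ = _ := by field_simp

lemma integrable_coord_mul_biharm {ξ : ℝ} (hξ : 0 < ξ) (j l m : Fin 3) :
    Integrable fun κ => (coord j κ : ℂ) * coord l κ * coord m κ *
      (biharmHat (join 0 κ) * hasimotoHat ξ (join 0 κ)) := by
  simp only [biharmHat_join, hasimotoHat_join]
  have ha : 0 < 1 / (4 * ξ ^ 2) := by positivity
  set a := 1 / (4 * ξ ^ 2)
  refine integrable_of_norm_le_inv_mul (Measurable.aestronglyMeasurable (by fun_prop))
    (E := 8 * Real.pi * (2 * (1 + 1 / a))) fun κ hκ => ?_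
  have hκ' : 0 < ‖κ‖ := norm_pos_iff.2 hκ
  have h1 := screening_le ha (sq_nonneg ‖κ‖)
  simp only [← Complex.ofReal_mul, Complex.norm_real, Real.norm_eq_abs, abs_mul, abs_neg]
  norm_num only [zero_add]
  rw [abs_of_nonneg (by positivity : 0 ≤ 8 * Real.pi / (‖κ‖ ^ 2) ^ 2),
    abs_of_nonneg (Real.exp_pos _).le, abs_of_nonneg (by positivity : 0 ≤ 1 + a * ‖κ‖ ^ 2)]
  calc _ ≤ ‖κ‖ * ‖κ‖ * ‖κ‖ *
        (8 * Real.pi / (‖κ‖ ^ 2) ^ 2 * (2 * (1 + 1 / a) * (1 + ‖κ‖ ^ 2)⁻¹)) := by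
        gcongr <;> exact abs_coord_le _ κ
    _ = _ := by field_simp

lemma rotletHatF_eq (ξ : ℝ) (j l : Fin 3) (κ : E2) : rotletHatF ξ j l (join 0 κ) =
    -∑ m : Fin 3, eps j l m * (Complex.I * (coord m κ : ℂ) *
      (harmHat (join 0 κ) * ewaldHat ξ (join 0 κ))) := by
  simp only [rotletHatF, rotletOpHat, coord, Fin.sum_univ_three]
  ring

lemma integrable_rotletHatF {ξ : ℝ} (hξ : 0 < ξ) (j l : Fin 3) :
    Integrable fun κ => rotletHatF ξ j l (join 0 κ) := by
  simp only [rotletHatF_eq]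
  refine (integrable_finsetSum _ fun m _ => ?_).neg
  refine (((integrable_coord_mul_harm hξ m).const_mul (eps j l m * Complex.I))).congr
    (Eventually.of_forall fun κ => ?_)
  simp only
  ring

lemma stressletHatF_eq (ξ : ℝ) (j l m : Fin 3) (κ : E2) :
    stressletHatF ξ j l m (join 0 κ) =
    kron j l * ∑ n : Fin 3, (Complex.I * (coord m κ : ℂ) * (Complex.I * (coord n κ : ℂ) *
      (Complex.I * (coord n κ : ℂ) * (biharmHat (join 0 κ) * hasimotoHat ξ (join 0 κ))))) +
    kron m j * ∑ n : Fin 3, (Complex.I * (coord l κ : ℂ) * (Complex.I * (coord n κ : ℂ) *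
      (Complex.I * (coord n κ : ℂ) * (biharmHat (join 0 κ) * hasimotoHat ξ (join 0 κ))))) +
    kron l m * ∑ n : Fin 3, (Complex.I * (coord j κ : ℂ) * (Complex.I * (coord n κ : ℂ) *
      (Complex.I * (coord n κ : ℂ) * (biharmHat (join 0 κ) * hasimotoHat ξ (join 0 κ))))) +
    -2 * (Complex.I * (coord j κ : ℂ) * (Complex.I * (coord l κ : ℂ) *
      (Complex.I * (coord m κ : ℂ) * (biharmHat (join 0 κ) * hasimotoHat ξ (join 0 κ))))) := by
  have hI : Complex.I ^ 3 = -Complex.I := Complex.I_pow_three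
  have e : ∀ j : Fin 3, join 0 κ j = coord j κ := fun _ => rfl
  simp only [stressletHatF, stressletOpHat, Fin.sum_univ_three, norm_join_zero_sq, e]
  ring_nf
  rw [hI]
  ring

lemma integrable_stressletHatF {ξ : ℝ} (hξ : 0 < ξ) (j l m : Fin 3) :
    Integrable fun κ => stressletHatF ξ j l m (join 0 κ) := by
  have h : ∀ j l m : Fin 3, Integrable fun κ => Complex.I * (coord j κ : ℂ) *
      (Complex.I * (coord l κ : ℂ) * (Complex.I * (coord m κ : ℂ) *
        (biharmHat (join 0 κ) * hasimotoHat ξ (join 0 κ)))) := fun j l m =>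
    ((integrable_coord_mul_biharm hξ j l m).const_mul (Complex.I ^ 3)).congr
      (Eventually.of_forall fun κ => by simp only; ring)
  simp only [stressletHatF_eq]
  exact ((((integrable_finsetSum _ fun n _ => h m n n).const_mul _).add
    ((integrable_finsetSum _ fun n _ => h l n n).const_mul _)).add
    ((integrable_finsetSum _ fun n _ => h j n n).const_mul _)).add ((h j l m).const_mul _)

lemma stokesletHatF_eq (ξ : ℝ) (j l : Fin 3) (κ : E2) : stokesletHatF ξ j l (join 0 κ) =
    kron j l * ∑ n : Fin 3, (Complex.I * (coord n κ : ℂ) *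
      (Complex.I * (coord n κ : ℂ) * (biharmHat (join 0 κ) * hasimotoHat ξ (join 0 κ)))) +
    -1 * (Complex.I * (coord j κ : ℂ) * (Complex.I * (coord l κ : ℂ) *
      (biharmHat (join 0 κ) * hasimotoHat ξ (join 0 κ)))) := by
  have e : ∀ j : Fin 3, join 0 κ j = coord j κ := fun _ => rfl
  simp only [stokesletHatF, stokesletOpHat, Fin.sum_univ_three, norm_join_zero_sq, e]
  ring_nf
  rw [Complex.I_sq]
  ring

/-! ### The differential operators on functions of the free variables -/

lemma IsWeakInvFt.sum {m : ℕ} {g f : Fin 3 → E2 → ℂ} (h : ∀ n, IsWeakInvFt m (g n) (f n)) :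
    IsWeakInvFt m (fun κ => ∑ n, g n κ) (fun r => ∑ n, f n r) := by
  simp only [Fin.sum_univ_three]
  exact ((h 0).add (h 1)).add (h 2)

lemma ContPolyBdd.sum {f : Fin 3 → E2 → ℂ} (h : ∀ n, ContPolyBdd (f n)) :
    ContPolyBdd fun r => ∑ n, f n r := by
  simp only [Fin.sum_univ_three]
  exact ((h 0).add (h 1)).add (h 2)

lemma rotletOp_lift (j l : Fin 3) {f : E2 → ℂ} {r : E2} (hf : DifferentiableAt ℝ f r) :
    rotletOp j l (lift f) (join 0 r) = -∑ m : Fin 3, eps j l m * freeDeriv m f r := by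
  rw [rotletOp]
  have h : ∀ m, grad m (lift f) (join 0 r) = freeDeriv m f r := fun m => by
    rw [grad_lift_apply m (by rwa [freeProj_join]), freeProj_join]
  simp only [h]

section Operators

variable {f : E2 → ℂ}

lemma lapl_lift (h0 : Differentiable ℝ f) (h1 : ∀ m, Differentiable ℝ (freeDeriv m f)) :
    lapl (lift f) = lift fun r => ∑ n : Fin 3, freeDeriv n (freeDeriv n f) r := by
  funext r
  simp only [lapl, grad_lift _ h0, grad_lift _ (h1 _)]
  simp only [lift]

lemma stokesletOp_lift (h0 : Differentiable ℝ f) (h1 : ∀ m, Differentiable ℝ (freeDeriv m f))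
    (j l : Fin 3) (r : E2) : stokesletOp j l (lift f) (join 0 r) =
    kron j l * ∑ n : Fin 3, freeDeriv n (freeDeriv n f) r + -1 * freeDeriv j (freeDeriv l f) r := by
  rw [stokesletOp, lapl_lift h0 h1, grad_lift _ h0, grad_lift _ (h1 _), lift_join, lift_join]
  ring

lemma stressletOp_lift (h0 : Differentiable ℝ f) (h1 : ∀ m, Differentiable ℝ (freeDeriv m f))
    (h2 : ∀ m n, Differentiable ℝ (freeDeriv m (freeDeriv n f))) (j l m : Fin 3)
    (r : E2) : stressletOp j l m (lift f) (join 0 r) =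
    kron j l * ∑ n : Fin 3, freeDeriv m (freeDeriv n (freeDeriv n f)) r +
    kron m j * ∑ n : Fin 3, freeDeriv l (freeDeriv n (freeDeriv n f)) r +
    kron l m * ∑ n : Fin 3, freeDeriv j (freeDeriv n (freeDeriv n f)) r +
    -2 * freeDeriv j (freeDeriv l (freeDeriv m f)) r := by
  have hL : ∀ p : Fin 3, grad p (lapl (lift f)) =
      lift fun r => ∑ n : Fin 3, freeDeriv p (freeDeriv n (freeDeriv n f)) r := fun p => by
    rw [lapl_lift h0 h1]
    simp only [Fin.sum_univ_three]
    have d01 : Differentiable ℝ fun r => freeDeriv 0 (freeDeriv 0 f) r +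
      freeDeriv 1 (freeDeriv 1 f) r := (h2 0 0).add (h2 1 1)
    have d012 : Differentiable ℝ fun r => freeDeriv 0 (freeDeriv 0 f) r +
      freeDeriv 1 (freeDeriv 1 f) r + freeDeriv 2 (freeDeriv 2 f) r := d01.add (h2 2 2)
    rw [grad_lift _ d012, freeDeriv_add _ d01 (h2 2 2),
      freeDeriv_add _ (h2 0 0) (h2 1 1)]
  rw [stressletOp, hL, hL, hL, grad_lift _ h0, grad_lift _ (h1 _), grad_lift _ (h2 _ _), lift_join,
    lift_join, lift_join, lift_join]
  ring

end Operators

/-! ### The rotlet -/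

section Rotlet

variable {ξ ℓ : ℝ}

lemma freeDeriv_harmProfile (ξ ℓ : ℝ) (m : Fin 3) : freeDeriv m (radial (harmProfile ξ ℓ)) =
    fun r => 2 * ((coord m r : ℂ) * radial (harmProfile₁ ξ) r) :=
  freeDeriv_radial m (hasDerivAt_harmProfile ξ ℓ)

lemma contPolyBdd_freeDeriv_harmProfile (ξ ℓ : ℝ) (m : Fin 3) :
    ContPolyBdd (freeDeriv m (radial (harmProfile ξ ℓ))) := by
  rw [freeDeriv_harmProfile]
  exact (ContPolyBdd.const 2).mul ((ContPolyBdd.coord m).mul (contPolyBdd_harmProfile₁ ξ))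

lemma rotletZeroMode_eq (hξ : 0 < ξ) (hℓ : 0 < ℓ) (j l : Fin 3) :
    (fun r => rotletZeroMode ξ r j l) =
      fun r => -∑ m : Fin 3, eps j l m * freeDeriv m (radial (harmProfile ξ ℓ)) r := by
  have hw : IsWeakInvFt 1 (fun κ => harmHat (join 0 κ) * ewaldHat ξ (join 0 κ))
      (radial (harmProfile ξ ℓ)) :=
    (isWeakInvFt_harmZeroMode hξ hℓ).congr (fun _ _ => rfl)
      fun r hr => harmZeroMode_eq_radial hξ hℓ hr
  have hd := contPolyBdd_freeDeriv_harmProfile ξ ℓ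
  have hm := fun m => (hw.freeDeriv m (differentiable_radial (hasDerivAt_harmProfile ξ ℓ))
    (hd m)).const_mul (eps j l m)
  have hs := (IsWeakInvFt.sum hm).const_mul (-1)
  have hs' : IsWeakInvFt 0 (fun κ => rotletHatF ξ j l (join 0 κ))
      (fun r => -∑ m : Fin 3, eps j l m * freeDeriv m (radial (harmProfile ξ ℓ)) r) :=
    hs.congr (fun κ _ => by rw [rotletHatF_eq, neg_one_mul]) (fun r _ => by rw [neg_one_mul])
  have hc : Continuous fun r => -∑ m : Fin 3, eps j l m *
      freeDeriv m (radial (harmProfile ξ ℓ)) r :=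
    (continuous_finsetSum _ fun m _ => continuous_const.mul (hd m).1).neg
  exact (hs'.eq_invFt2 (integrable_rotletHatF hξ j l) hc).symm

lemma rotletZeroMode_apply (hξ : 0 < ξ) (r : E2) (j l : Fin 3) : rotletZeroMode ξ r j l =
    -∑ m : Fin 3, eps j l m * (2 * ((coord m r : ℂ) * radial (harmProfile₁ ξ) r)) := by
  have := congr_fun (rotletZeroMode_eq hξ one_pos j l) r
  simpa only [freeDeriv_harmProfile] using this

lemma continuous_rotletZeroMode (hξ : 0 < ξ) : Continuous (rotletZeroMode ξ) := by
  refine continuous_matrix fun j l => ?_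
  simp only [rotletZeroMode_apply hξ]
  have := (contPolyBdd_harmProfile₁ ξ).1
  fun_prop

lemma rotletZeroMode_zero (hξ : 0 < ξ) : rotletZeroMode ξ 0 = 0 := by
  ext j l
  rw [rotletZeroMode_apply hξ]
  simp [coord_at_zero]

lemma harmZeroMode_eventuallyEq (hξ : 0 < ξ) (hℓ : 0 < ℓ) {r : E2} (hr : r ≠ 0) :
    harmZeroMode ξ ℓ =ᶠ[𝓝 r] radial (harmProfile ξ ℓ) := by
  filter_upwards [isOpen_ne.mem_nhds hr] with x hx using harmZeroMode_eq_radial hξ hℓ hx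

lemma freeDeriv_congr {f g : E2 → ℂ} {r : E2} (h : f =ᶠ[𝓝 r] g) (m : Fin 3) :
    freeDeriv m f r = freeDeriv m g r := by
  refine Fin.cases rfl (fun i => ?_) m
  simp only [freeDeriv, Fin.cases_succ, pd, h.fderiv_eq]

lemma harmProfile₁_eq {r : E2} (hr : r ≠ 0) (ξ : ℝ) :
    harmProfile₁ ξ (‖r‖ ^ 2) = -(phi1 ξ r / ‖r‖ ^ 2) := by
  have hr' : ‖r‖ ≠ 0 := norm_ne_zero_iff.2 hr
  have := expMoment_zero_mul (ξ ^ 2 * ‖r‖ ^ 2)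
  rw [harmProfile₁, phi1, auxV, ← this]
  field_simp

lemma rotletZeroMode_of_ne_zero (hξ : 0 < ξ) {r : E2} (hr : r ≠ 0) :
    rotletZeroMode ξ r =
      ((2 * phi1 ξ r / ‖r‖) •
        !![0, rt3 r, -rt2 r;
           -rt3 r, 0, 0;
           rt2 r, 0, 0]).map Complex.ofReal := by
  have hr' : (‖r‖ : ℂ) ≠ 0 := by exact_mod_cast norm_ne_zero_iff.2 hr
  ext j l
  rw [rotletZeroMode_apply hξ]
  simp only [radial, harmProfile₁_eq hr, Fin.sum_univ_three, coord_zero, coord_one, coord_two]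
  fin_cases j <;> fin_cases l <;> simp [eps, rt2, rt3] <;> field_simp <;> norm_num

end Rotlet

/-! ### The stokeslet -/

/-- The Kronecker delta as a real number. -/
noncomputable def kronR (j l : Fin 3) : ℝ := if j = l then 1 else 0

lemma kron_eq (j l : Fin 3) : kron j l = kronR j l := by
  rw [kron, kronR]; split_ifs <;> simp

section Stokes

variable {ξ ℓ : ℝ}

lemma differentiable_biharmProfile (ξ ℓ : ℝ) : Differentiable ℝ (radial (biharmProfile ξ ℓ)) :=
  differentiable_radial (hasDerivAt_biharmProfile ξ ℓ)

lemma differentiable_freeDeriv_biharmProfile (ξ ℓ : ℝ) (m : Fin 3) :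
    Differentiable ℝ (freeDeriv m (radial (biharmProfile ξ ℓ))) :=
  differentiable_freeDeriv_radial (hasDerivAt_biharmProfile ξ ℓ) (hasDerivAt_biharmProfile₁ ξ ℓ) m

lemma differentiable_freeDeriv_two_biharmProfile (ξ ℓ : ℝ) (m l : Fin 3) :
    Differentiable ℝ (freeDeriv m (freeDeriv l (radial (biharmProfile ξ ℓ)))) :=
  differentiable_freeDeriv_freeDeriv_radial (hasDerivAt_biharmProfile ξ ℓ)
    (hasDerivAt_biharmProfile₁ ξ ℓ) (hasDerivAt_biharmProfile₂ ξ) m l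

lemma contPolyBdd_freeDeriv_biharmProfile (ξ ℓ : ℝ) (m : Fin 3) :
    ContPolyBdd (freeDeriv m (radial (biharmProfile ξ ℓ))) := by
  rw [freeDeriv_radial m (hasDerivAt_biharmProfile ξ ℓ)]
  exact (ContPolyBdd.const 2).mul ((ContPolyBdd.coord m).mul (contPolyBdd_biharmProfile₁ ξ ℓ))

lemma contPolyBdd_freeDeriv_two_biharmProfile (ξ ℓ : ℝ) (m l : Fin 3) :
    ContPolyBdd (freeDeriv m (freeDeriv l (radial (biharmProfile ξ ℓ)))) := by
  rw [freeDeriv_freeDeriv_radial (hasDerivAt_biharmProfile ξ ℓ) (hasDerivAt_biharmProfile₁ ξ ℓ)]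
  exact ((ContPolyBdd.const _).mul (contPolyBdd_biharmProfile₁ ξ ℓ)).add
    ((ContPolyBdd.const 4).mul ((ContPolyBdd.coord l).mul ((ContPolyBdd.coord m).mul
      (contPolyBdd_biharmProfile₂ ξ))))

lemma contPolyBdd_freeDeriv_three_biharmProfile (ξ ℓ : ℝ) (n m l : Fin 3) :
    ContPolyBdd (freeDeriv n (freeDeriv m (freeDeriv l (radial (biharmProfile ξ ℓ))))) := by
  rw [freeDeriv_three_radial (hasDerivAt_biharmProfile ξ ℓ) (hasDerivAt_biharmProfile₁ ξ ℓ)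
    (hasDerivAt_biharmProfile₂ ξ)]
  exact (((ContPolyBdd.const 4).mul ((((ContPolyBdd.const _).mul (.coord n)).add
    ((ContPolyBdd.const _).mul (.coord m))).add ((ContPolyBdd.const _).mul (.coord l)))).mul
    (contPolyBdd_biharmProfile₂ ξ)).add
    (((((ContPolyBdd.const 8).mul (.coord l)).mul (.coord m)).mul (.coord n)).mul
      (contPolyBdd_biharmProfile₃ ξ))

lemma isWeakInvFt_freeDeriv_two (hξ : 0 < ξ) (hℓ : 0 < ℓ) (m l : Fin 3) :
    IsWeakInvFt 1 (fun κ => Complex.I * (coord m κ : ℂ) * (Complex.I * (coord l κ : ℂ) *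
      (biharmHat (join 0 κ) * hasimotoHat ξ (join 0 κ))))
      (freeDeriv m (freeDeriv l (radial (biharmProfile ξ ℓ)))) := by
  have h := isWeakInvFt_biharmZeroMode hξ hℓ
  rw [biharmZeroMode_eq_radial hξ hℓ] at h
  exact (h.freeDeriv l (differentiable_biharmProfile ξ ℓ)
    (contPolyBdd_freeDeriv_biharmProfile ξ ℓ l)).freeDeriv m
    (differentiable_freeDeriv_biharmProfile ξ ℓ l)
    (contPolyBdd_freeDeriv_two_biharmProfile ξ ℓ m l)

lemma isWeakInvFt_freeDeriv_three (hξ : 0 < ξ) (hℓ : 0 < ℓ) (n m l : Fin 3) :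
    IsWeakInvFt 0 (fun κ => Complex.I * (coord n κ : ℂ) * (Complex.I * (coord m κ : ℂ) *
      (Complex.I * (coord l κ : ℂ) * (biharmHat (join 0 κ) * hasimotoHat ξ (join 0 κ)))))
      (freeDeriv n (freeDeriv m (freeDeriv l (radial (biharmProfile ξ ℓ))))) :=
  (isWeakInvFt_freeDeriv_two hξ hℓ m l).freeDeriv n
    (differentiable_freeDeriv_two_biharmProfile ξ ℓ m l)
    (contPolyBdd_freeDeriv_three_biharmProfile ξ ℓ n m l)

lemma stokesletZeroMode_eq (hξ : 0 < ξ) (hℓ : 0 < ℓ) (r : E2) (j l : Fin 3) :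
    stokesletZeroMode ξ ℓ r j l =
      kron j l * ∑ n : Fin 3, freeDeriv n (freeDeriv n (radial (biharmProfile ξ ℓ))) r +
        -1 * freeDeriv j (freeDeriv l (radial (biharmProfile ξ ℓ))) r := by
  rw [stokesletZeroMode, Matrix.of_apply, biharmZeroMode_eq_radial hξ hℓ,
    stokesletOp_lift (differentiable_biharmProfile ξ ℓ) (differentiable_freeDeriv_biharmProfile ξ ℓ)]

lemma isWeakInvFt_stokesletZeroMode (hξ : 0 < ξ) (hℓ : 0 < ℓ) (j l : Fin 3) :
    IsWeakInvFt 1 (fun κ => stokesletHatF ξ j l (join 0 κ))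
      (fun r => stokesletZeroMode ξ ℓ r j l) := by
  simp only [stokesletHatF_eq, stokesletZeroMode_eq hξ hℓ]
  exact ((IsWeakInvFt.sum fun n => isWeakInvFt_freeDeriv_two hξ hℓ n n).const_mul _).add
    ((isWeakInvFt_freeDeriv_two hξ hℓ j l).const_mul _)

lemma stokesletZeroMode_apply (hξ : 0 < ξ) (hℓ : 0 < ℓ) (r : E2) (j l : Fin 3) :
    stokesletZeroMode ξ ℓ r j l = ((kronR j l *
      (4 * biharmProfile₁ ξ ℓ (‖r‖ ^ 2) + 4 * ‖r‖ ^ 2 * biharmProfile₂ ξ (‖r‖ ^ 2)) -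
      (2 * freeKron j l * biharmProfile₁ ξ ℓ (‖r‖ ^ 2) +
        4 * coord l r * coord j r * biharmProfile₂ ξ (‖r‖ ^ 2)) : ℝ) : ℂ) := by
  rw [stokesletZeroMode_eq hξ hℓ, kron_eq]
  have k0 : freeKron 0 0 = 0 := by simp [freeKron]
  have k1 : freeKron 1 1 = 1 := by simp [freeKron]
  have k2 : freeKron 2 2 = 1 := by simp [freeKron]
  simp only [freeDeriv_freeDeriv_radial (hasDerivAt_biharmProfile ξ ℓ)
    (hasDerivAt_biharmProfile₁ ξ ℓ), Fin.sum_univ_three, radial, k0, k1, k2, coord_zero, coord_one,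
    coord_two]
  rw [mul_assoc 4 (‖r‖ ^ 2), norm_sq_eq_coord r]
  push_cast
  ring

lemma biharmProfile₁_eq (hξ : 0 < ξ) (ℓ : ℝ) {r : E2} (hr : r ≠ 0) :
    biharmProfile₁ ξ ℓ (‖r‖ ^ 2) = Real.log ℓ - phi0 ξ r / 2 := by
  have hr' : 0 < ‖r‖ := norm_pos_iff.2 hr
  rw [biharmProfile₁, phi0, auxV, expInt_one_eq_ein (by positivity),
    Real.log_mul (by positivity) (by positivity), Real.log_pow ξ]
  push_cast
  ring

lemma biharmProfile₂_eq {r : E2} (hr : r ≠ 0) (ξ : ℝ) :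
    biharmProfile₂ ξ (‖r‖ ^ 2) = -(phi1 ξ r / (2 * ‖r‖ ^ 2)) := by
  have hr' : ‖r‖ ≠ 0 := norm_ne_zero_iff.2 hr
  have := expMoment_zero_mul (ξ ^ 2 * ‖r‖ ^ 2)
  rw [biharmProfile₂, phi1, auxV, ← this]
  field_simp

lemma biharmProfile₃_eq {r : E2} (hr : r ≠ 0) (ξ : ℝ) :
    biharmProfile₃ ξ (‖r‖ ^ 2) = phi2 ξ r / (2 * ‖r‖ ^ 4) := by
  have hr' : ‖r‖ ≠ 0 := norm_ne_zero_iff.2 hr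
  have e1 := expMoment_zero_mul (ξ ^ 2 * ‖r‖ ^ 2)
  have e2 := expMoment_one_mul (ξ ^ 2 * ‖r‖ ^ 2)
  rw [biharmProfile₃, phi2, phi1, auxV, ← e1, eq_div_iff (by positivity)]
  linear_combination (-(ξ ^ 2 * ‖r‖ ^ 2)) * e2

lemma biharmProfile₁_zero (ξ ℓ : ℝ) : biharmProfile₁ ξ ℓ 0 =
    Real.log ξ + Real.eulerMascheroniConstant / 2 + Real.log ℓ - 1 / 2 := by
  simp [biharmProfile₁, ein_zero]

@[fun_prop]
lemma continuous_biharmProfile₁ (ξ ℓ : ℝ) : Continuous (biharmProfile₁ ξ ℓ) := by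
  unfold biharmProfile₁; fun_prop

@[fun_prop]
lemma continuous_biharmProfile₂ (ξ : ℝ) : Continuous (biharmProfile₂ ξ) := by
  unfold biharmProfile₂; fun_prop

lemma continuous_stokesletZeroMode (hξ : 0 < ξ) (hℓ : 0 < ℓ) :
    Continuous (stokesletZeroMode ξ ℓ) := by
  refine continuous_matrix fun j l => ?_
  simp only [stokesletZeroMode_apply hξ hℓ]
  fun_prop

lemma stokesletZeroMode_gauge (hξ : 0 < ξ) (hℓ : 0 < ℓ) (r : E2) :
    stokesletZeroMode ξ ℓ r = stokesletZeroMode ξ 1 r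
      + (Real.log ℓ • !![4, 0, 0; 0, 2, 0; 0, 0, 2]).map Complex.ofReal := by
  ext j l
  rw [Matrix.add_apply, stokesletZeroMode_apply hξ hℓ, stokesletZeroMode_apply hξ one_pos]
  fin_cases j <;> fin_cases l <;> simp [kronR, freeKron, biharmProfile₁] <;> ring

lemma stokesletZeroMode_of_ne_zero (hξ : 0 < ξ) {r : E2} (hr : r ≠ 0) :
    stokesletZeroMode ξ 1 r =
      (-!![2 * (phi0 ξ r + phi1 ξ r), 0, 0;
           0, phi0 ξ r + 2 * rt3 r ^ 2 * phi1 ξ r, -2 * rt2 r * rt3 r * phi1 ξ r;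
           0, -2 * rt2 r * rt3 r * phi1 ξ r,
             phi0 ξ r + 2 * rt2 r ^ 2 * phi1 ξ r]).map Complex.ofReal := by
  have hr' : ‖r‖ ≠ 0 := norm_ne_zero_iff.2 hr
  have hn := norm_sq_eq_coord r
  ext j l
  rw [stokesletZeroMode_apply hξ one_pos, biharmProfile₁_eq hξ 1 hr, biharmProfile₂_eq hr,
    Matrix.map_apply, Real.log_one]
  refine congrArg Complex.ofReal ?_
  fin_cases j <;> fin_cases l <;> simp [kronR, freeKron, rt2, rt3] <;> field_simp <;>
    (try rw [hn]) <;> ring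

lemma stokesletZeroMode_zero (hξ : 0 < ξ) : stokesletZeroMode ξ 1 0 =
    ((Real.eulerMascheroniConstant + Real.log (ξ ^ 2) - 1) •
      !![(2 : ℝ), 0, 0; 0, 1, 0; 0, 0, 1]).map Complex.ofReal := by
  ext j l
  rw [stokesletZeroMode_apply hξ one_pos, norm_zero, zero_pow two_ne_zero, biharmProfile₁_zero,
    Real.log_one, Real.log_pow, Matrix.map_apply]
  refine congrArg Complex.ofReal ?_
  fin_cases j <;> fin_cases l <;> simp [kronR, freeKron] <;> ring

/-! ### The stresslet -/

lemma stressletZeroMode_eq (hξ : 0 < ξ) (hℓ : 0 < ℓ) (j l m : Fin 3) :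
    (fun r => stressletZeroMode ξ r j l m) = fun r =>
      stressletOp j l m (lift (biharmZeroMode ξ ℓ)) (join 0 r) := by
  rw [biharmZeroMode_eq_radial hξ hℓ]
  simp only [stressletOp_lift (differentiable_biharmProfile ξ ℓ)
    (differentiable_freeDeriv_biharmProfile ξ ℓ) (differentiable_freeDeriv_two_biharmProfile ξ ℓ)]
  have hc := contPolyBdd_freeDeriv_three_biharmProfile ξ ℓ
  have hw := isWeakInvFt_freeDeriv_three hξ hℓ
  have hsum := fun p : Fin 3 => IsWeakInvFt.sum fun n => hw p n n
  have hs := ((((hsum m).const_mul (kron j l)).add ((hsum l).const_mul (kron m j))).add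
    ((hsum j).const_mul (kron l m))).add ((hw j l m).const_mul (-2))
  simp only [← stressletHatF_eq] at hs
  have hcs := fun p : Fin 3 => ContPolyBdd.sum fun n => hc p n n
  exact (hs.eq_invFt2 (integrable_stressletHatF hξ j l m)
    (((((ContPolyBdd.const _).mul (hcs m)).add ((ContPolyBdd.const _).mul (hcs l))).add
      ((ContPolyBdd.const _).mul (hcs j))).add ((ContPolyBdd.const _).mul (hc j l m))).1).symm

lemma stressletZeroMode_apply (hξ : 0 < ξ) (r : E2) (j l m : Fin 3) :
    stressletZeroMode ξ r j l m = (((kronR j l * coord m r + kronR j m * coord l r +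
      kronR l m * coord j r) * (16 * biharmProfile₂ ξ (‖r‖ ^ 2) +
        8 * ‖r‖ ^ 2 * biharmProfile₃ ξ (‖r‖ ^ 2)) -
      (8 * (freeKron j l * coord m r + freeKron j m * coord l r + freeKron l m * coord j r) *
        biharmProfile₂ ξ (‖r‖ ^ 2) +
        16 * coord j r * coord l r * coord m r * biharmProfile₃ ξ (‖r‖ ^ 2)) : ℝ) : ℂ) := by
  have h := congr_fun (stressletZeroMode_eq hξ one_pos j l m) r
  rw [biharmZeroMode_eq_radial hξ one_pos, stressletOp_lift (differentiable_biharmProfile ξ 1)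
    (differentiable_freeDeriv_biharmProfile ξ 1) (differentiable_freeDeriv_two_biharmProfile ξ 1)]
    at h
  have hk : kron m j = kron j m := by simp only [kron, eq_comm]
  have hsum : ∀ p : Fin 3,
      ∑ n : Fin 3, freeDeriv p (freeDeriv n (freeDeriv n (radial (biharmProfile ξ 1)))) r =
      ((coord p r * (16 * biharmProfile₂ ξ (‖r‖ ^ 2) +
        8 * ‖r‖ ^ 2 * biharmProfile₃ ξ (‖r‖ ^ 2)) : ℝ) : ℂ) := fun p => by
    simp only [freeDeriv_three_radial (hasDerivAt_biharmProfile ξ 1)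
      (hasDerivAt_biharmProfile₁ ξ 1) (hasDerivAt_biharmProfile₂ ξ), Fin.sum_univ_three, radial]
    rw [mul_assoc 8 (‖r‖ ^ 2), norm_sq_eq_coord r]
    fin_cases p <;> simp [freeKron] <;> ring
  rw [hsum, hsum, hsum, hk] at h
  simp only [freeDeriv_three_radial (hasDerivAt_biharmProfile ξ 1)
    (hasDerivAt_biharmProfile₁ ξ 1) (hasDerivAt_biharmProfile₂ ξ), radial, kron_eq] at h
  rw [h]
  push_cast
  ring

lemma stressletZeroMode_symm (hξ : 0 < ξ) (r : E2) (j l m : Fin 3) :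
    stressletZeroMode ξ r j l m = stressletZeroMode ξ r l j m ∧
    stressletZeroMode ξ r j l m = stressletZeroMode ξ r j m l := by
  have hk : ∀ a b : Fin 3, kronR a b = kronR b a := fun a b => by simp only [kronR, eq_comm]
  have hf : ∀ a b : Fin 3, freeKron a b = freeKron b a := fun a b => by
    fin_cases a <;> fin_cases b <;> simp [freeKron]
  simp only [stressletZeroMode_apply hξ]
  constructor
  · rw [hk j l, hf j l]; congr 1; ring
  · rw [hk l m, hf l m]; congr 1; ring

lemma continuous_stressletZeroMode (hξ : 0 < ξ) : Continuous (stressletZeroMode ξ) := by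
  refine continuous_pi fun j => continuous_pi fun l => continuous_pi fun m => ?_
  exact continuous_invFt2 (integrable_stressletHatF hξ j l m)

lemma stressletZeroMode_zero (hξ : 0 < ξ) : stressletZeroMode ξ 0 = 0 := by
  funext j l m
  rw [stressletZeroMode_apply hξ]
  simp [coord_at_zero]

end Stokes

end SinglyPeriodic

open SinglyPeriodic in
theorem mainTheorem7 (ξ : ℝ) (hξ : 0 < ξ) :
    -- harmonic kernel: the unscreened transforms, the limit of the splitting, and the zero mode
    (∀ k₁ : ℝ, k₁ ≠ 0 →
      IsDistribInvFt 0 (fun κ => harmHat (join k₁ κ)) (harmBar k₁) ∧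
      Integrable fun κ => harmHat (join k₁ κ) * ewaldHat ξ (join k₁ κ)) ∧
    (∀ r : E2, r ≠ 0 →
      Tendsto (fun k₁ : ℝ => harmBar k₁ r - harmBarF ξ k₁ r) (𝓝[≠] 0)
        (𝓝 ((expInt 1 (ξ ^ 2 * ‖r‖ ^ 2) : ℝ) : ℂ))) ∧
    (∀ ℓ : ℝ, 0 < ℓ →
      IsDistribInvFt 1 (fun κ => harmHat (join 0 κ)) (harmBarZero ℓ) ∧
      IsDistribInvFt 1 (fun κ => harmHat (join 0 κ) * ewaldHat ξ (join 0 κ))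
        (harmZeroMode ξ ℓ) ∧
      ∀ r : E2, r ≠ 0 →
        harmZeroMode ξ ℓ r =
          ((-Real.log (‖r‖ ^ 2 / ℓ ^ 2) - expInt 1 (ξ ^ 2 * ‖r‖ ^ 2) : ℝ) : ℂ)) ∧
    -- biharmonic kernel: the unscreened transforms, the limit of the splitting, the zero mode
    (∀ k₁ : ℝ, k₁ ≠ 0 →
      (Integrable fun κ => biharmHat (join k₁ κ)) ∧
      (Integrable fun κ => biharmHat (join k₁ κ) * hasimotoHat ξ (join k₁ κ)) ∧
      ∀ r : E2, r ≠ 0 →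
        biharmBar k₁ r = ((-(2 * ‖r‖ / |k₁|) * besselK 1 (|k₁| * ‖r‖) : ℝ) : ℂ)) ∧
    (∀ r : E2,
      Tendsto (fun k₁ : ℝ => biharmBar k₁ r - biharmBarF ξ k₁ r) (𝓝[≠] 0)
        (𝓝 ((-(1 / (2 * ξ ^ 2)) * expInt 2 (ξ ^ 2 * ‖r‖ ^ 2) : ℝ) : ℂ))) ∧
    (∀ ℓ : ℝ, 0 < ℓ →
      IsDistribInvFt 3 (fun κ => biharmHat (join 0 κ)) (biharmBarZero ℓ) ∧
      IsDistribInvFt 3 (fun κ => biharmHat (join 0 κ) * hasimotoHat ξ (join 0 κ))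
        (biharmZeroMode ξ ℓ) ∧
      (∀ r : E2,
        biharmZeroMode ξ ℓ r =
          ((-‖r‖ ^ 2 * Real.log (‖r‖ / ℓ)
            + 1 / (2 * ξ ^ 2) * expInt 2 (ξ ^ 2 * ‖r‖ ^ 2) : ℝ) : ℂ)) ∧
      ContDiff ℝ 3 (biharmZeroMode ξ ℓ)) ∧
    -- rotlet
    (∀ j l : Fin 3, Integrable fun κ => rotletHatF ξ j l (join 0 κ)) ∧
    (∀ ℓ : ℝ, 0 < ℓ → ∀ r : E2, r ≠ 0 →
      DifferentiableAt ℝ (harmZeroMode ξ ℓ) r ∧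
      ∀ j l : Fin 3,
        rotletZeroMode ξ r j l = rotletOp j l (lift (harmZeroMode ξ ℓ)) (join 0 r)) ∧
    (∀ r : E2, r ≠ 0 →
      rotletZeroMode ξ r =
        ((2 * phi1 ξ r / ‖r‖) •
          !![0, rt3 r, -rt2 r;
             -rt3 r, 0, 0;
             rt2 r, 0, 0]).map Complex.ofReal) ∧
    Tendsto (rotletZeroMode ξ) (𝓝[≠] 0) (𝓝 0) ∧
    rotletZeroMode ξ 0 = 0 ∧
    -- stokeslet
    (∀ ℓ : ℝ, 0 < ℓ → ∀ j l : Fin 3,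
      IsDistribInvFt 1 (fun κ => stokesletHatF ξ j l (join 0 κ))
        (fun r => stokesletZeroMode ξ ℓ r j l)) ∧
    (∀ ℓ : ℝ, 0 < ℓ → ∀ r : E2,
      stokesletZeroMode ξ ℓ r =
        stokesletZeroMode ξ 1 r
          + (Real.log ℓ • !![4, 0, 0; 0, 2, 0; 0, 0, 2]).map Complex.ofReal) ∧
    (∀ r : E2, r ≠ 0 →
      stokesletZeroMode ξ 1 r =
        (-!![2 * (phi0 ξ r + phi1 ξ r), 0, 0;
             0, phi0 ξ r + 2 * rt3 r ^ 2 * phi1 ξ r, -2 * rt2 r * rt3 r * phi1 ξ r;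
             0, -2 * rt2 r * rt3 r * phi1 ξ r,
               phi0 ξ r + 2 * rt2 r ^ 2 * phi1 ξ r]).map Complex.ofReal) ∧
    Tendsto (stokesletZeroMode ξ 1) (𝓝[≠] 0)
      (𝓝 (((Real.eulerMascheroniConstant + Real.log (ξ ^ 2) - 1) •
        !![(2 : ℝ), 0, 0; 0, 1, 0; 0, 0, 1]).map Complex.ofReal)) ∧
    stokesletZeroMode ξ 1 0 =
      ((Real.eulerMascheroniConstant + Real.log (ξ ^ 2) - 1) •
        !![(2 : ℝ), 0, 0; 0, 1, 0; 0, 0, 1]).map Complex.ofReal ∧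
    -- stresslet
    (∀ j l m : Fin 3, Integrable fun κ => stressletHatF ξ j l m (join 0 κ)) ∧
    (∀ ℓ : ℝ, 0 < ℓ → ∀ (r : E2) (j l m : Fin 3),
      stressletZeroMode ξ r j l m =
        stressletOp j l m (lift (biharmZeroMode ξ ℓ)) (join 0 r)) ∧
    (∀ (r : E2) (j l m : Fin 3),
      stressletZeroMode ξ r j l m = stressletZeroMode ξ r l j m ∧
      stressletZeroMode ξ r j l m = stressletZeroMode ξ r j m l) ∧
    (∀ r : E2, r ≠ 0 → ∀ R : ℝ, R = -4 / ‖r‖ →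
      stressletZeroMode ξ r 0 0 0 = 0 ∧
      stressletZeroMode ξ r 0 0 1 =
        ((R * rt2 r * (2 * phi1 ξ r - phi2 ξ r) : ℝ) : ℂ) ∧
      stressletZeroMode ξ r 0 0 2 =
        ((R * rt3 r * (2 * phi1 ξ r - phi2 ξ r) : ℝ) : ℂ) ∧
      stressletZeroMode ξ r 0 1 1 = 0 ∧
      stressletZeroMode ξ r 0 1 2 = 0 ∧
      stressletZeroMode ξ r 0 2 2 = 0 ∧
      stressletZeroMode ξ r 1 1 1 =
        ((R * rt2 r * (3 * phi1 ξ r - (rt2 r ^ 2 + 3 * rt3 r ^ 2) * phi2 ξ r) : ℝ) : ℂ) ∧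
      stressletZeroMode ξ r 1 1 2 =
        ((R * rt3 r * (phi1 ξ r - (rt3 r ^ 2 - rt2 r ^ 2) * phi2 ξ r) : ℝ) : ℂ) ∧
      stressletZeroMode ξ r 1 2 2 =
        ((R * rt2 r * (phi1 ξ r - (rt2 r ^ 2 - rt3 r ^ 2) * phi2 ξ r) : ℝ) : ℂ) ∧
      stressletZeroMode ξ r 2 2 2 =
        ((R * rt3 r * (3 * phi1 ξ r - (3 * rt2 r ^ 2 + rt3 r ^ 2) * phi2 ξ r) : ℝ) : ℂ)) ∧
    Tendsto (stressletZeroMode ξ) (𝓝[≠] 0) (𝓝 0) ∧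
    stressletZeroMode ξ 0 = 0 := by
  refine ⟨fun k hk => ⟨(isWeakInvFt_harmBar hk).isDistribInvFt, (harmBarF_eq hξ hk).1⟩,
    fun r hr => tendsto_harmBar_sub hξ hr,
    fun ℓ hℓ => ⟨(isWeakInvFt_harmBarZero hℓ).isDistribInvFt,
      (isWeakInvFt_harmZeroMode hξ hℓ).isDistribInvFt, fun r hr => ?_⟩,
    fun k hk => ⟨(biharmBar_eq hk).1, (biharmBarF_eq hk).1, fun r hr => biharmBar_eq_besselK hk hr⟩,
    fun r => tendsto_biharmBar_sub hξ r,
    fun ℓ hℓ => ⟨(isWeakInvFt_biharmBarZero hℓ).isDistribInvFt,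
      (isWeakInvFt_biharmZeroMode hξ hℓ).isDistribInvFt, fun r => ?_,
      contDiff_biharmZeroMode hξ hℓ⟩,
    integrable_rotletHatF hξ, fun ℓ hℓ r hr => ?_, fun r hr => rotletZeroMode_of_ne_zero hξ hr, ?_,
    rotletZeroMode_zero hξ, fun ℓ hℓ j l => (isWeakInvFt_stokesletZeroMode hξ hℓ j l).isDistribInvFt,
    fun ℓ hℓ r => stokesletZeroMode_gauge hξ hℓ r,
    fun r hr => stokesletZeroMode_of_ne_zero hξ hr, ?_, stokesletZeroMode_zero hξ,
    integrable_stressletHatF hξ,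
    fun ℓ hℓ r j l m => congr_fun (stressletZeroMode_eq hξ hℓ j l m) r,
    stressletZeroMode_symm hξ, fun r hr R hR => ?_, ?_, stressletZeroMode_zero hξ⟩
  · rw [harmZeroMode_eq hξ ℓ hr, harmBarZero, ← Complex.ofReal_sub, ← div_pow, Real.log_pow]
    push_cast
    ring_nf
  · rw [biharmZeroMode_eq hξ ℓ r, biharmBarZero, ← Complex.ofReal_sub]
    ring_nf
  · have he := harmZeroMode_eventuallyEq hξ hℓ hr
    have hd : DifferentiableAt ℝ (harmZeroMode ξ ℓ) r :=
      (differentiable_radial (hasDerivAt_harmProfile ξ ℓ) r).congr_of_eventuallyEq he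
    refine ⟨hd, fun j l => ?_⟩
    rw [rotletOp_lift j l hd]
    simp only [freeDeriv_congr he]
    exact congr_fun (rotletZeroMode_eq hξ hℓ j l) r
  · rw [← rotletZeroMode_zero hξ]
    exact ((continuous_rotletZeroMode hξ).tendsto 0).mono_left nhdsWithin_le_nhds
  · rw [← stokesletZeroMode_zero hξ]
    exact ((continuous_stokesletZeroMode hξ one_pos).tendsto 0).mono_left nhdsWithin_le_nhds
  · have hr' : ‖r‖ ≠ 0 := norm_ne_zero_iff.2 hr
    have hn := norm_sq_eq_coord r
    simp only [stressletZeroMode_apply hξ, biharmProfile₂_eq hr, biharmProfile₃_eq hr, coord_zero,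
      coord_one, coord_two, hR]
    refine ⟨?_, ?_, ?_, ?_, ?_, ?_, ?_, ?_, ?_, ?_⟩ <;>
      simp only [← Complex.ofReal_zero, Complex.ofReal_inj] <;>
      simp [kronR, freeKron, rt2, rt3] <;> field_simp <;> (try simp only [hn]) <;> ring
  · rw [← stressletZeroMode_zero hξ]
    exact ((continuous_stressletZeroMode hξ).tendsto 0).mono_left nhdsWithin_le_nhds
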